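/- Let $\mathbb G$ be a commutative divisible group of finite Morley rank, that is, a structure in a countable language whose universe carries a $\emptyset$-definable commutative divisible group operation $+$ and whose theory has finite Morley rank (such a group is automatically connected). Assume that $T:=\mathrm{Th}(\mathbb G)$ has quantifier elimination, and that every $\mathrm{acl}^{\mathrm{eq}}(\emptyset)$-definable connected subgroup of any $\mathbb G^n$ is $\emptyset$-definable, where a definable subgroup is called connected if it has no proper definable subgroup of finite index. Let $$\widehat{\mathbb G}=\{(g_n)_{n\ge 1} : g_n\in\mathbb G,\ m\,g_{nm}=g_n \text{ for all } n,m\ge1\},\qquad \rho_n((g_k)_k)=g_n,\qquad \rho=\rho_1 .$$ Let $\widehat T$ be the complete theory of $(\widehat{\mathbb G},\mathbb G)$ in the two-sorted language consisting of the maps $\rho_n$ ($n\ge1$) from the first sort to the second, the full language of $T$ on the second sort and, for each $\emptyset$-definable connected subgroup $H$ of $\mathbb G^n$ ($n\ge 0$), a predicate $\widehat H$ on $n$-tuples of the first sort, interpreted as $\{x\in\widehat{\mathbb G}^n : \rho_i(x)\in H \text{ for all } i\ge 1\}$. (For $\mathbb G'\models T$, the structure $(\widehat{\mathbb G'},\mathbb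 G')$ is defined in the same language, reading $H$ as the subgroup of $\mathbb G'^n$ defined by the formula that defines $H$.) Then $\widehat T$ has quantifier elimination, and it is axiomatised by the following list $\widehat T'$ (that is, a structure for the two-sorted language is a model of $\widehat T$ if and only if it satisfies the list). Here $G,H$ range over the $\emptyset$-definable connected subgroups of the powers of $\mathbb G$, $\mathrm{Tor}$ denotes the set of torsion elements, $K^o$ is the connected component of $K$, and $\ker$ is the set of tuples $x$ of the first sort with $\rho(x)=0$. * (A1) The second sort is a model of $T$. * (A2) If $\Gamma_+$ is the graph of the group operation of $\mathbb G$, then $\widehat{\Gamma_+}$ is the graph of a commutative divisible torsion-free group operation on the first sort, written $+$ and used in the following axioms. * (A3) If $\Delta\le\mathbb G^2$ is the diagonal, then $\widehat\Delta$ is the diagonal of the first sort. * (A4) Each $\widehat H$ is a subgroup. * (A5) $m\,\rho_{nm}=\rho_n$ for all $n,m\ge1$. * (A6) $\rho_n(\widehat H)=H$ for all $n\geq 1$. * (A7) $H\subseteq G$ if and only if $\widehat H\subseteq\widehat G$, for $H,G\le\mathbb G^n$. * (A8) If $H\subseteq G$ and $\mathrm{Tor}(H)=\mathrm{Tor}(G)$,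 then $\widehat H\cap\ker=\widehat G\cap\ker$. * (A9) If a co-ordinate projection $\mathrm{pr}$ maps $G$ onto $H$ with kernel $K$, then (I) the corresponding co-ordinate projection of the first sort maps $\widehat G$ onto $\widehat H$ with kernel $\widehat{K^o}$; and (II) if $N\ge1$ is such that $NK\subseteq K^o$, then $N(\widehat H\cap\ker)\subseteq\mathrm{pr}(\widehat G\cap\ker)$. In particular, $\mathrm{Th}(\widehat{\mathbb G'},\mathbb G')=\widehat T$ for every $\mathbb G'\models T$. -/

import Mathlib

open FirstOrder FirstOrder.Language Cardinal

universe u v w p a b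

namespace ProCover

/-! ### One-sorted model theory -/

section OneSorted

variable (L : FirstOrder.Language.{u, v})

/-- `MorleyRankGE L M r X`: the Morley rank of `X`, computed in the structure `M`, is at least `r`.
Rank at least `0` means non-empty; rank at least `r + 1` means that `X` contains infinitely many
pairwise disjoint sets, definable with parameters from `M`, of rank at least `r`. -/
def MorleyRankGE (M : Type w) [L.Structure M] : ℕ → Set M → Prop
  | 0, X => X.Nonempty
  | r + 1, X => ∃ Y : ℕ → Set M, (∀ i, (Set.univ : Set M).Definable₁ L (Y i)) ∧
      Pairwise (fun i j => Disjoint (Y i) (Y j)) ∧ ∀ i, Y i ⊆ X ∧ MorleyRankGE M r (Y i)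

variable {L}

/-- The theory `T` has finite Morley rank. The Morley rank of the formula `x = x` is its rank
computed in an `ℵ₀`-saturated model; the rank computed in any model is at most that one, so `T` has
finite Morley rank iff the ranks computed in its models are bounded by a natural number. -/
def HasFiniteMorleyRank (T : L.Theory) : Prop :=
  ∃ r : ℕ, ∀ M : T.ModelType.{u, v, max u v w}, ¬ MorleyRankGE L M r Set.univ

/-- Quantifier elimination for a one-sorted theory. -/
def HasQE (T : L.Theory) : Prop :=
  ∀ (n : ℕ) (φ : L.Formula (Fin n)), ∃ ψ : L.Formula (Fin n),
    BoundedFormula.IsQF ψ ∧ T ⊨ᵇ BoundedFormula.iff φ ψ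

/-- The formula `add` defines the graph of addition. -/
def DefinesAdd (add : L.Formula (Fin 3)) (M : Type w) [AddCommGroup M] [L.Structure M] : Prop :=
  ∀ x y z : M, add.Realize ![x, y, z] ↔ x + y = z

variable (L)

/-- `X` is definable over `acl^eq(∅)`: it is a union of classes of a `∅`-definable equivalence
relation with finitely many classes. -/
def IsAclEqDefinable {M : Type w} [L.Structure M] {n : ℕ} (X : Set (Fin n → M)) : Prop :=
  ∃ E : Setoid (Fin n → M),
    (∅ : Set M).Definable L {z : Fin n ⊕ Fin n → M | E (z ∘ Sum.inl) (z ∘ Sum.inr)} ∧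
    Finite (Quotient E) ∧ ∀ x y, E x y → x ∈ X → y ∈ X

/-- `H` is connected: it has no proper subgroup of finite index which is definable
(with parameters). -/
def IsDefConnected {G : Type w} [AddCommGroup G] [L.Structure G] {n : ℕ}
    (H : AddSubgroup (Fin n → G)) : Prop :=
  ∀ A : AddSubgroup (Fin n → G), (Set.univ : Set G).Definable L (A : Set (Fin n → G)) →
    A ≤ H → A.relIndex H ≠ 0 → A = H

/-- A formula without parameters which defines in `G` a connected subgroup of `G^n`, together with
that subgroup. These index the predicates on the cover. -/
structure ConnSubgroup (G : Type w) [AddCommGroup G] [L.Structure G] (n : ℕ) where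
  formula : L.Formula (Fin n)
  subgroup : AddSubgroup (Fin n → G)
  mem_iff : ∀ x, x ∈ subgroup ↔ formula.Realize x
  connected : IsDefConnected L subgroup

end OneSorted

/-! ### The two-sorted language of covers

There is a cover sort and a base sort; the base sort carries the language `L`, there are function
symbols `ρ_n` (`n ≥ 1`) from the cover sort to the base sort, and `P n` is the set of `n`-ary
predicate symbols on the cover sort. The only terms of the cover sort are variables; the terms of
the base sort are the `L`-terms in base variables and in expressions `ρ_n x`, with `x` a cover
variable. -/

/-- `CoverFormula L P m k`: first-order formulas with free cover variables indexed by `Fin m` and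
free base variables indexed by `Fin k`. A quantifier binds the last variable of its sort. -/
inductive CoverFormula (L : FirstOrder.Language.{u, v}) (P : ℕ → Type p) :
    ℕ → ℕ → Type (max u v p)
  | falsum {m k : ℕ} : CoverFormula L P m k
  | eqCover {m k : ℕ} (x y : Fin m) : CoverFormula L P m k
  | mem {m k n : ℕ} (H : P n) (x : Fin n → Fin m) : CoverFormula L P m k
  | eqBase {m k : ℕ} (s t : L.Term ((ℕ+ × Fin m) ⊕ Fin k)) : CoverFormula L P m k
  | rel {m k n : ℕ} (R : L.Relations n) (ts : Fin n → L.Term ((ℕ+ × Fin m) ⊕ Fin k)) :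
      CoverFormula L P m k
  | imp {m k : ℕ} (φ ψ : CoverFormula L P m k) : CoverFormula L P m k
  | allCover {m k : ℕ} (φ : CoverFormula L P (m + 1) k) : CoverFormula L P m k
  | allBase {m k : ℕ} (φ : CoverFormula L P m (k + 1)) : CoverFormula L P m k

/-- A structure for the two-sorted language, with cover sort `A` and base sort `B`. -/
structure CoverStructure (L : FirstOrder.Language.{u, v}) (P : ℕ → Type p)
    (A : Type a) (B : Type b) [L.Structure B] where
  rho : ℕ+ → A → B
  pred : ∀ {n : ℕ}, P n → Set (Fin n → A)

section Semantics

variable {L : FirstOrder.Language.{u, v}} {P : ℕ → Type p}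

/-- Quantifier-free formulas. -/
inductive CoverFormula.IsQF : ∀ {m k : ℕ}, CoverFormula L P m k → Prop
  | falsum {m k : ℕ} : IsQF (.falsum : CoverFormula L P m k)
  | eqCover {m k : ℕ} (x y : Fin m) : IsQF (.eqCover x y : CoverFormula L P m k)
  | mem {m k n : ℕ} (H : P n) (x : Fin n → Fin m) : IsQF (.mem H x : CoverFormula L P m k)
  | eqBase {m k : ℕ} (s t : L.Term ((ℕ+ × Fin m) ⊕ Fin k)) :
      IsQF (.eqBase s t : CoverFormula L P m k)
  | rel {m k n : ℕ} (R : L.Relations n) (ts : Fin n → L.Term ((ℕ+ × Fin m) ⊕ Fin k)) :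
      IsQF (.rel R ts : CoverFormula L P m k)
  | imp {m k : ℕ} {φ ψ : CoverFormula L P m k} (hφ : IsQF φ) (hψ : IsQF ψ) : IsQF (.imp φ ψ)

/-- The value of a term of the base sort. -/
def CoverStructure.termVal {A : Type a} {B : Type b} [L.Structure B] (S : CoverStructure L P A B)
    {m k : ℕ} (x : Fin m → A) (y : Fin k → B) (t : L.Term ((ℕ+ × Fin m) ⊕ Fin k)) : B :=
  t.realize (Sum.elim (fun q => S.rho q.1 (x q.2)) y)

/-- Satisfaction of a formula. -/
def CoverFormula.Realize {A : Type a} {B : Type b} [L.Structure B] (S : CoverStructure L P A B) :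
    ∀ {m k : ℕ}, CoverFormula L P m k → (Fin m → A) → (Fin k → B) → Prop
  | _, _, .falsum, _, _ => False
  | _, _, .eqCover i j, x, _ => x i = x j
  | _, _, .mem H e, x, _ => (fun i => x (e i)) ∈ S.pred H
  | _, _, .eqBase s t, x, y => S.termVal x y s = S.termVal x y t
  | _, _, .rel R ts, x, y => Structure.RelMap R (fun i => S.termVal x y (ts i))
  | _, _, .imp φ ψ, x, y => φ.Realize S x y → ψ.Realize S x y
  | _, _, .allCover φ, x, y => ∀ c : A, φ.Realize S (Fin.snoc x c) y
  | _, _, .allBase φ, x, y => ∀ c : B, φ.Realize S x (Fin.snoc y c)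

/-- The complete theory of a two-sorted structure: the set of all sentences true in it. -/
def CoverStructure.completeTheory {A : Type a} {B : Type b} [L.Structure B]
    (S : CoverStructure L P A B) : Set (CoverFormula L P 0 0) :=
  {σ | σ.Realize S Fin.elim0 Fin.elim0}

/-- `S` is a model of the set of sentences `Θ`. -/
def CoverStructure.Models {A : Type a} {B : Type b} [L.Structure B]
    (S : CoverStructure L P A B) (Θ : Set (CoverFormula L P 0 0)) : Prop :=
  ∀ σ ∈ Θ, σ.Realize S Fin.elim0 Fin.elim0

/-- Quantifier elimination for a two-sorted theory: every formula is equivalent, in all models, to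
a quantifier-free formula in the same free variables. -/
def HasCoverQE (Θ : Set (CoverFormula L P 0 0)) : Prop :=
  ∀ (m k : ℕ) (φ : CoverFormula L P m k), ∃ ψ : CoverFormula L P m k, ψ.IsQF ∧
    ∀ (A B : Type (max u v p)) [L.Structure B] (S : CoverStructure L P A B), S.Models Θ →
      ∀ (x : Fin m → A) (y : Fin k → B), φ.Realize S x y ↔ ψ.Realize S x y

end Semantics

/-! ### The pro-definable universal cover -/

/-- `Ĝ`, the inverse limit of the maps `[m] : G → G`: sequences `(g_n)` with `m g_{nm} = g_n`. -/
def Hat (G : Type w) [AddCommGroup G] : Type w :=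
  {g : ℕ+ → G // ∀ n m : ℕ+, (m : ℕ) • g (n * m) = g n}

/-- The two-sorted structure `(Ĝ', G')`, for `G'` a model of the theory of `G`: `ρ_n` is the
`n`-th coordinate, and the predicate given by a formula `h` is interpreted as the set of all
`x ∈ Ĝ'^n` such that `ρ_i(x)` satisfies `h` in `G'` for every `i`. -/
def hatStructure (L : FirstOrder.Language.{u, v}) (G : Type w) [AddCommGroup G] [L.Structure G]
    (G' : Type a) [AddCommGroup G'] [L.Structure G'] :
    CoverStructure L (ConnSubgroup L G) (Hat G') G' where
  rho n g := g.1 n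
  pred H := {x | ∀ i : ℕ+, H.formula.Realize (fun j => (x j).1 i)}

/-- The theory `T̂` of `(Ĝ, G)`. -/
def hatTheory (L : FirstOrder.Language.{u, v}) (G : Type w) [AddCommGroup G] [L.Structure G] :
    Set (CoverFormula L (ConnSubgroup L G) 0 0) :=
  (hatStructure L G G).completeTheory

/-! ### The axioms -/

/-- The projection `G^n → G^m` to the co-ordinates `e 0, …, e (m - 1)`. -/
def coordProj {G : Type w} [AddCommGroup G] {n m : ℕ} (e : Fin m ↪ Fin n) :
    (Fin n → G) →+ (Fin m → G) where
  toFun x := x ∘ e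
  map_zero' := rfl
  map_add' _ _ := rfl

/-- The kernel of `ρ = ρ_1` on tuples. -/
def CoverStructure.ker {L : FirstOrder.Language.{u, v}} {P : ℕ → Type p} {A : Type a} {B : Type b}
    [L.Structure B] [AddCommGroup B] (S : CoverStructure L P A B) (n : ℕ) : Set (Fin n → A) :=
  {x | ∀ i, S.rho 1 (x i) = 0}

/-- The axioms (A1)-(A9) on a two-sorted structure `S` whose sorts `A` and `B` carry given group
operations; `base_add` and `cover_add` say that these operations are those whose graphs are defined
by `add`, respectively by the predicate for the graph of addition. The conditions on connected
subgroups under which an axiom is imposed are evaluated in `G`. For divisible `G` the graph of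
addition and the diagonal are divisible, hence connected, so that they do have predicates. -/
structure CoverAxioms {L : FirstOrder.Language.{u, v}} (G : Type w) [AddCommGroup G]
    [L.Structure G] (add : L.Formula (Fin 3)) {A : Type a} {B : Type b} [L.Structure B]
    (S : CoverStructure L (ConnSubgroup L G) A B) [AddCommGroup A] [AddCommGroup B] : Prop where
  /-- (A1) -/
  base : B ⊨ L.completeTheory G
  base_add : DefinesAdd add B
  /-- (A2) -/
  cover_add : ∀ H : ConnSubgroup L G 3,
    (H.subgroup : Set (Fin 3 → G)) = {x | x 0 + x 1 = x 2} →
      S.pred H = {x | x 0 + x 1 = x 2}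
  cover_divisible : ∀ n : ℕ, 0 < n → ∀ x : A, ∃ y : A, n • y = x
  cover_torsionFree : ∀ n : ℕ, 0 < n → ∀ x : A, n • x = 0 → x = 0
  /-- (A3) -/
  diag : ∀ H : ConnSubgroup L G 2,
    (H.subgroup : Set (Fin 2 → G)) = {x | x 0 = x 1} → S.pred H = {x | x 0 = x 1}
  /-- (A4) -/
  isSubgroup : ∀ {n : ℕ} (H : ConnSubgroup L G n),
    ∃ K : AddSubgroup (Fin n → A), (K : Set (Fin n → A)) = S.pred H
  /-- (A5) -/
  coherent : ∀ (n m : ℕ+) (x : A), (m : ℕ) • S.rho (n * m) x = S.rho n x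
  /-- (A6) -/
  epic : ∀ {n : ℕ} (H : ConnSubgroup L G n) (i : ℕ+),
    (fun (x : Fin n → A) (j : Fin n) => S.rho i (x j)) '' S.pred H = {y | H.formula.Realize y}
  /-- (A7) -/
  lattice : ∀ {n : ℕ} (H K : ConnSubgroup L G n),
    (∀ y : Fin n → B, H.formula.Realize y → K.formula.Realize y) ↔ S.pred H ⊆ S.pred K
  /-- (A8) -/
  torsion : ∀ {n : ℕ} (H K : ConnSubgroup L G n), H.subgroup ≤ K.subgroup →
    {x | x ∈ H.subgroup ∧ IsOfFinAddOrder x} = {x | x ∈ K.subgroup ∧ IsOfFinAddOrder x} →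
      S.pred H ∩ S.ker n = S.pred K ∩ S.ker n
  /-- (A9)(I); here `K₀` is the connected component of the kernel of the projection `F → H`. -/
  proj : ∀ {n m : ℕ} (e : Fin m ↪ Fin n) (F : ConnSubgroup L G n) (H : ConnSubgroup L G m)
    (K₀ : ConnSubgroup L G n), F.subgroup.map (coordProj e) = H.subgroup →
    K₀.subgroup ≤ F.subgroup ⊓ (coordProj e).ker →
    K₀.subgroup.relIndex (F.subgroup ⊓ (coordProj e).ker) ≠ 0 →
      coordProj e '' S.pred F = S.pred H ∧
      S.pred K₀ = {x | x ∈ S.pred F ∧ coordProj e x = 0}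
  /-- (A9)(II) -/
  proj_ker : ∀ {n m : ℕ} (e : Fin m ↪ Fin n) (F : ConnSubgroup L G n) (H : ConnSubgroup L G m)
    (K₀ : ConnSubgroup L G n), F.subgroup.map (coordProj e) = H.subgroup →
    K₀.subgroup ≤ F.subgroup ⊓ (coordProj e).ker →
    K₀.subgroup.relIndex (F.subgroup ⊓ (coordProj e).ker) ≠ 0 →
    ∀ N : ℕ, 0 < N → (∀ x ∈ F.subgroup ⊓ (coordProj e).ker, N • x ∈ K₀.subgroup) →
      ∀ y ∈ S.pred H ∩ S.ker m, ∃ x ∈ S.pred F ∩ S.ker n, coordProj e x = N • y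

/-- `S` is a model of the axioms `T̂'`. The group operations are uniquely determined by `S`. -/
def SatisfiesAxioms {L : FirstOrder.Language.{u, v}} (G : Type w) [AddCommGroup G]
    [L.Structure G] (add : L.Formula (Fin 3)) {A : Type a} {B : Type b} [L.Structure B]
    (S : CoverStructure L (ConnSubgroup L G) A B) : Prop :=
  ∃ (_ : AddCommGroup A) (_ : AddCommGroup B), CoverAxioms G add S

end ProCover

/-! Finite Morley rank enters through two facts, kept in `Setting` together with divisibility. The
group $\mathbb G$ has finitely many elements of each finite order, and every $\emptyset$-definable
$K\le\mathbb G^n$ has a multiple $NK$, $N\ge1$, that is divisible. So for $\emptyset$-definable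
groups connected means divisible, and the component of $K$ is $NK$, again $\emptyset$-definable.
Hence images, products and components of preimages under integer-linear maps stay among the groups
that index predicates. The axioms imply that $H\mapsto\widehat H$ commutes with these operations
(`mem_pred_map`, `mem_pred_preimage`); they mention only co-ordinate projections, so a linear map is
replaced by its graph.

Every formula is shown equivalent to a finite union of cells: $x\in\widehat H$, $x\notin\widehat
K_i$ for finitely many $K_i$, and a base formula in the $\rho_q(x)$ and $y$. Boolean operations and
base quantifiers are harmless; the content is $\exists c$ on the cover sort. The fibre of $\widehat
H$ over $x$ is a coset of $\widehat C$, with $C$ the component of the kernel of the projection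
$H\to\mathbb G^m$. A base formula sees $c$ only through some $\rho_n(c)$, and membership in the
image of the fibre under $\rho_n$ is controlled by a base formula (`exists_fiber_rho`). For a
removed $\widehat K$, let $C'\le C$ be the group obtained in the same way from the component of
$H\cap K$.

If $C$ and $C'$ have the same torsion, the axiom `torsion` says that $\widehat C$ and $\widehat{C'}$
have the same points killed by $\rho$, and membership in $\widehat K$ becomes a condition on $x$ and
a base formula (`mem_pred_of_not_isGeneric`). If some torsion point of $C$ lies outside $C'$, then
$\widehat{C'}$ meets $\widehat C\cap\ker\rho_n$ in a subgroup of infinite index; by B. H. Neumann's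
lemma on coverings by cosets, finitely many such $\widehat K$ never exhaust the points with a
prescribed $\rho_n$ (`exists_avoid`), and they can be dropped.

The translation into cells does not depend on the model. For a sentence it gives cells whose truth
is decided by $T$, so any two structures satisfying the axioms are elementarily equivalent. The
inverse limit over any model of $T$ satisfies the axioms, and conversely the axioms pass to all
models of $\widehat T$ because they amount to first-order sentences. Quantifier elimination for $T$
is used only at the end, to remove quantifiers inside the base formulas of the cells. -/

namespace ProCover

/-! ### Integer-linear terms -/

/-- Terms in the language of abelian groups. -/
inductive LinTerm (α : Type*) where
  | var (i : α)
  | zero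
  | add (s t : LinTerm α)
  | neg (t : LinTerm α)

namespace LinTerm

variable {α β X Y : Type*} [AddCommGroup X] [AddCommGroup Y]

/-- The value of a term at a tuple of group elements. -/
def eval : LinTerm α → (α → X) →+ X
  | var i => Pi.evalAddMonoidHom (fun _ => X) i
  | zero => 0
  | add s t => s.eval + t.eval
  | neg t => -t.eval

@[simp] lemma eval_var (i : α) (x : α → X) : (var i).eval x = x i := rfl
@[simp] lemma eval_zero (x : α → X) : (zero : LinTerm α).eval x = 0 := rfl
@[simp] lemma eval_add (s t : LinTerm α) (x : α → X) :
    (add s t).eval x = s.eval x + t.eval x := rfl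
@[simp] lemma eval_neg (t : LinTerm α) (x : α → X) : (neg t).eval x = -t.eval x := rfl

/-- The multiple `n t` of a term. -/
def nsmul : ℕ → LinTerm α → LinTerm α
  | 0, _ => zero
  | n + 1, t => add (nsmul n t) t

@[simp] lemma eval_nsmul (n : ℕ) (t : LinTerm α) (x : α → X) :
    (nsmul n t).eval x = n • t.eval x := by
  induction n with
  | zero => simp [nsmul]
  | succ n ih => simp [nsmul, ih, succ_nsmul]

/-- The difference of two terms. -/
def sub (s t : LinTerm α) : LinTerm α := add s (neg t)

@[simp] lemma eval_sub (s t : LinTerm α) (x : α → X) :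
    (sub s t).eval x = s.eval x - t.eval x := by
  simp [sub, sub_eq_add_neg]

/-- Renaming of variables. -/
def rename (f : α → β) : LinTerm α → LinTerm β
  | var i => var (f i)
  | zero => zero
  | add s t => add (rename f s) (rename f t)
  | neg t => neg (rename f t)

@[simp] lemma eval_rename (f : α → β) (t : LinTerm α) (x : β → X) :
    (t.rename f).eval x = t.eval (x ∘ f) := by
  induction t <;> simp_all [rename]

/-- The homomorphism of powers given by a tuple of terms. -/
def evalHom (c : β → LinTerm α) : (α → X) →+ (β → X) :=
  AddMonoidHom.mk' (fun x j => (c j).eval x) fun x y => by ext j; simp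

@[simp] lemma evalHom_apply (c : β → LinTerm α) (x : α → X) (j : β) :
    evalHom c x j = (c j).eval x := rfl

lemma evalHom_var (e : β → α) (x : α → X) : evalHom (fun j => var (e j)) x = x ∘ e := rfl

lemma evalHom_nsmul (r : ℕ) (x : α → X) :
    evalHom (fun j => nsmul r (var j)) x = r • x := by
  ext
  simp

/-- The equations defining the graph of a linear map. -/
def graphEqn {n m : ℕ} (c : Fin m → LinTerm (Fin n)) (j : Fin m) : LinTerm (Fin (n + m)) :=
  .sub ((c j).rename (Fin.castAdd m)) (.var (Fin.natAdd n j))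

lemma evalHom_graphEqn {n m : ℕ} (c : Fin m → LinTerm (Fin n)) (z : Fin (n + m) → X) :
    evalHom (graphEqn c) z = evalHom c (z ∘ Fin.castAdd m) - z ∘ Fin.natAdd n := by
  ext
  simp [graphEqn]

end LinTerm

/-! ### Formulas for linear maps -/

section LinFormula

variable {L : FirstOrder.Language.{u, v}} {α : Type*} {β : Type*}

/-- The graph of the function given by a term. -/
noncomputable def graphFormula (add : L.Formula (Fin 3)) : LinTerm α → L.Formula (α ⊕ Fin 1)
  | .var i => Term.equal (.var (.inl i)) (.var (.inr 0))
  -- Zero is the only solution of $y+y=y$; the same device names zero in the clause for negation.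
  | .zero => add.relabel fun _ => .inr 0
  | .add s t => Formula.iExs (Fin 2)
      ((graphFormula add s).relabel (Sum.elim (fun i => .inl (.inl i)) fun _ => .inr 0) ⊓
        ((graphFormula add t).relabel (Sum.elim (fun i => .inl (.inl i)) fun _ => .inr 1) ⊓
          add.relabel ![.inr 0, .inr 1, .inl (.inr 0)]))
  | .neg t => Formula.iExs (Fin 2)
      ((graphFormula add t).relabel (Sum.elim (fun i => .inl (.inl i)) fun _ => .inr 0) ⊓
        (add.relabel (fun _ => .inr 1) ⊓ add.relabel ![.inr 0, .inl (.inr 0), .inr 1]))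

variable {M : Type*} [AddCommGroup M] [L.Structure M] {add : L.Formula (Fin 3)}

lemma DefinesAdd.realize (h : DefinesAdd add M) (x : Fin 3 → M) :
    add.Realize x ↔ x 0 + x 1 = x 2 := by
  rw [← h]
  exact iff_of_eq (congrArg _ (by ext i; fin_cases i <;> rfl))

lemma realize_graphFormula (h : DefinesAdd add M) (t : LinTerm α) (x : α → M) (y : Fin 1 → M) :
    (graphFormula add t).Realize (Sum.elim x y) ↔ t.eval x = y 0 := by
  have key : ∀ (y : Fin 1 → M) (z : Fin 2 → M) (i : Fin 2), (Sum.elim (Sum.elim x y) z ∘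
      Sum.elim (fun i => .inl (.inl i)) fun _ : Fin 1 => .inr i) = Sum.elim x fun _ => z i := by
    intro y z i; ext (j | j) <;> rfl
  induction t generalizing y with
  | var i => simp [graphFormula]
  | zero => simp [graphFormula, Formula.realize_relabel, h.realize, eq_comm]
  | add s t ihs iht =>
    simp only [graphFormula, Formula.realize_iExs, Formula.realize_inf, Formula.realize_relabel,
      key, ihs, iht, h.realize]
    constructor
    · rintro ⟨z, h1, h2, h3⟩
      simpa [h1, h2] using h3
    · exact fun h0 => ⟨![s.eval x, t.eval x], by simpa using h0⟩
  | neg t iht =>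
    simp only [graphFormula, Formula.realize_iExs, Formula.realize_inf, Formula.realize_relabel,
      key, iht, h.realize]
    constructor
    · rintro ⟨z, h1, h2, h3⟩
      have h4 : z 1 = 0 := by simpa using h2
      have h5 : z 0 + y 0 = 0 := by simpa [h4] using h3
      simpa [h1] using neg_eq_of_add_eq_zero_right h5
    · intro h0
      refine ⟨![t.eval x, 0], by simp, by simp, ?_⟩
      simp [← h0]

/-- The preimage of a definable set under a linear map. -/
noncomputable def pull (add : L.Formula (Fin 3)) [Finite β] (c : β → LinTerm α)
    (φ : L.Formula β) : L.Formula α :=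
  Formula.iExs β (Formula.iInf (fun j => (graphFormula add (c j)).relabel
    (Sum.elim (fun i => .inl i) fun _ => .inr j)) ⊓ φ.relabel .inr)

/-- The image of a definable set under a linear map. -/
noncomputable def push (add : L.Formula (Fin 3)) [Finite α] [Finite β] (c : β → LinTerm α)
    (φ : L.Formula α) : L.Formula β :=
  Formula.iExs α (Formula.iInf (fun j => (graphFormula add (c j)).relabel
    (Sum.elim (fun i => .inr i) fun _ => .inl j)) ⊓ φ.relabel .inr)

lemma realize_pull (h : DefinesAdd add M) [Finite β] (c : β → LinTerm α) (φ : L.Formula β)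
    (x : α → M) : (pull add c φ).Realize x ↔ φ.Realize (LinTerm.evalHom c x) := by
  have key : ∀ (z : β → M) (j : β), (Sum.elim x z ∘
      Sum.elim (fun i => .inl i) fun _ : Fin 1 => .inr j) = Sum.elim x fun _ => z j := by
    intro z i; ext (j | j) <;> rfl
  simp only [pull, Formula.realize_iExs, Formula.realize_inf, Formula.realize_iInf,
    Formula.realize_relabel, key, realize_graphFormula h, Sum.elim_comp_inr]
  constructor
  · rintro ⟨z, h1, h2⟩
    rwa [show LinTerm.evalHom c x = z from funext h1]
  · exact fun h0 => ⟨_, fun j => rfl, h0⟩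

lemma realize_push (h : DefinesAdd add M) [Finite α] [Finite β] (c : β → LinTerm α)
    (φ : L.Formula α) (y : β → M) :
    (push add c φ).Realize y ↔ ∃ x, φ.Realize x ∧ LinTerm.evalHom c x = y := by
  have key : ∀ (z : α → M) (j : β), (Sum.elim y z ∘
      Sum.elim (fun i => .inr i) fun _ : Fin 1 => .inl j) = Sum.elim z fun _ => y j := by
    intro z i; ext (j | j) <;> rfl
  simp only [push, Formula.realize_iExs, Formula.realize_inf, Formula.realize_iInf,
    Formula.realize_relabel, key, realize_graphFormula h, Sum.elim_comp_inr]
  exact exists_congr fun z => ⟨fun ⟨h1, h2⟩ => ⟨h2, funext h1⟩, fun ⟨h1, h2⟩ => ⟨congrFun h2, h1⟩⟩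

/-- A formula for the zero tuple. -/
noncomputable def zeroFormula (add : L.Formula (Fin 3)) (β : Type*) [Finite β] : L.Formula β :=
  Formula.iInf fun j => add.relabel fun _ => j

lemma realize_zeroFormula (h : DefinesAdd add M) [Finite β] (x : β → M) :
    (zeroFormula add β).Realize x ↔ x = 0 := by
  simp [zeroFormula, h.realize, Formula.realize_relabel, funext_iff]

end LinFormula

/-- A universally quantified formula without parameters holds in a model of the complete theory of
`G` if and only if it holds in `G`. -/
lemma forall_realize_iff {L : FirstOrder.Language.{u, v}} {G : Type w} [L.Structure G]
    {B : Type b} [L.Structure B] (hB : B ⊨ L.completeTheory G) {α : Type*} [Finite α]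
    (φ : L.Formula α) : (∀ x : α → B, φ.Realize x) ↔ ∀ x : α → G, φ.Realize x := by
  have := realize_iff_of_model_completeTheory G B
    (Formula.iAlls α (φ.relabel Sum.inr : L.Formula (Empty ⊕ α)))
  simpa [Sentence.Realize, Formula.realize_iAlls, Formula.realize_relabel] using this

/-! ### Definable groups of finite Morley rank -/

section MorleyRank

variable {L : FirstOrder.Language.{u, v}} {M : Type w} [L.Structure M]

lemma MorleyRankGE.mono {r : ℕ} {X Y : Set M} (h : X ⊆ Y) (hX : MorleyRankGE L M r X) :
    MorleyRankGE L M r Y := by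
  cases r with
  | zero => exact Set.Nonempty.mono h hX
  | succ r =>
    obtain ⟨Z, hZ, hd, hs⟩ := hX
    exact ⟨Z, hZ, hd, fun i => ⟨(hs i).1.trans h, (hs i).2⟩⟩

/-- Isomorphisms carry sets definable with parameters to such sets. This serves to move $\mathbb G$
into the universe over which `HasFiniteMorleyRank` quantifies. -/
lemma MorleyRankGE.image {N : Type a} [L.Structure N] (e : M ≃[L] N) {r : ℕ} {X : Set M}
    (h : MorleyRankGE L M r X) : MorleyRankGE L N r (e '' X) := by
  induction r generalizing X with
  | zero => exact Set.Nonempty.image e h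
  | succ r ih =>
    obtain ⟨Z, hZ, hd, hs⟩ := h
    refine ⟨fun i => e '' Z i, fun i => ?_, fun i j hij => ?_, fun i =>
      ⟨Set.image_mono (hs i).1, ih (hs i).2⟩⟩
    · obtain ⟨φ, hφ⟩ := Set.definable_iff_exists_formula_sum.1 (hZ i)
      let g : ↥(Set.univ : Set M) → ↥(Set.univ : Set N) := fun m => ⟨e m, trivial⟩
      refine Set.definable_iff_exists_formula_sum.2 ⟨φ.relabel (Sum.map g id), ?_⟩
      ext x
      have hx := Set.ext_iff.1 hφ (e.symm ∘ x)
      have h2 := StrongHomClass.realize_formula e φ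
        (v := Sum.elim (fun m : (Set.univ : Set M) => (m : M)) (e.symm ∘ x))
      simp only [Set.mem_ofPred_eq, Set.mem_image, Formula.realize_relabel] at hx ⊢
      rw [show Sum.elim (fun m : (Set.univ : Set N) => (m : N)) x ∘ Sum.map g id
          = e ∘ Sum.elim (fun m : (Set.univ : Set M) => (m : M)) (e.symm ∘ x) by
        ext (j | j) <;> simp [g] ]
      refine Iff.trans ?_ (hx.trans h2.symm)
      exact ⟨fun ⟨y, hy, hyx⟩ => by simpa [← hyx] using hy, fun h => ⟨_, h, by simp⟩⟩
    · exact (Set.disjoint_image_iff e.injective).2 (hd hij)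

variable [AddCommGroup M] {add : L.Formula (Fin 3)}

/-- Parameters from `A` are admitted as variables of the terms, so that translates and multiples of
definable sets are handled together. -/
lemma definable_linear_preimage (h : DefinesAdd add M) {A : Set M} {α β : Type} [Finite β]
    {s : Set (β → M)} (hs : A.Definable L s) (c : β → LinTerm (A ⊕ α)) :
    A.Definable L {x : α → M | (fun j => (c j).eval (Sum.elim (↑) x)) ∈ s} := by
  obtain ⟨φ, hφ⟩ := Set.definable_iff_exists_formula_sum.1 hs
  refine Set.definable_iff_exists_formula_sum.2 ⟨Formula.iExs β
    (Formula.iInf (fun j => (graphFormula add (c j)).relabel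
      (Sum.elim (fun i => .inl i) fun _ => .inr j)) ⊓
        φ.relabel (Sum.elim (fun i => .inl (.inl i)) .inr)), ?_⟩
  ext x
  have key : ∀ (z : β → M) (j : β), (Sum.elim (Sum.elim (fun i : A => (i : M)) x) z ∘
      Sum.elim (fun i => .inl i) fun _ : Fin 1 => .inr j) =
        Sum.elim (Sum.elim (↑) x) fun _ => z j := by
    intro z i; ext (j | j) <;> rfl
  have key2 : ∀ z : β → M, (Sum.elim (Sum.elim (fun i : A => (i : M)) x) z ∘
      Sum.elim (fun i => .inl (.inl i)) .inr) = Sum.elim (↑) z := by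
    intro z; ext (j | j) <;> rfl
  simp only [Formula.realize_iExs, Formula.realize_inf, Formula.realize_iInf,
    Formula.realize_relabel, key, key2, realize_graphFormula h, Set.mem_ofPred_eq]
  have hφ' : ∀ z, z ∈ s ↔ φ.Realize (Sum.elim (↑) z) := fun z => Set.ext_iff.1 hφ z
  rw [hφ']
  constructor
  · exact fun h0 => ⟨_, fun j => rfl, h0⟩
  · rintro ⟨z, h1, h2⟩
    rwa [show (fun j => (c j).eval (Sum.elim (↑) x)) = z from funext h1]

lemma definable₁_linear_preimage (h : DefinesAdd add M) {A : Set M} {s : Set M}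
    (hs : A.Definable₁ L s) (t : LinTerm (A ⊕ Fin 1)) :
    A.Definable₁ L {x : M | t.eval (Sum.elim (↑) fun _ => x) ∈ s} := by
  have := definable_linear_preimage (s := {x : Fin 1 → M | x 0 ∈ s}) h hs fun _ => t
  refine cast (congrArg (fun s => A.Definable L s) ?_) this
  ext x
  simp [show (fun _ => x 0) = x by ext i; rw [Subsingleton.elim i 0] ]

/-- A group of finite Morley rank has no infinite descending chain of definable subgroups. -/
lemma wellFoundedLT_definable₁ (h : DefinesAdd add M)
    (hr : ∃ r, ¬ MorleyRankGE L M r (Set.univ : Set M)) :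
    WellFoundedLT {H : AddSubgroup M // (Set.univ : Set M).Definable₁ L (H : Set M)} := by
  refine ⟨RelEmbedding.wellFounded_iff_isEmpty.2 ⟨fun f => ?_⟩⟩
  obtain ⟨r, hr⟩ := hr
  have hlt : ∀ i j, i < j → f j < f i := fun i j hij => f.map_rel_iff.2 hij
  have hle : ∀ i j, i ≤ j → (f j).1 ≤ (f i).1 := fun i j hij => by
    rcases hij.eq_or_lt with rfl | hij
    exacts [le_rfl, (hlt i j hij).le]
  -- All cosets of all members of the chain are treated at once: each contains infinitely many
  -- disjoint cosets of later members, so the rank exceeds every natural number.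
  suffices ∀ r i a, MorleyRankGE L M r {x | x - a ∈ (f i).1} from
    hr ((this r 0 0).mono (Set.subset_univ _))
  intro r
  induction r with
  | zero => exact fun i a => ⟨a, by simp⟩
  | succ r ih =>
    intro i a
    -- With $d_j\in f(i+j)\setminus f(i+j+1)$, the cosets $a+d_j+f(i+j+1)$ are disjoint: for $j<k$ a
    -- common point would put $d_j$ into $f(i+j+1)$, since $d_k$ lies there.
    have hex : ∀ j, ∃ x ∈ (f (i + j)).1, x ∉ (f (i + j + 1)).1 := fun j =>
      SetLike.exists_of_lt (hlt _ _ (Nat.lt_succ_self (i + j)))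
    choose d hd hd' using hex
    have hdis : ∀ j k, j < k → Disjoint {x | x - (a + d j) ∈ (f (i + j + 1)).1}
        {x | x - (a + d k) ∈ (f (i + k + 1)).1} := by
      intro j k hjk
      refine Set.disjoint_left.2 fun x hx hx' => hd' j ?_
      have h1 := hle (i + j + 1) (i + k + 1) (by omega) hx'
      have h2 := hle (i + j + 1) (i + k) (by omega) (hd k)
      have h3 := sub_mem (add_mem h1 h2) hx
      rwa [show x - (a + d k) + d k - (x - (a + d j)) = d j by abel] at h3
    refine ⟨fun j => {x | x - (a + d j) ∈ (f (i + j + 1)).1}, fun j => ?_, fun j k hjk => ?_,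
      fun j => ⟨fun x hx => ?_, ih _ _⟩⟩
    · simpa using definable₁_linear_preimage h (f (i + j + 1)).2
        ((LinTerm.var (.inr 0)).sub (.var (.inl ⟨a + d j, trivial⟩)))
    · rcases lt_or_gt_of_ne hjk with hjk | hjk
      exacts [hdis j k hjk, (hdis k j hjk).symm]
    · have h1 := add_mem (hle i (i + j + 1) (by omega) hx) (hle i (i + j) (by omega) (hd j))
      rwa [show x - (a + d j) + d j = x - a by abel] at h1

/-- Induction on $n$ avoids ranks of subsets of powers. A subgroup is sent to its projection to the
first $n$ co-ordinates and its section along the last one; nested subgroups with the same projection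
and section are equal, so this map into a product of well-founded orders is strictly increasing. -/
lemma wellFoundedLT_definable (h : DefinesAdd add M)
    (hr : ∃ r, ¬ MorleyRankGE L M r (Set.univ : Set M)) : ∀ n : ℕ,
    WellFoundedLT {H : AddSubgroup (Fin n → M) //
      (Set.univ : Set M).Definable L (H : Set (Fin n → M))}
  | 0 => by
    have : Subsingleton (AddSubgroup (Fin 0 → M)) :=
      ⟨fun H K => by
        ext x
        rw [Subsingleton.elim x 0]
        exact iff_of_true (zero_mem H) (zero_mem K)⟩
    infer_instance
  | n + 1 => by
    have := wellFoundedLT_definable₁ h hr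
    have := wellFoundedLT_definable h hr n
    let q : (Fin (n + 1) → M) →+ (Fin n → M) := coordProj Fin.castSuccEmb
    let s : M →+ (Fin (n + 1) → M) := AddMonoidHom.single (fun _ => M) (Fin.last n)
    let F : {H : AddSubgroup (Fin (n + 1) → M) //
        (Set.univ : Set M).Definable L (H : Set (Fin (n + 1) → M))} →
        {H : AddSubgroup (Fin n → M) // (Set.univ : Set M).Definable L (H : Set (Fin n → M))} ×
        {H : AddSubgroup M // (Set.univ : Set M).Definable₁ L (H : Set M)} := fun H =>
      (⟨H.1.map q, H.2.image_comp Fin.castSucc⟩, ⟨H.1.comap s, by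
        have := definable_linear_preimage h H.2 (α := Fin 1)
          (Fin.snoc (fun _ => .zero) (.var (.inr 0)) : Fin (n + 1) → _)
        refine cast (congrArg (fun s => (Set.univ : Set M).Definable L s) ?_) this
        ext x
        simp only [SetLike.mem_coe, Set.mem_ofPred_eq, AddSubgroup.mem_comap]
        refine iff_of_eq (congrArg (· ∈ H.1) ?_)
        ext j
        refine Fin.lastCases ?_ (fun j => ?_) j <;> simp [s, Fin.castSucc_ne_last]⟩)
    have hF : StrictMono F := by
      intro H K hHK
      have hle : H.1 ≤ K.1 := hHK.le
      refine lt_of_le_not_ge ⟨AddSubgroup.map_mono hle, AddSubgroup.comap_mono hle⟩ fun hge => ?_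
      refine hHK.not_ge fun x hx => ?_
      obtain ⟨y, hy, hyx⟩ := hge.1 (⟨x, hx, rfl⟩ : q x ∈ K.1.map q)
      have hxy : x - y = s (x (Fin.last n) - y (Fin.last n)) := by
        ext j
        refine Fin.lastCases ?_ (fun j => ?_) j
        · simp [s]
        · have hj : y j.castSucc = x j.castSucc := congrFun hyx j
          simp [s, Fin.castSucc_ne_last, hj]
      have h1 : s (x (Fin.last n) - y (Fin.last n)) ∈ K.1 :=
        hxy ▸ sub_mem hx (hle hy)
      have h2 : s (x (Fin.last n) - y (Fin.last n)) ∈ H.1 := hge.2 h1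
      rw [← hxy] at h2
      simpa using add_mem h2 hy
    exact hF.wellFoundedLT

/-- A divisible group of finite Morley rank has finitely many elements of each finite order. -/
lemma finite_torsion_of_rank (h : DefinesAdd add M)
    (hdiv : ∀ n : ℕ, 0 < n → ∀ g : M, ∃ h : M, n • h = g)
    (hr : ∃ r, ¬ MorleyRankGE L M r (Set.univ : Set M)) {n : ℕ} (hn : 0 < n) :
    {g : M | n • g = 0}.Finite := by
  by_contra hinf
  have hinf : {g : M | n • g = 0}.Infinite := hinf
  obtain ⟨r, hr⟩ := hr
  -- Pulling back along multiplication by $n$ raises a lower bound for the rank by one. At rank $0$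
  -- the infinite fibre over a point supplies infinitely many singletons; afterwards disjoint
  -- families are pulled back. The whole group is its own preimage, so its rank would be unbounded.
  have step : ∀ r (X : Set M), MorleyRankGE L M r X →
      MorleyRankGE L M (r + 1) {x | n • x ∈ X} := by
    intro r
    induction r with
    | zero =>
      rintro X ⟨y, hy⟩
      obtain ⟨g, rfl⟩ := hdiv n hn y
      refine ⟨fun i => {g + hinf.natEmbedding _ i}, fun i => ?_, fun i j hij => ?_, fun i =>
        ⟨?_, Set.singleton_nonempty _⟩⟩
      · refine cast (congrArg _ ?_) (Set.Definable.singleton (L := L)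
          (g + hinf.natEmbedding _ i : M) |>.mono (Set.subset_univ _))
        ext x
        rfl
      · simpa using fun h0 => hij ((hinf.natEmbedding _).injective (Subtype.ext h0))
      · have := (hinf.natEmbedding _ i).2
        simpa [show n • ((hinf.natEmbedding _ i : {g : M | n • g = 0}) : M) = 0 from this] using hy
    | succ r ih =>
      rintro X ⟨Z, hZ, hd, hs⟩
      refine ⟨fun i => {x | n • x ∈ Z i}, fun i => ?_, fun i j hij =>
        Set.disjoint_left.2 fun x hx hx' => Set.disjoint_left.1 (hd hij) hx hx', fun i =>
        ⟨fun x hx => (hs i).1 hx, ih _ (hs i).2⟩⟩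
      simpa using definable₁_linear_preimage h (hZ i) (.nsmul n (.var (.inr 0)))
  suffices ∀ r, MorleyRankGE L M r (Set.univ : Set M) from hr (this r)
  intro r
  induction r with
  | zero => exact ⟨0, trivial⟩
  | succ r ih => simpa using step r _ ih

end MorleyRank

/-! ### Divisibility and connectedness -/

/-- The properties of divisible groups of finite Morley rank that control the cover. -/
structure Setting (L : FirstOrder.Language.{u, v}) (G : Type w) [AddCommGroup G] [L.Structure G]
    (add : L.Formula (Fin 3)) : Prop where
  definesAdd : DefinesAdd add G
  divisible : ∀ n : ℕ, 0 < n → ∀ g : G, ∃ h : G, n • h = g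
  finite_torsion : ∀ n : ℕ, 0 < n → {g : G | n • g = 0}.Finite
  -- In other words $NK$ is divisible; it is the component of $K$.
  exists_divisible_nsmul : ∀ {n : ℕ} (φ : L.Formula (Fin n)) (K : AddSubgroup (Fin n → G)),
    (∀ x, x ∈ K ↔ φ.Realize x) →
      ∃ N, 0 < N ∧ ∀ r, 0 < r → ∀ x ∈ K, ∃ y ∈ K, N • x = r • N • y

lemma definable_of_formula {L : FirstOrder.Language.{u, v}} {M : Type w} [L.Structure M]
    {α : Type*} (A : Set M) (φ : L.Formula α) : A.Definable L {x : α → M | φ.Realize x} :=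
  (Set.empty_definable_iff.2 ⟨φ, rfl⟩).mono (Set.empty_subset _)

/-- The definable groups $j!\,K$ decrease, so one of them is minimal. For that $j$ and any $r>0$ one
has $j!\,K=(j+r)!\,K$, and $r\cdot j!$ divides $(j+r)!$; this makes $j!\,K$ divisible by $r$. -/
lemma Setting.of_rank {L : FirstOrder.Language.{u, v}} {G : Type w} [AddCommGroup G]
    [L.Structure G] {add : L.Formula (Fin 3)} (hadd : DefinesAdd add G)
    (hdiv : ∀ n : ℕ, 0 < n → ∀ g : G, ∃ h : G, n • h = g)
    (hr : ∃ r, ¬ MorleyRankGE L G r (Set.univ : Set G)) : Setting L G add where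
  definesAdd := hadd
  divisible := hdiv
  finite_torsion n hn := finite_torsion_of_rank hadd hdiv hr hn
  exists_divisible_nsmul {n} φ K hK := by
    have := wellFoundedLT_definable hadd hr n
    let F : ℕ → {H : AddSubgroup (Fin n → G) //
        (Set.univ : Set G).Definable L (H : Set (Fin n → G))} := fun j =>
      ⟨K.map (nsmulAddMonoidHom j.factorial), by
        refine cast (congrArg _ ?_) (definable_of_formula Set.univ
          (push add (fun i => .nsmul j.factorial (.var i)) φ))
        ext x
        simp only [Set.mem_ofPred_eq, realize_push hadd, SetLike.mem_coe, AddSubgroup.mem_map, hK]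
        exact exists_congr fun y => and_congr_right fun _ => iff_of_eq (congrArg (· = x) (by
          ext; simp))⟩
    obtain ⟨_, ⟨j, rfl⟩, hj⟩ := wellFounded_lt.has_min (Set.range F) ⟨_, 0, rfl⟩
    refine ⟨j.factorial, j.factorial_pos, fun r hr x hx => ?_⟩
    have hdvd : r * j.factorial ∣ (j + r).factorial :=
      (mul_comm r j.factorial ▸ mul_dvd_mul_left _ (Nat.dvd_factorial hr le_rfl)).trans
        (Nat.factorial_mul_factorial_dvd_factorial_add j r)
    obtain ⟨q, hq⟩ := hdvd
    have hle : F (j + r) ≤ F j := by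
      rintro _ ⟨y, hy, rfl⟩
      refine ⟨(r * q) • y, nsmul_mem hy _, ?_⟩
      simp only [nsmulAddMonoidHom_apply, hq, ← mul_smul]
      congr 1
      ring
    have hge : F j ≤ F (j + r) := by
      by_contra hne
      exact hj _ ⟨_, rfl⟩ (lt_of_le_not_ge hle hne)
    obtain ⟨y, hy, hyx⟩ := hge (⟨x, hx, rfl⟩ : (nsmulAddMonoidHom j.factorial) x ∈ (F j).1)
    refine ⟨q • y, nsmul_mem hy _, ?_⟩
    simp only [nsmulAddMonoidHom_apply] at hyx
    rw [← hyx, hq]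
    simp only [← mul_smul, mul_assoc]

lemma Setting.of_hasFiniteMorleyRank {L : FirstOrder.Language.{u, v}} {G : Type w}
    [AddCommGroup G] [L.Structure G] {add : L.Formula (Fin 3)} (hadd : DefinesAdd add G)
    (hdiv : ∀ n : ℕ, 0 < n → ∀ g : G, ∃ h : G, n • h = g)
    (hfmr : HasFiniteMorleyRank.{u, v, w} (L.completeTheory G)) : Setting L G add := by
  refine .of_rank hadd hdiv (hfmr.imp fun r hr hG => ?_)
  let e : G ≃ ULift.{max u v} G := Equiv.ulift.symm
  let _ : L.Structure (ULift.{max u v} G) := e.inducedStructure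
  let E : G ≃[L] ULift.{max u v} G := e.inducedStructureEquiv
  have : ULift.{max u v} G ⊨ L.completeTheory G :=
    StrongHomClass.theory_model E (T := L.completeTheory G)
  refine hr (Theory.ModelType.of (L.completeTheory G) (ULift.{max u v} G)) ?_
  exact (hG.image E).mono (Set.subset_univ _)

section Divisible

variable {L : FirstOrder.Language.{u, v}} {G : Type w} [AddCommGroup G] [L.Structure G]
  {add : L.Formula (Fin 3)} {n m : ℕ}

/-- A subgroup of finite index $r$ in $H$ contains $rH=H$. -/
lemma isDefConnected_of_divisible {H : AddSubgroup (Fin n → G)}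
    (hH : ∀ r : ℕ, 0 < r → ∀ x ∈ H, ∃ y ∈ H, r • y = x) : IsDefConnected L H := by
  refine fun A _ hA hi => le_antisymm hA fun x hx => ?_
  obtain ⟨y, hy, rfl⟩ := hH _ (Nat.pos_of_ne_zero hi) x hx
  exact AddSubgroup.nsmul_relIndex_mem A hy

variable (E : Setting L G add)
include E

/-- For $x\in K$ write $Nx=Ny$ with $y\in C$. Then $x-y$ is killed by $N$ and represents the coset
of $x$, and there are only finitely many such elements. -/
lemma Setting.relIndex_ne_zero {C K : AddSubgroup (Fin n → G)} {N : ℕ} (hN : 0 < N)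
    (hC : ∀ x ∈ C, ∃ y ∈ C, N • y = x) (hCK : C ≤ K) (hK : ∀ x ∈ K, N • x ∈ C) :
    C.relIndex K ≠ 0 := by
  have hfin : {t : Fin n → G | N • t = 0}.Finite := by
    refine (Set.Finite.pi' fun _ : Fin n => E.finite_torsion N hN).subset fun t ht i => ?_
    exact congrFun ht i
  have : Finite {t : Fin n → G | N • t = 0 ∧ t ∈ K} := (hfin.subset fun t ht => ht.1).to_subtype
  have : Finite (K ⧸ C.addSubgroupOf K) := by
    refine Finite.of_surjective (fun t : {t : Fin n → G | N • t = 0 ∧ t ∈ K} =>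
      ((⟨t.1, t.2.2⟩ : K) : K ⧸ C.addSubgroupOf K)) fun q => ?_
    induction q using QuotientAddGroup.induction_on with
    | H x =>
      obtain ⟨y, hy, hyx⟩ := hC _ (hK x x.2)
      refine ⟨⟨x.1 - y, by simp [smul_sub, hyx], sub_mem x.2 (hCK hy)⟩, ?_⟩
      refine QuotientAddGroup.eq.2 ?_
      simpa [AddSubgroup.mem_addSubgroupOf] using hy
  exact AddSubgroup.index_ne_zero_of_finite

/-- The divisible multiple $NF$ has finite index in $F$ by `relIndex_ne_zero`, so connectedness
forces $NF=F$. -/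
lemma Setting.connSubgroup_divisible (F : ConnSubgroup L G n) {r : ℕ} (hr : 0 < r)
    {x : Fin n → G} (hx : x ∈ F.subgroup) : ∃ y ∈ F.subgroup, r • y = x := by
  obtain ⟨N, hN, hdiv⟩ := E.exists_divisible_nsmul F.formula F.subgroup F.mem_iff
  have hD := F.connected (F.subgroup.map (nsmulAddMonoidHom N)) (by
      refine cast (congrArg _ ?_) (definable_of_formula Set.univ
        (push add (fun i => .nsmul N (.var i)) F.formula))
      ext x
      simp only [Set.mem_ofPred_eq, realize_push E.definesAdd, SetLike.mem_coe,
        AddSubgroup.mem_map, F.mem_iff]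
      exact exists_congr fun y => and_congr_right fun _ => iff_of_eq (congrArg (· = x) (by
        ext; simp))) (by rintro _ ⟨y, hy, rfl⟩; exact nsmul_mem hy N)
    (E.relIndex_ne_zero hN (by
      rintro _ ⟨y, hy, rfl⟩
      obtain ⟨z, hz, hzy⟩ := hdiv N hN y hy
      exact ⟨_, ⟨z, hz, rfl⟩, hzy.symm⟩) (by
      rintro _ ⟨y, hy, rfl⟩; exact nsmul_mem hy N) fun x hx => ⟨x, hx, rfl⟩)
  rw [← hD] at hx
  obtain ⟨y, hy, rfl⟩ := hx
  obtain ⟨z, hz, hzy⟩ := hdiv r hr y hy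
  exact ⟨_, nsmul_mem hz N, hzy.symm⟩

end Divisible

/-! ### Operations on connected subgroups -/

section Operations

variable {L : FirstOrder.Language.{u, v}} {G : Type w} [AddCommGroup G] [L.Structure G]
  {add : L.Formula (Fin 3)} {n m : ℕ}

/-- The group `C` is the connected component of `K`: as `C` is divisible, this means that `K / C` is
a torsion group of finite exponent. -/
def IsComponent (C : ConnSubgroup L G n) (K : AddSubgroup (Fin n → G)) : Prop :=
  C.subgroup ≤ K ∧ ∃ N, 0 < N ∧ ∀ x ∈ K, N • x ∈ C.subgroup

lemma isComponent_of_relIndex {C : ConnSubgroup L G n} {K : AddSubgroup (Fin n → G)}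
    (h : C.subgroup ≤ K) (hi : C.subgroup.relIndex K ≠ 0) : IsComponent C K :=
  ⟨h, _, Nat.pos_of_ne_zero hi, fun _ hx => AddSubgroup.nsmul_relIndex_mem _ hx⟩

namespace Setting

variable (E : Setting L G add)

include E in
lemma relIndex_of_isComponent {C : ConnSubgroup L G n} {K : AddSubgroup (Fin n → G)}
    (h : IsComponent C K) : C.subgroup.relIndex K ≠ 0 := by
  obtain ⟨h, N, hN, hK⟩ := h
  exact E.relIndex_ne_zero hN (fun x hx => E.connSubgroup_divisible C hN hx) h hK

include E in
/-- A connected subgroup contained in a subgroup is contained in its connected component. -/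
lemma le_of_isComponent {C D : ConnSubgroup L G n} {K : AddSubgroup (Fin n → G)}
    (h : IsComponent C K) (hD : D.subgroup ≤ K) : D.subgroup ≤ C.subgroup := by
  obtain ⟨-, N, hN, hK⟩ := h
  intro x hx
  obtain ⟨y, hy, rfl⟩ := E.connSubgroup_divisible D hN hx
  exact hK y (hD hy)

/-- The image of a connected subgroup under a linear map. -/
noncomputable def map (F : ConnSubgroup L G n) (c : Fin m → LinTerm (Fin n)) :
    ConnSubgroup L G m where
  formula := push add c F.formula
  subgroup := F.subgroup.map (LinTerm.evalHom c)
  mem_iff x := by simp [realize_push E.definesAdd, F.mem_iff]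
  connected := isDefConnected_of_divisible fun r hr => by
    rintro _ ⟨y, hy, rfl⟩
    obtain ⟨z, hz, rfl⟩ := E.connSubgroup_divisible F hr hy
    exact ⟨_, ⟨z, hz, rfl⟩, (map_nsmul _ _ _).symm⟩

/-- The product of two connected subgroups. -/
noncomputable def prod (F : ConnSubgroup L G n) (H : ConnSubgroup L G m) :
    ConnSubgroup L G (n + m) where
  formula := F.formula.relabel (Fin.castAdd m) ⊓ H.formula.relabel (Fin.natAdd n)
  subgroup := F.subgroup.comap (coordProj (Fin.castAddEmb m)) ⊓
    H.subgroup.comap (coordProj (Fin.natAddEmb n))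
  mem_iff x := by
    simp only [AddSubgroup.mem_inf, AddSubgroup.mem_comap, F.mem_iff, H.mem_iff,
      Formula.realize_inf, Formula.realize_relabel]
    rfl
  connected := isDefConnected_of_divisible fun r hr x hx => by
    obtain ⟨y, hy, hyx⟩ := E.connSubgroup_divisible F hr hx.1
    obtain ⟨z, hz, hzx⟩ := E.connSubgroup_divisible H hr hx.2
    refine ⟨Fin.append y z, ⟨?_, ?_⟩, ?_⟩
    · simpa [coordProj, Function.comp_def] using hy
    · simpa [coordProj, Function.comp_def] using hz
    · ext i
      refine Fin.addCases (fun i => ?_) (fun i => ?_) i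
      · have h : r • y i = x (Fin.castAdd m i) := congrFun hyx i
        simpa using h
      · have h : r • z i = x (Fin.natAdd n i) := congrFun hzx i
        simpa using h

lemma mem_prod {F : ConnSubgroup L G n} {H : ConnSubgroup L G m} {x : Fin (n + m) → G} :
    x ∈ (E.prod F H).subgroup ↔ x ∘ Fin.castAdd m ∈ F.subgroup ∧ x ∘ Fin.natAdd n ∈ H.subgroup :=
  Iff.rfl

/-- The whole power. -/
noncomputable def top (n : ℕ) : ConnSubgroup L G n where
  formula := ⊤
  subgroup := ⊤
  mem_iff x := by simp
  connected := isDefConnected_of_divisible fun r hr x _ => by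
    choose f hf using fun i => E.divisible r hr (x i)
    exact ⟨f, trivial, funext hf⟩

/-- The trivial subgroup. -/
noncomputable def bot (n : ℕ) : ConnSubgroup L G n where
  formula := zeroFormula add _
  subgroup := ⊥
  mem_iff x := by simp [realize_zeroFormula E.definesAdd]
  connected := isDefConnected_of_divisible fun r hr x hx =>
    ⟨0, zero_mem _, by simpa using (AddSubgroup.mem_bot.1 hx).symm⟩

/-- The graph of addition. -/
noncomputable def addGraph : ConnSubgroup L G 3 where
  formula := add
  -- Written as an image of $\mathbb G^2$, so that its connectedness is that of an image.
  subgroup := (⊤ : AddSubgroup (Fin 2 → G)).map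
    (LinTerm.evalHom ![.var 0, .var 1, .add (.var 0) (.var 1)])
  mem_iff x := by
    rw [E.definesAdd.realize]
    constructor
    · rintro ⟨y, -, rfl⟩
      simp
    · intro h
      refine ⟨![x 0, x 1], trivial, ?_⟩
      ext i
      fin_cases i <;> simp [h]
  connected := (E.map (E.top 2) _).connected

lemma mem_addGraph (x : Fin 3 → G) : x ∈ E.addGraph.subgroup ↔ x 0 + x 1 = x 2 := by
  rw [E.addGraph.mem_iff, ← E.definesAdd.realize]
  rfl

/-- The diagonal. -/
noncomputable def diag : ConnSubgroup L G 2 := E.map (E.top 1) fun _ => .var 0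

lemma mem_diag (x : Fin 2 → G) : x ∈ E.diag.subgroup ↔ x 0 = x 1 := by
  constructor
  · rintro ⟨y, -, rfl⟩
    rfl
  · intro h
    refine ⟨fun _ => x 0, trivial, ?_⟩
    ext i
    fin_cases i <;> simp [h]

include E in
-- The component is $N(F\cap c^{-1}H)$ for a suitable $N$, visibly defined without parameters and
-- divisible; thus it indexes a predicate.
lemma exists_preimage (F : ConnSubgroup L G n) (H : ConnSubgroup L G m)
    (c : Fin m → LinTerm (Fin n)) : ∃ C : ConnSubgroup L G n,
      IsComponent C (F.subgroup ⊓ H.subgroup.comap (LinTerm.evalHom c)) := by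
  obtain ⟨N, hN, hdiv⟩ := E.exists_divisible_nsmul (F.formula ⊓ pull add c H.formula)
    (F.subgroup ⊓ H.subgroup.comap (LinTerm.evalHom c))
    fun x => by simp [realize_pull E.definesAdd, F.mem_iff, H.mem_iff]
  refine ⟨⟨push add (fun i => .nsmul N (.var i)) (F.formula ⊓ pull add c H.formula),
    (F.subgroup ⊓ H.subgroup.comap (LinTerm.evalHom c)).map (nsmulAddMonoidHom N),
    fun x => ?_, ?_⟩, ?_, N, hN, fun x hx => ⟨x, hx, rfl⟩⟩
  · simp only [realize_push E.definesAdd, AddSubgroup.mem_map, AddSubgroup.mem_inf,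
      AddSubgroup.mem_comap, Formula.realize_inf, realize_pull E.definesAdd, F.mem_iff, H.mem_iff]
    exact exists_congr fun y => and_congr_right fun _ => iff_of_eq (congrArg (· = x) (by
      ext; simp))
  · refine isDefConnected_of_divisible fun r hr => ?_
    rintro _ ⟨y, hy, rfl⟩
    obtain ⟨z, hz, hzy⟩ := hdiv r hr y hy
    exact ⟨_, ⟨z, hz, rfl⟩, hzy.symm⟩
  · rintro _ ⟨y, hy, rfl⟩
    exact nsmul_mem hy N

/-- The connected component of `F ∩ c⁻¹ H`. -/
noncomputable def preimage (F : ConnSubgroup L G n) (H : ConnSubgroup L G m)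
    (c : Fin m → LinTerm (Fin n)) : ConnSubgroup L G n :=
  (E.exists_preimage F H c).choose

lemma isComponent_preimage (F : ConnSubgroup L G n) (H : ConnSubgroup L G m)
    (c : Fin m → LinTerm (Fin n)) : IsComponent (E.preimage F H c)
      (F.subgroup ⊓ H.subgroup.comap (LinTerm.evalHom c)) :=
  (E.exists_preimage F H c).choose_spec

/-- The graph of the restriction of a linear map to a connected subgroup. -/
noncomputable def graph (F : ConnSubgroup L G n) (c : Fin m → LinTerm (Fin n)) :
    ConnSubgroup L G (n + m) :=
  E.map F (Fin.append .var c)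

lemma append_evalHom {X : Type*} [AddCommGroup X] (c : Fin m → LinTerm (Fin n)) (x : Fin n → X) :
    LinTerm.evalHom (Fin.append .var c) x = Fin.append x (LinTerm.evalHom c x) := by
  ext i
  refine Fin.addCases (fun i => ?_) (fun i => ?_) i <;> simp

lemma mem_graph (F : ConnSubgroup L G n) (c : Fin m → LinTerm (Fin n)) (x : Fin (n + m) → G) :
    x ∈ (E.graph F c).subgroup ↔ ∃ y ∈ F.subgroup, Fin.append y (LinTerm.evalHom c y) = x := by
  simp only [← append_evalHom]
  rfl

section Transfer

variable {B : Type b} [L.Structure B] [AddCommGroup B] (hB : B ⊨ L.completeTheory G)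
  (hadd : DefinesAdd add B)
include E hB hadd

/-- A linear relation between definable sets passes to models of the theory of `G`. -/
lemma realize_of_forall {α : Type*} [Finite α] {φ : L.Formula α} {c : Fin n → LinTerm α}
    {C : ConnSubgroup L G n} (h : ∀ x, φ.Realize x → LinTerm.evalHom c x ∈ C.subgroup)
    {y : α → B} (hy : φ.Realize y) : C.formula.Realize (LinTerm.evalHom c y) := by
  have := Formula.realize_imp.1 ((forall_realize_iff hB (φ.imp (pull add c C.formula))).2
    (fun x => ?_) y) hy
  · rwa [realize_pull hadd] at this
  · rw [Formula.realize_imp, realize_pull E.definesAdd, ← C.mem_iff]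
    exact h x

lemma realize_nsmul_of_forall {C : ConnSubgroup L G n} {φ : L.Formula (Fin n)} {N : ℕ}
    (h : ∀ x, φ.Realize x → N • x ∈ C.subgroup) {y : Fin n → B} (hy : φ.Realize y) :
    C.formula.Realize (N • y) := by
  rw [← LinTerm.evalHom_nsmul]
  exact E.realize_of_forall hB hadd (fun x hx => LinTerm.evalHom_nsmul N x ▸ h x hx) hy

lemma exists_realize_of_forall {α : Type*} [Finite α] {φ : L.Formula α} {c : α → LinTerm (Fin n)}
    {C : ConnSubgroup L G n} (h : ∀ x, φ.Realize x → ∃ z ∈ C.subgroup, LinTerm.evalHom c z = x)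
    {y : α → B} (hy : φ.Realize y) : ∃ z, C.formula.Realize z ∧ LinTerm.evalHom c z = y := by
  have := Formula.realize_imp.1 ((forall_realize_iff hB (φ.imp (push add c C.formula))).2
    (fun x => ?_) y) hy
  · rwa [realize_push hadd] at this
  · rw [Formula.realize_imp, realize_push E.definesAdd]
    simpa only [C.mem_iff] using h x

/-- The subgroup defined in a model of the theory of `G`. -/
def realizeSubgroup (H : ConnSubgroup L G n) : AddSubgroup (Fin n → B) :=
  .ofSub {y | H.formula.Realize y} (by
    have h := E.realize_of_forall hB hadd (C := H) (φ := zeroFormula add (Fin n))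
      (c := fun j => .var j) (fun x hx => by
        rw [(realize_zeroFormula E.definesAdd x).1 hx, map_zero]
        exact zero_mem _) (y := 0) (by rw [realize_zeroFormula hadd])
    exact ⟨_, h⟩) fun x hx y hy => by
    have h := E.realize_of_forall hB hadd (C := H) (α := Fin n ⊕ Fin n)
      (φ := H.formula.relabel .inl ⊓ H.formula.relabel .inr)
      (c := fun j => .sub (.var (.inl j)) (.var (.inr j))) (fun x hx => by
        simp only [Formula.realize_inf, Formula.realize_relabel, ← H.mem_iff] at hx
        convert! sub_mem hx.1 hx.2
        ext
        simp) (y := Sum.elim x y) (by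
        simpa [Formula.realize_relabel] using ⟨hx, hy⟩)
    rwa [show LinTerm.evalHom (fun j => .sub (.var (.inl j)) (.var (.inr j))) (Sum.elim x y) =
      x + -y by ext j; simp [sub_eq_add_neg] ] at h

omit hB hadd in
lemma mem_realizeSubgroup (hB : B ⊨ L.completeTheory G) (hadd : DefinesAdd add B)
    {H : ConnSubgroup L G n} {y : Fin n → B} :
    y ∈ E.realizeSubgroup hB hadd H ↔ H.formula.Realize y := Iff.rfl

lemma exists_nsmul_eq (H : ConnSubgroup L G n) {r : ℕ} (hr : 0 < r) {y : Fin n → B}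
    (hy : H.formula.Realize y) : ∃ z, H.formula.Realize z ∧ r • z = y := by
  simp only [← LinTerm.evalHom_nsmul]
  refine E.exists_realize_of_forall hB hadd (fun x hx => ?_) hy
  simp only [LinTerm.evalHom_nsmul]
  exact E.connSubgroup_divisible H hr ((H.mem_iff x).2 hx)

end Transfer

end Setting

end Operations

/-! ### Consequences of the axioms -/

/-- The axioms which imply the remaining ones. -/
structure CoreAxioms {L : FirstOrder.Language.{u, v}} (G : Type w) [AddCommGroup G]
    [L.Structure G] (add : L.Formula (Fin 3)) {A : Type a} {B : Type b} [L.Structure B]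
    (S : CoverStructure L (ConnSubgroup L G) A B) [AddCommGroup A] [AddCommGroup B] : Prop where
  base : B ⊨ L.completeTheory G
  base_add : DefinesAdd add B
  cover_add : ∀ H : ConnSubgroup L G 3,
    (H.subgroup : Set (Fin 3 → G)) = {x | x 0 + x 1 = x 2} →
      S.pred H = {x | x 0 + x 1 = x 2}
  diag : ∀ H : ConnSubgroup L G 2,
    (H.subgroup : Set (Fin 2 → G)) = {x | x 0 = x 1} → S.pred H = {x | x 0 = x 1}
  isSubgroup : ∀ {n : ℕ} (H : ConnSubgroup L G n),
    ∃ K : AddSubgroup (Fin n → A), (K : Set (Fin n → A)) = S.pred H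
  coherent : ∀ (n m : ℕ+) (x : A), (m : ℕ) • S.rho (n * m) x = S.rho n x
  epic : ∀ {n : ℕ} (H : ConnSubgroup L G n) (i : ℕ+),
    (fun (x : Fin n → A) (j : Fin n) => S.rho i (x j)) '' S.pred H = {y | H.formula.Realize y}
  lattice : ∀ {n : ℕ} (H K : ConnSubgroup L G n),
    (∀ y : Fin n → B, H.formula.Realize y → K.formula.Realize y) ↔ S.pred H ⊆ S.pred K
  torsion : ∀ {n : ℕ} (H K : ConnSubgroup L G n), H.subgroup ≤ K.subgroup →
    {x | x ∈ H.subgroup ∧ IsOfFinAddOrder x} = {x | x ∈ K.subgroup ∧ IsOfFinAddOrder x} →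
      S.pred H ∩ S.ker n = S.pred K ∩ S.ker n
  proj : ∀ {n m : ℕ} (e : Fin m ↪ Fin n) (F : ConnSubgroup L G n) (H : ConnSubgroup L G m)
    (K₀ : ConnSubgroup L G n), F.subgroup.map (coordProj e) = H.subgroup →
    K₀.subgroup ≤ F.subgroup ⊓ (coordProj e).ker →
    K₀.subgroup.relIndex (F.subgroup ⊓ (coordProj e).ker) ≠ 0 →
      coordProj e '' S.pred F = S.pred H ∧
      S.pred K₀ = {x | x ∈ S.pred F ∧ coordProj e x = 0}

lemma CoverAxioms.core {L : FirstOrder.Language.{u, v}} {G : Type w} [AddCommGroup G]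
    [L.Structure G] {add : L.Formula (Fin 3)} {A : Type a} {B : Type b} [L.Structure B]
    {S : CoverStructure L (ConnSubgroup L G) A B} [AddCommGroup A] [AddCommGroup B]
    (h : CoverAxioms G add S) : CoreAxioms G add S where
  base := h.base
  base_add := h.base_add
  cover_add := h.cover_add
  diag := h.diag
  isSubgroup := h.isSubgroup
  coherent := h.coherent
  epic := h.epic
  lattice := h.lattice
  torsion := h.torsion
  proj := h.proj

namespace CoreAxioms

variable {L : FirstOrder.Language.{u, v}} {G : Type w} [AddCommGroup G] [L.Structure G]
  {add : L.Formula (Fin 3)} {A : Type a} {B : Type b} [L.Structure B]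
  {S : CoverStructure L (ConnSubgroup L G) A B} [AddCommGroup A] [AddCommGroup B] {n m : ℕ}

section Basic

variable (hS : CoreAxioms G add S)
include hS

lemma realize_of_le {H K : ConnSubgroup L G n} (h : H.subgroup ≤ K.subgroup) {y : Fin n → B}
    (hy : H.formula.Realize y) : K.formula.Realize y := by
  refine Formula.realize_imp.1 ((forall_realize_iff hS.base (H.formula.imp K.formula)).2
    (fun x => Formula.realize_imp.2 fun hx => ?_) y) hy
  exact (K.mem_iff x).1 (h ((H.mem_iff x).2 hx))

lemma pred_mono {H K : ConnSubgroup L G n} (h : H.subgroup ≤ K.subgroup) :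
    S.pred H ⊆ S.pred K :=
  (hS.lattice H K).1 fun _ => hS.realize_of_le h

lemma pred_congr {H K : ConnSubgroup L G n} (h : H.subgroup = K.subgroup) :
    S.pred H = S.pred K :=
  (hS.pred_mono h.le).antisymm (hS.pred_mono h.ge)

lemma add_mem_pred (H : ConnSubgroup L G n) {x y : Fin n → A} (hx : x ∈ S.pred H)
    (hy : y ∈ S.pred H) : x + y ∈ S.pred H := by
  obtain ⟨K, hK⟩ := hS.isSubgroup H
  rw [← hK] at hx hy ⊢
  exact add_mem hx hy

lemma sub_mem_pred (H : ConnSubgroup L G n) {x y : Fin n → A} (hx : x ∈ S.pred H)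
    (hy : y ∈ S.pred H) : x - y ∈ S.pred H := by
  obtain ⟨K, hK⟩ := hS.isSubgroup H
  rw [← hK] at hx hy ⊢
  exact sub_mem hx hy

lemma zero_mem_pred (H : ConnSubgroup L G n) : 0 ∈ S.pred H := by
  obtain ⟨K, hK⟩ := hS.isSubgroup H
  rw [← hK]
  exact zero_mem K

lemma nsmul_mem_pred (H : ConnSubgroup L G n) {x : Fin n → A} (hx : x ∈ S.pred H) (r : ℕ) :
    r • x ∈ S.pred H := by
  obtain ⟨K, hK⟩ := hS.isSubgroup H
  rw [← hK] at hx ⊢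
  exact nsmul_mem hx r

lemma realize_rho (H : ConnSubgroup L G n) {x : Fin n → A} (hx : x ∈ S.pred H) (i : ℕ+) :
    H.formula.Realize fun j => S.rho i (x j) :=
  (Set.ext_iff.1 (hS.epic H i) _).1 ⟨x, hx, rfl⟩

lemma exists_rho_eq (H : ConnSubgroup L G n) {y : Fin n → B} (hy : H.formula.Realize y) (i : ℕ+) :
    ∃ x ∈ S.pred H, (fun j => S.rho i (x j)) = y :=
  (Set.ext_iff.1 (hS.epic H i) _).2 hy

lemma rho_nsmul (i r : ℕ+) (x : A) : S.rho i x = (r : ℕ) • S.rho (i * r) x :=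
  (hS.coherent i r x).symm

end Basic

variable (E : Setting L G add) (hS : CoreAxioms G add S)
include E hS

lemma mem_addGraph {x : Fin 3 → A} : x ∈ S.pred E.addGraph ↔ x 0 + x 1 = x 2 :=
  Set.ext_iff.1 (hS.cover_add E.addGraph (by ext; exact E.mem_addGraph _)) x

lemma mem_diag {x : Fin 2 → A} : x ∈ S.pred E.diag ↔ x 0 = x 1 :=
  Set.ext_iff.1 (hS.diag E.diag (by ext; exact E.mem_diag _)) x

lemma rho_add (i : ℕ+) (x y : A) : S.rho i (x + y) = S.rho i x + S.rho i y := by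
  have := hS.realize_rho E.addGraph (x := ![x, y, x + y]) ((hS.mem_addGraph E).2 rfl) i
  exact ((hS.base_add.realize _).1 this).symm

/-- The map `ρ_i` as a homomorphism. -/
def rhoHom (i : ℕ+) : A →+ B := AddMonoidHom.mk' (S.rho i) (hS.rho_add E i)

omit E hS in
lemma map_coordProj (E : Setting L G add) (F : ConnSubgroup L G n) (e : Fin m → Fin n)
    (he : Function.Injective e) : F.subgroup.map (coordProj ⟨e, he⟩) =
      (E.map F fun j => .var (e j)).subgroup := rfl

lemma coord_image (F : ConnSubgroup L G n) (e : Fin m → Fin n) (he : Function.Injective e) :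
    (fun x => x ∘ e) '' S.pred F = S.pred (E.map F fun j => .var (e j)) := by
  -- The kernel of a projection is the preimage of the trivial group, so it has a component of the
  -- kind that `proj` asks for.
  have hK := E.isComponent_preimage F (E.bot m) fun j => .var (e j)
  exact (hS.proj ⟨e, he⟩ F _ _ (map_coordProj E F e he) hK.1 (E.relIndex_of_isComponent hK)).1

lemma comp_mem_pred {F : ConnSubgroup L G n} {H : ConnSubgroup L G m} (e : Fin m → Fin n)
    (he : Function.Injective e) (h : ∀ x ∈ F.subgroup, x ∘ e ∈ H.subgroup) {x : Fin n → A}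
    (hx : x ∈ S.pred F) : x ∘ e ∈ S.pred H := by
  refine hS.pred_mono (H := E.map F fun j => .var (e j)) ?_ ?_
  · rintro _ ⟨y, hy, rfl⟩
    exact h y hy
  · exact hS.coord_image E F e he ▸ ⟨x, hx, rfl⟩

lemma pred_eq (F : ConnSubgroup L G n) (i j : Fin n) (h : ∀ x ∈ F.subgroup, x i = x j)
    {x : Fin n → A} (hx : x ∈ S.pred F) : x i = x j := by
  by_cases hij : i = j
  · rw [hij]
  have he : Function.Injective ![i, j] := by
    intro k l
    fin_cases k <;> fin_cases l <;> simp [hij, Ne.symm hij]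
  exact (hS.mem_diag E).1 (hS.comp_mem_pred E (H := E.diag) ![i, j] he
    (fun x hx => (E.mem_diag _).2 (h x hx)) hx)

lemma pred_add (F : ConnSubgroup L G n) {i j k : Fin n} (hij : i ≠ j) (hjk : j ≠ k) (hik : i ≠ k)
    (h : ∀ x ∈ F.subgroup, x i + x j = x k) {x : Fin n → A} (hx : x ∈ S.pred F) :
    x i + x j = x k := by
  have he : Function.Injective ![i, j, k] := by
    intro p q
    fin_cases p <;> fin_cases q <;> simp [hij, hjk, hik, hij.symm, hjk.symm, hik.symm]
  exact (hS.mem_addGraph E).1 (hS.comp_mem_pred E (H := E.addGraph) ![i, j, k] he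
    (fun x hx => (E.mem_addGraph _).2 (h x hx)) hx)

/-- The graph of $c$ over $F$ projects onto $F$, so `proj` lifts points of $\widehat F$. That the
lift is the value of $c$ at $x$ is only available after `pred_linear`. -/
lemma exists_graph_lift (F : ConnSubgroup L G n) (c : Fin m → LinTerm (Fin n)) {x : Fin n → A}
    (hx : x ∈ S.pred F) : ∃ y, Fin.append x y ∈ S.pred (E.graph F c) := by
  have h1 := hS.coord_image E (E.graph F c) (Fin.castAdd m) (Fin.castAdd_injective n m)
  have h2 : (E.map (E.graph F c) fun j => .var (Fin.castAdd m j)).subgroup = F.subgroup := by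
    ext z
    constructor
    · rintro ⟨_, ⟨y, hy, rfl⟩, rfl⟩
      rw [Setting.append_evalHom, LinTerm.evalHom_var]
      convert! hy
      ext i
      simp
    · intro hz
      refine ⟨_, ⟨z, hz, rfl⟩, ?_⟩
      rw [Setting.append_evalHom, LinTerm.evalHom_var]
      ext i
      simp
  rw [hS.pred_congr h2] at h1
  obtain ⟨w, hw, rfl⟩ := (Set.ext_iff.1 h1 x).2 hx
  refine ⟨w ∘ Fin.natAdd n, ?_⟩
  convert! hw
  ext i
  refine Fin.addCases (fun i => ?_) (fun i => ?_) i <;> simp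

lemma pred_zero (F : ConnSubgroup L G n) (i : Fin n) (h : ∀ x ∈ F.subgroup, x i = 0)
    {x : Fin n → A} (hx : x ∈ S.pred F) : x i = 0 := by
  -- The aim is $x_i+x_i=x_i$, but `pred_add` needs three distinct co-ordinates. Two auxiliary
  -- co-ordinates that vanish on the group supply them, and `pred_eq` identifies both with $x_i$.
  obtain ⟨y, hw⟩ := hS.exists_graph_lift E F (fun _ : Fin 2 => .zero) hx
  have hG : ∀ z ∈ (E.graph F fun _ : Fin 2 => .zero).subgroup,
      z (Fin.castAdd 2 i) = 0 ∧ ∀ j : Fin 2, z (Fin.natAdd n j) = 0 := by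
    intro z hz
    obtain ⟨u, hu, rfl⟩ := (E.mem_graph _ _ _).1 hz
    simp [h u hu]
  have h1 := hS.pred_eq E _ (Fin.castAdd 2 i) (Fin.natAdd n 0)
    (fun z hz => by rw [(hG z hz).1, (hG z hz).2]) hw
  have h2 := hS.pred_eq E _ (Fin.castAdd 2 i) (Fin.natAdd n 1)
    (fun z hz => by rw [(hG z hz).1, (hG z hz).2]) hw
  have h3 := hS.pred_add E _ (i := Fin.castAdd 2 i) (j := Fin.natAdd n 0) (k := Fin.natAdd n 1)
    (by simp [Fin.ext_iff]; omega) (by simp) (by simp [Fin.ext_iff]; omega)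
    (fun z hz => by simp [hG z hz]) hw
  rw [← h1, ← h2] at h3
  simpa using h3

/-- A linear equation which holds on `F` holds on `F̂`. -/
lemma pred_linear {α : Type*} (t : LinTerm α) : ∀ {n : ℕ} (F : ConnSubgroup L G n) (f : α → Fin n)
    (i : Fin n), (∀ x ∈ F.subgroup, x i = t.eval (x ∘ f)) → ∀ {x : Fin n → A}, x ∈ S.pred F →
      x i = t.eval (x ∘ f) := by
  induction t with
  | var j => exact fun F f i h x hx => hS.pred_eq E F i (f j) h hx
  | zero => exact fun F f i h x hx => hS.pred_zero E F i h hx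
  | add s t ihs iht =>
    intro n F f i h x hx
    -- The values of the subterms become new co-ordinates. The equation splits into one for each
    -- subterm, covered by induction because `F` varies, and one addition between distinct
    -- co-ordinates.
    let c : Fin 2 → LinTerm (Fin n) := ![s.rename f, t.rename f]
    obtain ⟨y, hw⟩ := hS.exists_graph_lift E F c hx
    have hG : ∀ z ∈ (E.graph F c).subgroup, z (Fin.natAdd n 0) = s.eval (z ∘ Fin.castAdd 2 ∘ f) ∧
        z (Fin.natAdd n 1) = t.eval (z ∘ Fin.castAdd 2 ∘ f) ∧
        z (Fin.natAdd n 0) + z (Fin.natAdd n 1) = z (Fin.castAdd 2 i) := by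
      intro z hz
      obtain ⟨u, hu, rfl⟩ := (E.mem_graph _ _ _).1 hz
      simp [c, h u hu, Function.comp_def]
    have h1 := ihs _ _ _ (fun z hz => (hG z hz).1) hw
    have h2 := iht _ _ _ (fun z hz => (hG z hz).2.1) hw
    have h3 := hS.pred_add E _ (by simp) (by simp [Fin.ext_iff]; omega)
      (by simp [Fin.ext_iff]; omega) (fun z hz => (hG z hz).2.2) hw
    rw [h1, h2] at h3
    simpa [Function.comp_def] using h3.symm
  | neg t iht =>
    intro n F f i h x hx
    let c : Fin 2 → LinTerm (Fin n) := ![t.rename f, .zero]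
    obtain ⟨y, hw⟩ := hS.exists_graph_lift E F c hx
    have hG : ∀ z ∈ (E.graph F c).subgroup, z (Fin.natAdd n 0) = t.eval (z ∘ Fin.castAdd 2 ∘ f) ∧
        z (Fin.natAdd n 1) = 0 ∧
        z (Fin.castAdd 2 i) + z (Fin.natAdd n 0) = z (Fin.natAdd n 1) := by
      intro z hz
      obtain ⟨u, hu, rfl⟩ := (E.mem_graph _ _ _).1 hz
      simp [c, h u hu, Function.comp_def]
    have h1 := iht _ _ _ (fun z hz => (hG z hz).1) hw
    have h2 := hS.pred_zero E _ _ (fun z hz => (hG z hz).2.1) hw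
    have h3 := hS.pred_add E _ (by simp [Fin.ext_iff]; omega) (by simp)
      (by simp [Fin.ext_iff]; omega) (fun z hz => (hG z hz).2.2) hw
    rw [h1, h2] at h3
    simpa [Function.comp_def] using eq_neg_of_add_eq_zero_left h3

/-- The equations of the graph persist on the cover by `pred_linear`; they also force the lift given
by `exists_graph_lift` to be the value of $c$. -/
lemma mem_pred_graph {F : ConnSubgroup L G n} {c : Fin m → LinTerm (Fin n)} {z : Fin (n + m) → A} :
    z ∈ S.pred (E.graph F c) ↔ ∃ x ∈ S.pred F, Fin.append x (LinTerm.evalHom c x) = z := by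
  have key : ∀ {z}, z ∈ S.pred (E.graph F c) → z ∘ Fin.castAdd m ∈ S.pred F ∧
      Fin.append (z ∘ Fin.castAdd m) (LinTerm.evalHom c (z ∘ Fin.castAdd m)) = z := by
    intro z hz
    refine ⟨hS.comp_mem_pred E _ (Fin.castAdd_injective n m) (fun y hy => ?_) hz, ?_⟩
    · obtain ⟨u, hu, rfl⟩ := (E.mem_graph _ _ _).1 hy
      simpa [Function.comp_def] using hu
    · ext i
      refine Fin.addCases (fun i => by simp) (fun i => ?_) i
      simp only [Fin.append_right, LinTerm.evalHom_apply]
      refine (hS.pred_linear E (c i) _ _ _ (fun y hy => ?_) hz).symm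
      obtain ⟨u, hu, rfl⟩ := (E.mem_graph _ _ _).1 hy
      simp [Function.comp_def]
  constructor
  · exact fun hz => ⟨_, (key hz).1, (key hz).2⟩
  · rintro ⟨x, hx, rfl⟩
    obtain ⟨y, hy⟩ := hS.exists_graph_lift E F c hx
    have h1 := (key hy).2
    simp only [show Fin.append x y ∘ Fin.castAdd m = x by ext; simp] at h1
    rwa [h1]

/-- The cover of an image is the image of the cover. -/
lemma mem_pred_map {F : ConnSubgroup L G n} {c : Fin m → LinTerm (Fin n)} {y : Fin m → A} :
    y ∈ S.pred (E.map F c) ↔ ∃ x ∈ S.pred F, LinTerm.evalHom c x = y := by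
  have h1 := hS.coord_image E (E.graph F c) (Fin.natAdd n) (Fin.natAdd_injective m n)
  have h2 : (E.map (E.graph F c) fun j => .var (Fin.natAdd n j)).subgroup =
      (E.map F c).subgroup := by
    ext z
    constructor
    · rintro ⟨_, ⟨y, hy, rfl⟩, rfl⟩
      refine ⟨y, hy, ?_⟩
      rw [Setting.append_evalHom, LinTerm.evalHom_var]
      ext i
      simp
    · rintro ⟨y, hy, rfl⟩
      refine ⟨_, ⟨y, hy, rfl⟩, ?_⟩
      rw [Setting.append_evalHom, LinTerm.evalHom_var]
      ext i
      simp
  rw [← hS.pred_congr h2, ← h1]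
  constructor
  · rintro ⟨z, hz, rfl⟩
    obtain ⟨x, hx, rfl⟩ := (hS.mem_pred_graph E).1 hz
    exact ⟨x, hx, by ext; simp⟩
  · rintro ⟨x, hx, rfl⟩
    exact ⟨_, (hS.mem_pred_graph E).2 ⟨x, hx, rfl⟩, by ext; simp⟩

lemma mem_pred_bot {x : Fin n → A} : x ∈ S.pred (E.bot n) ↔ x = 0 := by
  constructor
  · exact fun hx => funext fun i => hS.pred_zero E _ i (fun y hy => by
      rw [AddSubgroup.mem_bot.1 hy]; rfl) hx
  · rintro rfl
    exact hS.zero_mem_pred _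

/-- The cover of the component of a kernel is the kernel on the cover. -/
lemma mem_pred_ker {F C : ConnSubgroup L G n} {c : Fin m → LinTerm (Fin n)}
    (hC : IsComponent C (F.subgroup ⊓ (LinTerm.evalHom c).ker)) {x : Fin n → A} :
    x ∈ S.pred C ↔ x ∈ S.pred F ∧ LinTerm.evalHom c x = 0 := by
  obtain ⟨hC, N, hN, hNC⟩ := hC
  -- The axiom `proj` concerns co-ordinate projections, so the kernel of $c$ is replaced by the
  -- kernel of the projection of its graph to the last $m$ co-ordinates.
  have hcomp : IsComponent (E.graph C c) ((E.graph F c).subgroup ⊓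
      (coordProj ⟨Fin.natAdd n, Fin.natAdd_injective m n⟩).ker) := by
    refine ⟨?_, N, hN, ?_⟩
    · rintro _ ⟨y, hy, rfl⟩
      refine ⟨⟨y, (hC hy).1, rfl⟩, ?_⟩
      have : LinTerm.evalHom c y = 0 := (hC hy).2
      rw [Setting.append_evalHom, this]
      ext i
      simp [coordProj]
    · rintro _ ⟨⟨y, hy, rfl⟩, h0⟩
      rw [← map_nsmul]
      refine ⟨N • y, hNC y ⟨hy, ?_⟩, rfl⟩
      rw [Setting.append_evalHom] at h0
      ext i
      simpa [coordProj] using congrFun h0 i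
  have h := (hS.proj _ (E.graph F c) (E.map (E.graph F c) fun j => .var (Fin.natAdd n j)) _
    (map_coordProj E _ _ _) hcomp.1 (E.relIndex_of_isComponent hcomp)).2
  have h' := Set.ext_iff.1 h (Fin.append x (LinTerm.evalHom c x))
  have hinj : ∀ y : Fin n → A, Fin.append y (LinTerm.evalHom c y) =
      Fin.append x (LinTerm.evalHom c x) ↔ y = x := by
    refine fun y => ⟨fun h => ?_, fun h => by rw [h]⟩
    ext i
    simpa using congrFun h (Fin.castAdd m i)
  simp only [Set.mem_ofPred_eq, hS.mem_pred_graph E, hinj, exists_eq_right] at h'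
  rw [h']
  refine and_congr_right fun _ => ?_
  rw [show coordProj ⟨Fin.natAdd n, Fin.natAdd_injective m n⟩
    (Fin.append x (LinTerm.evalHom c x)) = LinTerm.evalHom c x by ext; simp [coordProj] ]

end CoreAxioms

/-! ### Covers of products and preimages, divisibility, and the remaining axioms -/

namespace CoreAxioms

variable {L : FirstOrder.Language.{u, v}} {G : Type w} [AddCommGroup G] [L.Structure G]
  {add : L.Formula (Fin 3)} {A : Type a} {B : Type b} [L.Structure B]
  {S : CoverStructure L (ConnSubgroup L G) A B} [AddCommGroup A] [AddCommGroup B] {n m : ℕ}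
  (E : Setting L G add) (hS : CoreAxioms G add S)
include E hS

/-- For the converse, $z=(z_1,0)+(0,z_2)$, where each summand lies in the cover of a linear image
contained in the product. -/
lemma mem_pred_prod {F : ConnSubgroup L G n} {H : ConnSubgroup L G m} {z : Fin (n + m) → A} :
    z ∈ S.pred (E.prod F H) ↔ z ∘ Fin.castAdd m ∈ S.pred F ∧ z ∘ Fin.natAdd n ∈ S.pred H := by
  constructor
  · intro hz
    exact ⟨hS.comp_mem_pred E _ (Fin.castAdd_injective n m) (fun y hy => (E.mem_prod.1 hy).1) hz,
      hS.comp_mem_pred E _ (Fin.natAdd_injective m n) (fun y hy => (E.mem_prod.1 hy).2) hz⟩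
  · rintro ⟨h1, h2⟩
    have key : ∀ {k : ℕ} (K : ConnSubgroup L G k) (c : Fin (n + m) → LinTerm (Fin k)),
        (∀ x ∈ K.subgroup, LinTerm.evalHom c x ∈ (E.prod F H).subgroup) → ∀ x ∈ S.pred K,
          LinTerm.evalHom c x ∈ S.pred (E.prod F H) := by
      intro k K c h x hx
      refine hS.pred_mono (H := E.map K c) ?_ ((hS.mem_pred_map E).2 ⟨x, hx, rfl⟩)
      rintro _ ⟨y, hy, rfl⟩
      exact h y hy
    have h1' := key F (Fin.append .var fun _ => .zero)
      (fun x hx => E.mem_prod.2 ⟨?_, ?_⟩) _ h1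
    have h2' := key H (Fin.append (fun _ => .zero) .var)
      (fun x hx => E.mem_prod.2 ⟨?_, ?_⟩) _ h2
    · convert! hS.add_mem_pred _ h1' h2'
      ext i
      refine Fin.addCases (fun i => ?_) (fun i => ?_) i <;> simp
    · convert! zero_mem F.subgroup
      ext i
      simp
    · convert! hx
      ext i
      simp
    · convert! hx
      ext i
      simp
    · convert! zero_mem H.subgroup
      ext i
      simp

/-- The cover of the component of a preimage is the preimage of the cover. -/
lemma mem_pred_preimage {F C : ConnSubgroup L G n} {H : ConnSubgroup L G m}
    {c : Fin m → LinTerm (Fin n)}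
    (hC : IsComponent C (F.subgroup ⊓ H.subgroup.comap (LinTerm.evalHom c))) {x : Fin n → A} :
    x ∈ S.pred C ↔ x ∈ S.pred F ∧ LinTerm.evalHom c x ∈ S.pred H := by
  obtain ⟨hC, N, hN, hNC⟩ := hC
  -- The graph of $c$ over $C$ is the component of the kernel, on $F\times H$, of $(u,v)\mapsto
  -- c(u)-v$. This reduces preimages to kernels and products.
  have hcomp : IsComponent (E.graph C c)
      ((E.prod F H).subgroup ⊓ (LinTerm.evalHom (LinTerm.graphEqn c)).ker) := by
    refine ⟨?_, N, hN, ?_⟩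
    · intro z hz
      obtain ⟨y, hy, rfl⟩ := (E.mem_graph _ _ _).1 hz
      have h1 : Fin.append y (LinTerm.evalHom c y) ∘ Fin.castAdd m = y := by ext; simp
      have h2 : Fin.append y (LinTerm.evalHom c y) ∘ Fin.natAdd n = LinTerm.evalHom c y := by
        ext; simp
      rw [AddSubgroup.mem_inf, E.mem_prod, h1, h2, AddMonoidHom.mem_ker, LinTerm.evalHom_graphEqn,
        h1, h2, sub_self]
      exact ⟨hC hy, rfl⟩
    · intro z hz
      rw [AddSubgroup.mem_inf, E.mem_prod, AddMonoidHom.mem_ker, LinTerm.evalHom_graphEqn,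
        sub_eq_zero] at hz
      obtain ⟨⟨h1, h2⟩, h3⟩ := hz
      refine (E.mem_graph _ _ _).2 ⟨_, hNC (z ∘ Fin.castAdd m) ⟨h1, ?_⟩, ?_⟩
      · exact AddSubgroup.mem_comap.2 (h3.symm ▸ h2)
      · rw [map_nsmul, h3]
        ext i
        refine Fin.addCases (fun i => ?_) (fun i => ?_) i <;> simp
  have hinj : ∀ y : Fin n → A, Fin.append y (LinTerm.evalHom c y) =
      Fin.append x (LinTerm.evalHom c x) ↔ y = x := by
    refine fun y => ⟨fun h => ?_, fun h => by rw [h]⟩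
    ext i
    simpa using congrFun h (Fin.castAdd m i)
  have h := hS.mem_pred_ker E hcomp (x := Fin.append x (LinTerm.evalHom c x))
  have h1 : Fin.append x (LinTerm.evalHom c x) ∘ Fin.castAdd m = x := by ext; simp
  have h2 : Fin.append x (LinTerm.evalHom c x) ∘ Fin.natAdd n = LinTerm.evalHom c x := by
    ext; simp
  simpa only [hS.mem_pred_graph E, hinj, exists_eq_right, hS.mem_pred_prod E, h1,
    h2, LinTerm.evalHom_graphEqn, sub_self, and_true] using h

/-- In one variable, $(y,0,y)$ lies in the cover of the graph of addition, and its first co-ordinate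
in the cover of the projection of that graph. Higher powers are products. -/
lemma mem_pred_top (x : Fin n → A) : x ∈ S.pred (E.top n) := by
  have h1 : ∀ y : Fin 1 → A, y ∈ S.pred (E.top 1) := by
    intro y
    have h := hS.comp_mem_pred E (H := E.top 1) ![0] (Function.injective_of_subsingleton _)
      (fun _ _ => trivial) ((hS.mem_addGraph E (x := ![y 0, 0, y 0])).2 (by simp))
    convert! h
    ext i
    rw [Subsingleton.elim i 0]
    rfl
  induction n with
  | zero =>
    rw [Subsingleton.elim x 0]
    exact hS.zero_mem_pred _
  | succ n ih =>
    exact hS.pred_mono (K := E.top (n + 1)) (fun _ _ => trivial)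
      ((hS.mem_pred_prod E (F := E.top n) (H := E.top 1)).2 ⟨ih _, h1 _⟩)

lemma exists_nsmul_eq {H : ConnSubgroup L G n} {r : ℕ} (hr : 0 < r) {x : Fin n → A}
    (hx : x ∈ S.pred H) : ∃ y ∈ S.pred H, r • y = x := by
  have h : H.subgroup ≤ (E.map H fun j => .nsmul r (.var j)).subgroup := by
    intro x hx
    obtain ⟨y, hy, rfl⟩ := E.connSubgroup_divisible H hr hx
    exact ⟨y, hy, by ext; simp⟩
  obtain ⟨y, hy, rfl⟩ := (hS.mem_pred_map E).1 (hS.pred_mono h hx)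
  exact ⟨y, hy, by ext; simp⟩

lemma cover_divisible {r : ℕ} (hr : 0 < r) (x : A) : ∃ y : A, r • y = x := by
  obtain ⟨y, -, hy⟩ := hS.exists_nsmul_eq E hr (hS.mem_pred_top E fun _ : Fin 1 => x)
  exact ⟨y 0, congrFun hy 0⟩

/-- The $r$-torsion of $\mathbb G$ has exponent dividing $r$, hence trivial component; by
`mem_pred_ker` multiplication by $r$ then has trivial kernel on the cover. -/
lemma eq_zero_of_nsmul {r : ℕ} (hr : 0 < r) {x : A} (hx : r • x = 0) : x = 0 := by
  have hC : IsComponent (E.bot 1)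
      ((E.top 1).subgroup ⊓ (LinTerm.evalHom fun j => .nsmul r (.var j)).ker) := by
    refine ⟨bot_le, r, hr, fun y hy => ?_⟩
    refine AddSubgroup.mem_bot.2 ?_
    rw [← AddMonoidHom.mem_ker.1 hy.2]
    ext
    simp
  have h := (hS.mem_pred_ker E hC (x := fun _ : Fin 1 => x)).2
    ⟨hS.mem_pred_top E _, by ext; simpa using hx⟩
  exact congrFun ((hS.mem_pred_bot E).1 h) 0

/-- If a multiple of an element of the cover of a group lies in the cover of another group, then so
does the element. -/
lemma mem_of_nsmul_mem {H : ConnSubgroup L G n} {r : ℕ} (hr : 0 < r) {x : Fin n → A}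
    (hx : r • x ∈ S.pred H) : x ∈ S.pred H := by
  obtain ⟨y, hy, hyx⟩ := hS.exists_nsmul_eq E hr hx
  convert! hy
  ext i
  refine (sub_eq_zero.1 (hS.eq_zero_of_nsmul E hr ?_)).symm
  rw [smul_sub, sub_eq_zero]
  exact congrFun hyx i

/-- For `proj_ker`, lift $y$ to $x\in\widehat F$. As $\rho(y)=0$, $\rho(x)$ lies in the kernel of
the projection, so $N\rho(x)=\rho(z)$ with $z$ in the cover of its component. Then $Nx-z$ is killed
by $\rho$ and projects to $Ny$. -/
lemma coverAxioms : CoverAxioms G add S where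
  base := hS.base
  base_add := hS.base_add
  cover_add := hS.cover_add
  diag := hS.diag
  isSubgroup := hS.isSubgroup
  coherent := hS.coherent
  epic := hS.epic
  lattice := hS.lattice
  torsion := hS.torsion
  proj := hS.proj
  cover_divisible _ hn x := hS.cover_divisible E hn x
  cover_torsionFree _ hn _ hx := hS.eq_zero_of_nsmul E hn hx
  proj_ker {n m} e F H K₀ h1 h2 h3 N hN hNK y hy := by
    have hp := hS.proj e F H K₀ h1 h2 h3
    obtain ⟨x, hx, rfl⟩ := (Set.ext_iff.1 hp.1 y).2 hy.1
    have hr := E.realize_nsmul_of_forall hS.base hS.base_add (C := K₀) (N := N)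
      (φ := F.formula ⊓ (zeroFormula add (Fin m)).relabel e) (fun z hz => ?_)
      (y := fun j => S.rho 1 (x j)) ?_
    · obtain ⟨z, hz, hzx⟩ := hS.exists_rho_eq K₀ hr 1
      have hz' := (Set.ext_iff.1 hp.2 z).1 hz
      refine ⟨N • x - z, ⟨hS.sub_mem_pred F (hS.nsmul_mem_pred F hx N) hz'.1, fun i => ?_⟩, ?_⟩
      · have h := map_sub (hS.rhoHom E 1) (N • x i) (z i)
        rw [map_nsmul] at h
        exact h.trans (sub_eq_zero.2 (congrFun hzx i).symm)
      · rw [map_sub, map_nsmul, hz'.2, sub_zero]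
    · simp only [Formula.realize_inf, Formula.realize_relabel,
        realize_zeroFormula E.definesAdd] at hz
      exact hNK z ⟨(F.mem_iff z).2 hz.1, hz.2⟩
    · simp only [Formula.realize_inf, Formula.realize_relabel, realize_zeroFormula hS.base_add]
      exact ⟨hS.realize_rho F hx 1, funext fun j => hy.2 j⟩

end CoreAxioms

/-! ### The inverse limit satisfies the axioms -/

section Hat

variable {B : Type b} [AddCommGroup B]

/-- The inverse limit as a subgroup of the group of sequences. -/
def hatSubgroup (B : Type b) [AddCommGroup B] : AddSubgroup (ℕ+ → B) where
  carrier := {g | ∀ n m : ℕ+, (m : ℕ) • g (n * m) = g n}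
  zero_mem' _ _ := smul_zero _
  add_mem' hx hy n m := by rw [Pi.add_apply, smul_add, hx, hy, Pi.add_apply]
  neg_mem' hx n m := by rw [Pi.neg_apply, smul_neg, hx, Pi.neg_apply]

instance : AddCommGroup (Hat B) := inferInstanceAs (AddCommGroup (hatSubgroup B))

lemma Hat.add_apply (x y : Hat B) (n : ℕ+) : (x + y).1 n = x.1 n + y.1 n := rfl

/-- A sequence of sets with surjective transition maps has a compatible sequence of elements. -/
lemma exists_hat_of_surjective {r : ℕ} (P : ℕ+ → Set (Fin r → B))
    (hsurj : ∀ n m : ℕ+, ∀ x ∈ P n, ∃ y ∈ P (n * m), (m : ℕ) • y = x)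
    (hmap : ∀ n m : ℕ+, ∀ y ∈ P (n * m), (m : ℕ) • y ∈ P n) {x : Fin r → B} (hx : x ∈ P 1) :
    ∃ s : Fin r → Hat B, (fun j => (s j).1 1) = x ∧ ∀ n, (fun j => (s j).1 n) ∈ P n := by
  let f : ℕ → ℕ+ := Nat.rec (motive := fun _ => ℕ+) 1 fun j k => k * j.succPNat
  have hf : ∀ j : ℕ, PNat.val (f j) = j.factorial := by
    intro j
    induction j with
    | zero => rfl
    | succ j ih =>
      rw [Nat.factorial_succ, ← ih, mul_comm]
      rfl
  choose g hg hg' using hsurj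
  let t : ∀ j, {y // y ∈ P (f j)} := fun j => Nat.rec (motive := fun j => {y // y ∈ P (f j)}) ⟨x, hx⟩
    (fun j y => ⟨g (f j) j.succPNat y.1 y.2, hg _ _ _ _⟩) j
  have ht : ∀ j, (j + 1) • (t (j + 1)).1 = (t j).1 := fun j => hg' (f j) j.succPNat _ _
  have ht' : ∀ j d, ∃ D : ℕ+, f (j + d) = f j * D ∧ (D : ℕ) • (t (j + d)).1 = (t j).1 := by
    intro j d
    induction d with
    | zero => exact ⟨1, (mul_one _).symm, one_smul _ _⟩
    | succ d ih =>
      obtain ⟨D, h1, h2⟩ := ih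
      refine ⟨D * (j + d).succPNat, ?_, ?_⟩
      · rw [← mul_assoc, ← h1]
        rfl
      · rw [← h2, ← ht (j + d), ← mul_smul]
        rfl
  have hq : ∀ n : ℕ+, ∃ q : ℕ+, f n = n * q := fun n => by
    refine dvd_def.1 (PNat.dvd_iff.2 ?_)
    rw [hf]
    exact Nat.dvd_factorial n.pos le_rfl
  choose q hq using hq
  have hs : ∀ n m : ℕ+, (m : ℕ) • (q (n * m) : ℕ) • (t (n * m : ℕ+)).1 = (q n : ℕ) • (t n).1 := by
    intro n m
    obtain ⟨d, hd⟩ := Nat.exists_eq_add_of_le (Nat.le_mul_of_pos_right n m.pos)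
    obtain ⟨D, h1, h2⟩ := ht' n d
    rw [← hd] at h1 h2
    rw [← h2, ← mul_smul, ← mul_smul]
    have h3 : n * (m * q (n * m)) = n * (q n * D) := by
      rw [← mul_assoc, ← hq, ← mul_assoc, ← hq, ← h1]
      rfl
    have h4 := congrArg PNat.val (mul_left_cancel h3)
    simp only [PNat.mul_coe] at h4 ⊢
    exact congrArg (· • _) h4
  refine ⟨fun j => ⟨fun n => ((q n : ℕ) • (t n).1) j, fun n m => congrFun (hs n m) j⟩, ?_, ?_⟩
  · have h1 : q 1 = 1 := by
      have := hq 1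
      rw [one_mul] at this
      exact this.symm
    have h2 : (t 1).1 = (t 0).1 := by simpa using ht 0
    ext j
    simp [h1]
    exact congrFun h2 j
  · intro n
    refine hmap n (q n) _ ?_
    rw [← hq]
    exact (t n).2

variable {L : FirstOrder.Language.{u, v}} {G : Type w} [AddCommGroup G] [L.Structure G]
  {add : L.Formula (Fin 3)} [L.Structure B] {n m : ℕ}

lemma mem_hat_pred {H : ConnSubgroup L G n} {x : Fin n → Hat B} :
    x ∈ (hatStructure L G B).pred H ↔ ∀ i : ℕ+, H.formula.Realize fun j => (x j).1 i := Iff.rfl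

variable (E : Setting L G add) (hB : B ⊨ L.completeTheory G) (hadd : DefinesAdd add B)
include E hB hadd

lemma exists_hat_rho (H : ConnSubgroup L G n) (i : ℕ+) {y : Fin n → B} (hy : H.formula.Realize y) :
    ∃ x ∈ (hatStructure L G B).pred H, (fun j => (x j).1 i) = y := by
  obtain ⟨s, hs, hs'⟩ := exists_hat_of_surjective (fun _ => {z | H.formula.Realize z})
    (fun n m x hx => E.exists_nsmul_eq hB hadd H m.pos hx)
    (fun n m y hy => (E.realizeSubgroup hB hadd H).nsmul_mem hy _) hy
  -- The sequence $s$ starts with $s_1=y$, so $i\,s$ has $i$-th entry $i\,s_i=s_1=y$.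
  refine ⟨(i : ℕ) • s, fun k => (E.realizeSubgroup hB hadd H).nsmul_mem (hs' k) (i : ℕ), ?_⟩
  rw [← hs]
  ext j
  exact (congrArg _ (congrArg (s j).1 (one_mul i).symm)).trans ((s j).2 1 i)

/-- The fibres of $F\to H$ over the $y_k$ need not map onto each other, since the kernel may fail to
be divisible. Taking instead $P_k=N\cdot\{x\in F: x\mapsto y_{kN}\}$ repairs this: two lifts differ
by a kernel element, whose $N$-th multiple lies in the divisible group $K_0$ and can be divided by
any integer. A compatible sequence in the $P_k$ projects to $y$, because $N y_{kN}=y_k$. -/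
lemma exists_hat_lift (e : Fin m ↪ Fin n) (F : ConnSubgroup L G n) (H : ConnSubgroup L G m)
    (K₀ : ConnSubgroup L G n) (hFH : F.subgroup.map (coordProj e) = H.subgroup)
    (hK : IsComponent K₀ (F.subgroup ⊓ (coordProj e).ker)) {y : Fin m → Hat B}
    (hy : y ∈ (hatStructure L G B).pred H) :
    ∃ x ∈ (hatStructure L G B).pred F, coordProj e x = y := by
  obtain ⟨hK, N, hN, hNK⟩ := hK
  lift N to ℕ+ using hN
  have hlift : ∀ k, ∃ z, F.formula.Realize z ∧ z ∘ e = fun j => (y j).1 k := fun k =>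
    E.exists_realize_of_forall hB hadd (C := F) (c := fun j => .var (e j)) (fun x hx => by
      rw [← H.mem_iff, ← hFH] at hx
      exact hx) (hy k)
  have hker : ∀ z : Fin n → B, F.formula.Realize z → z ∘ e = 0 →
      K₀.formula.Realize ((N : ℕ) • z) := fun z hz hz0 =>
    E.realize_nsmul_of_forall hB hadd (φ := F.formula ⊓ (zeroFormula add (Fin m)).relabel e)
      (fun x hx => by
        rw [Formula.realize_inf, Formula.realize_relabel, realize_zeroFormula E.definesAdd] at hx
        exact hNK x ⟨(F.mem_iff x).2 hx.1, hx.2⟩) (by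
        rw [Formula.realize_inf, Formula.realize_relabel, realize_zeroFormula hadd]
        exact ⟨hz, hz0⟩)
  have hKF : ∀ z : Fin n → B, K₀.formula.Realize z → F.formula.Realize z ∧ z ∘ e = 0 :=
    fun z hz => ⟨E.realize_of_forall hB hadd (c := .var)
      (fun x hx => (hK ((K₀.mem_iff x).2 hx)).1) hz,
      (realize_zeroFormula hadd _).1 <| E.realize_of_forall hB hadd (C := E.bot m)
        (c := fun j => .var (e j)) (fun x hx => AddSubgroup.mem_bot.2
          (hK ((K₀.mem_iff x).2 hx)).2) hz⟩
  have hsub : ∀ {z : Fin n → B}, F.formula.Realize z ↔ z ∈ E.realizeSubgroup hB hadd F :=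
    Iff.rfl
  let P : ℕ+ → Set (Fin n → B) := fun k => {z | ∃ x, F.formula.Realize x ∧
    (x ∘ e = fun j => (y j).1 (k * N)) ∧ (N : ℕ) • x = z}
  have hy' : ∀ (k l : ℕ+) (x : Fin n → B), (x ∘ e = fun j => (y j).1 (k * l * N)) →
      ((l : ℕ) • x) ∘ e = fun j => (y j).1 (k * N) := by
    intro k l x hx
    ext j
    have := (y j).2 (k * N) l
    rw [mul_right_comm, ← show (x ∘ e) j = _ from congrFun hx j] at this
    exact this
  have hsurj : ∀ k l : ℕ+, ∀ x ∈ P k, ∃ z ∈ P (k * l), (l : ℕ) • z = x := by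
    intro k l x hx
    obtain ⟨x, hx, hxy, rfl⟩ := hx
    obtain ⟨x₁, hx₁, hxy₁⟩ := hlift (k * l * N)
    have h0 := hker (x - (l : ℕ) • x₁) (sub_mem (hsub.1 hx) (nsmul_mem (hsub.1 hx₁) _)) (by
      have := hy' k l x₁ hxy₁
      rw [← hxy] at this
      ext j
      simpa [sub_eq_zero] using (congrFun this j).symm)
    obtain ⟨z, hz, hzx⟩ := E.exists_nsmul_eq hB hadd K₀ l.pos h0
    obtain ⟨z', hz', rfl⟩ := E.exists_nsmul_eq hB hadd K₀ N.pos hz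
    have hz'' := hKF z' hz'
    refine ⟨(N : ℕ) • (x₁ + z'), ⟨x₁ + z', add_mem (hsub.1 hx₁) (hsub.1 hz''.1), ?_, rfl⟩, ?_⟩
    · rw [← hxy₁]
      ext j
      simpa using congrFun hz''.2 j
    · rw [smul_add, smul_add, hzx, smul_sub, smul_comm (l : ℕ)]
      abel
  have hmap : ∀ k l : ℕ+, ∀ x ∈ P (k * l), (l : ℕ) • x ∈ P k := by
    intro k l x hx
    obtain ⟨u, hu, huy, rfl⟩ := hx
    exact ⟨(l : ℕ) • u, nsmul_mem (hsub.1 hu) _, hy' k l u huy, smul_comm _ _ _⟩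
  obtain ⟨z, hz, hzy⟩ := hlift (1 * N)
  obtain ⟨s, -, hs⟩ := exists_hat_of_surjective P hsurj hmap (x := (N : ℕ) • z) ⟨z, hz, hzy, rfl⟩
  refine ⟨s, fun i => ?_, ?_⟩
  · obtain ⟨x, hx, -, hxs⟩ := hs i
    rw [← hxs]
    exact nsmul_mem (hsub.1 hx) _
  · ext j
    refine Subtype.ext (funext fun i => ?_)
    obtain ⟨x, -, hx, hxs⟩ := hs i
    rw [← (y j).2 i N, ← show (x ∘ e) j = _ from congrFun hx j]
    exact (congrFun hxs (e j)).symm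

/-- The inverse limit satisfies the axioms. -/
lemma hatStructure_coreAxioms : CoreAxioms G add (hatStructure L G B) where
  base := hB
  base_add := hadd
  cover_add H hH := by
    ext x
    have key : ∀ y : Fin 3 → B, H.formula.Realize y ↔ y 0 + y 1 = y 2 := by
      intro y
      rw [← hadd.realize, ← Formula.realize_iff]
      refine (forall_realize_iff hB (H.formula.iff add)).2 (fun x => ?_) y
      rw [Formula.realize_iff, E.definesAdd.realize, ← H.mem_iff]
      exact Set.ext_iff.1 hH x
    simp only [mem_hat_pred, key]
    exact ⟨fun h => Subtype.ext (funext h), fun h i => by rw [← Hat.add_apply, h]⟩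
  diag H hH := by
    ext x
    have key : ∀ y : Fin 2 → B, H.formula.Realize y ↔ y 0 = y 1 := by
      intro y
      have := (forall_realize_iff hB (H.formula.iff (Term.equal (.var 0) (.var 1)))).2
        (fun x => ?_) y
      · simpa using this
      · simp only [Formula.realize_iff, Formula.realize_equal, Term.realize_var, ← H.mem_iff]
        exact Set.ext_iff.1 hH x
    simp only [mem_hat_pred, key]
    exact ⟨fun h => Subtype.ext (funext h), fun h i => by rw [h]⟩
  isSubgroup H := ⟨.ofSub ((hatStructure L G B).pred H)
    ⟨0, fun i => zero_mem (E.realizeSubgroup hB hadd H)⟩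
    fun x hx y hy i => (E.realizeSubgroup hB hadd H).add_mem (hx i)
      ((E.realizeSubgroup hB hadd H).neg_mem (hy i)), rfl⟩
  coherent n m x := x.2 n m
  epic H i := by
    ext y
    constructor
    · rintro ⟨x, hx, rfl⟩
      exact hx i
    · exact fun hy => exists_hat_rho E hB hadd H i hy
  lattice H K := by
    refine ⟨fun h x hx i => h _ (hx i), fun h y hy => ?_⟩
    obtain ⟨x, hx, rfl⟩ := exists_hat_rho E hB hadd H 1 hy
    exact h hx 1
  torsion H K hHK hT := by
    refine subset_antisymm (Set.inter_subset_inter_left _ fun x hx i =>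
      E.realize_of_forall hB hadd (c := .var) (fun x hx => hHK ((H.mem_iff x).2 hx)) (hx i))
      fun x hx => ⟨fun i => ?_, hx.2⟩
    -- If $\rho_1(x)=0$, then $i\,\rho_i(x)=0$. For fixed $i$, the inclusion of the $i$-torsion of
    -- $K$ in $H$ is first order and passes from $\mathbb G$ to `B`.
    refine E.realize_of_forall hB hadd (C := H) (c := .var)
      (φ := K.formula ⊓ pull add (fun j => .nsmul i (.var j)) (zeroFormula add _))
      (fun z hz => ?_) ?_
    · simp only [Formula.realize_inf, realize_pull E.definesAdd,
        realize_zeroFormula E.definesAdd, LinTerm.evalHom_nsmul] at hz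
      exact ((Set.ext_iff.1 hT z).2 ⟨(K.mem_iff z).2 hz.1,
        isOfFinAddOrder_iff_nsmul_eq_zero.2 ⟨i, i.pos, hz.2⟩⟩).1
    · simp only [Formula.realize_inf, realize_pull hadd, realize_zeroFormula hadd,
        LinTerm.evalHom_nsmul]
      refine ⟨hx.1 i, funext fun j => ?_⟩
      have := (x j).2 1 i
      rw [one_mul] at this
      exact this.trans (hx.2 j)
  proj e F H K₀ hFH hK hi := by
    have hK' := isComponent_of_relIndex hK hi
    refine ⟨Set.ext fun y => ⟨?_, fun hy => exists_hat_lift E hB hadd e F H K₀ hFH hK' hy⟩,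
      Set.ext fun x => ⟨fun hx => ⟨fun i => ?_, ?_⟩, fun hx i => ?_⟩⟩
    · rintro ⟨x, hx, rfl⟩ i
      exact E.realize_of_forall hB hadd (C := H) (c := fun j => .var (e j)) (fun z hz => by
        rw [← hFH]
        exact ⟨z, (F.mem_iff z).2 hz, rfl⟩) (hx i)
    · exact E.realize_of_forall hB hadd (c := .var) (fun z hz => (hK ((K₀.mem_iff z).2 hz)).1)
        (hx i)
    · ext j
      refine Subtype.ext (funext fun i => ?_)
      exact congrFun ((realize_zeroFormula hadd _).1 <| E.realize_of_forall hB hadd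
        (C := E.bot _) (c := fun j => .var (e j)) (fun z hz => AddSubgroup.mem_bot.2
          (hK ((K₀.mem_iff z).2 hz)).2) (hx i)) j
    · obtain ⟨-, N, hN, hNK⟩ := hK'
      lift N to ℕ+ using hN
      -- Use $\rho_i(x)=N\rho_{iN}(x)$: the element $\rho_{iN}(x)$ lies in the kernel, and $N$ maps
      -- the kernel into $K_0$.
      have h := E.realize_nsmul_of_forall hB hadd (C := K₀) (N := N)
        (φ := F.formula ⊓ (zeroFormula add (Fin _)).relabel e) (fun z hz => by
          rw [Formula.realize_inf, Formula.realize_relabel,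
            realize_zeroFormula E.definesAdd] at hz
          exact hNK z ⟨(F.mem_iff z).2 hz.1, hz.2⟩) (y := fun j => (x j).1 (i * N)) (by
          rw [Formula.realize_inf, Formula.realize_relabel, realize_zeroFormula hadd]
          exact ⟨hx.1 _, funext fun j => by
            have := congrFun hx.2 j
            exact congrArg (fun g : Hat B => g.1 (i * N)) this⟩)
      convert! h using 1
      ext j
      exact ((x j).2 i N).symm

end Hat

/-! ### Cells and their Boolean combinations -/

/-- A basic condition on a tuple of the two-sorted structure: the cover variables lie in the cover
of `pos`, not in the covers of the groups in the list `neg`, and the base variables together with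
the images of the cover variables satisfy a formula of the base language. -/
structure Cell (L : FirstOrder.Language.{u, v}) (G : Type w) [AddCommGroup G] [L.Structure G]
    (m k : ℕ) where
  pos : ConnSubgroup L G m
  neg : List (ConnSubgroup L G m)
  formula : L.BoundedFormula (ℕ+ × Fin m) k

section Cells

variable {L : FirstOrder.Language.{u, v}} {G : Type w} [AddCommGroup G] [L.Structure G]
  {add : L.Formula (Fin 3)} {A : Type a} {B : Type b} [L.Structure B] {m k : ℕ}

/-- The truth of a formula of the base language at a tuple of the two-sorted structure. -/
def CoverStructure.BaseRealize {P : ℕ → Type p} (S : CoverStructure L P A B)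
    (φ : L.BoundedFormula (ℕ+ × Fin m) k) (x : Fin m → A) (y : Fin k → B) : Prop :=
  φ.Realize (fun q => S.rho q.1 (x q.2)) y

variable (S : CoverStructure L (ConnSubgroup L G) A B)

/-- Satisfaction of the condition of a cell. -/
def Cell.Realize (c : Cell L G m k) (x : Fin m → A) (y : Fin k → B) : Prop :=
  x ∈ S.pred c.pos ∧ (∀ K ∈ c.neg, x ∉ S.pred K) ∧ S.BaseRealize c.formula x y

/-- Membership in a finite union of cells. -/
def RealizeAny (l : List (Cell L G m k)) (x : Fin m → A) (y : Fin k → B) : Prop :=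
  ∃ c ∈ l, c.Realize S x y

variable {S} {x : Fin m → A} {y : Fin k → B}

lemma realizeAny_append {l l' : List (Cell L G m k)} :
    RealizeAny S (l ++ l') x y ↔ RealizeAny S l x y ∨ RealizeAny S l' x y := by
  simp [RealizeAny, or_and_right, exists_or]

lemma realizeAny_singleton {c : Cell L G m k} :
    RealizeAny S [c] x y ↔ c.Realize S x y := by
  simp [RealizeAny]

variable (E : Setting L G add)

/-- The intersection of two cells. -/
noncomputable def Cell.inter (c d : Cell L G m k) : Cell L G m k :=
  ⟨E.preimage c.pos d.pos .var, c.neg ++ d.neg, c.formula ⊓ d.formula⟩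

/-- The intersection of two finite unions of cells. -/
noncomputable def cellsInter (l l' : List (Cell L G m k)) : List (Cell L G m k) :=
  l.flatMap fun c => l'.map fun d => c.inter E d

/-- The complement of a cell. -/
noncomputable def Cell.compl (c : Cell L G m k) : List (Cell L G m k) :=
  ⟨E.top m, [c.pos], ⊤⟩ :: ⟨E.top m, [], ∼c.formula⟩ :: c.neg.map fun K => ⟨K, [], ⊤⟩

/-- The complement of a finite union of cells. -/
noncomputable def cellsCompl : List (Cell L G m k) → List (Cell L G m k)
  | [] => [⟨E.top m, [], ⊤⟩]
  | c :: l => cellsInter E (c.compl E) (cellsCompl l)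

/-- The projection of a cell along a base variable. -/
def Cell.exBase (c : Cell L G m (k + 1)) : Cell L G m k :=
  ⟨c.pos, c.neg, c.formula.ex⟩

lemma Cell.realize_exBase {c : Cell L G m (k + 1)} :
    c.exBase.Realize S x y ↔ ∃ z, c.Realize S x (Fin.snoc y z) := by
  simp [Cell.Realize, Cell.exBase, CoverStructure.BaseRealize]

lemma realizeAny_map_exBase {l : List (Cell L G m (k + 1))} :
    RealizeAny S (l.map Cell.exBase) x y ↔ ∃ z, RealizeAny S l x (Fin.snoc y z) := by
  simp only [RealizeAny, List.mem_map, exists_exists_and_eq_and, Cell.realize_exBase]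
  exact ⟨fun ⟨c, hc, z, h⟩ => ⟨z, c, hc, h⟩, fun ⟨z, c, hc, h⟩ => ⟨c, hc, z, h⟩⟩

variable [AddCommGroup A] [AddCommGroup B] (hS : CoreAxioms G add S)
include hS

lemma CoreAxioms.realize_inter {c d : Cell L G m k} :
    (c.inter E d).Realize S x y ↔ c.Realize S x y ∧ d.Realize S x y := by
  have h := hS.mem_pred_preimage E (E.isComponent_preimage c.pos d.pos .var) (x := x)
  have h' : LinTerm.evalHom LinTerm.var x = x := rfl
  rw [h'] at h
  simp only [Cell.Realize, Cell.inter, h, CoverStructure.BaseRealize, BoundedFormula.realize_inf,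
    List.mem_append, or_imp, forall_and]
  tauto

lemma CoreAxioms.realizeAny_inter {l l' : List (Cell L G m k)} :
    RealizeAny S (cellsInter E l l') x y ↔ RealizeAny S l x y ∧ RealizeAny S l' x y := by
  simp only [RealizeAny, cellsInter, List.mem_flatMap, List.mem_map]
  constructor
  · rintro ⟨_, ⟨c, hc, d, hd, rfl⟩, h⟩
    have h := (hS.realize_inter E).1 h
    exact ⟨⟨c, hc, h.1⟩, ⟨d, hd, h.2⟩⟩
  · rintro ⟨⟨c, hc, h⟩, ⟨d, hd, h'⟩⟩
    exact ⟨_, ⟨c, hc, d, hd, rfl⟩, (hS.realize_inter E).2 ⟨h, h'⟩⟩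

lemma CoreAxioms.realizeAny_cellCompl {c : Cell L G m k} :
    RealizeAny S (c.compl E) x y ↔ ¬ c.Realize S x y := by
  have h := hS.mem_pred_top E x
  by_cases h1 : x ∈ S.pred c.pos <;> by_cases h2 : S.BaseRealize c.formula x y <;>
    simp_all [RealizeAny, Cell.compl, Cell.Realize, CoverStructure.BaseRealize]

lemma CoreAxioms.realizeAny_compl {l : List (Cell L G m k)} :
    RealizeAny S (cellsCompl E l) x y ↔ ¬ RealizeAny S l x y := by
  induction l with
  | nil =>
    simp [cellsCompl, RealizeAny, Cell.Realize, CoverStructure.BaseRealize, hS.mem_pred_top E x]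
  | cons c l ih =>
    rw [cellsCompl, hS.realizeAny_inter E, ih, hS.realizeAny_cellCompl E]
    simp [RealizeAny]

end Cells

/-! ### Elimination of a cover variable -/

section Fiber

variable {L : FirstOrder.Language.{u, v}} {G : Type w} [AddCommGroup G] [L.Structure G]
  {add : L.Formula (Fin 3)} {m k : ℕ} (E : Setting L G add)

namespace Setting

/-- The image under the projection forgetting the last co-ordinate. -/
noncomputable def initMap (H : ConnSubgroup L G (m + 1)) : ConnSubgroup L G m :=
  E.map H fun i => .var i.castSucc

/-- The connected component of the kernel of the projection forgetting the last co-ordinate. -/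
noncomputable def initKer (H : ConnSubgroup L G (m + 1)) : ConnSubgroup L G (m + 1) :=
  E.preimage H (E.bot m) fun i => .var i.castSucc

lemma isComponent_initKer (H : ConnSubgroup L G (m + 1)) : IsComponent (E.initKer H)
    (H.subgroup ⊓ (LinTerm.evalHom fun i : Fin m => .var i.castSucc).ker) :=
  E.isComponent_preimage H (E.bot m) fun i => .var i.castSucc

/-- A positive integer multiplying the kernel of the projection into its component. -/
noncomputable def exponent (H : ConnSubgroup L G (m + 1)) : ℕ+ :=
  ⟨(E.isComponent_initKer H).2.choose, (E.isComponent_initKer H).2.choose_spec.1⟩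

lemma exponent_nsmul_mem {H : ConnSubgroup L G (m + 1)} {x : Fin (m + 1) → G}
    (hx : x ∈ H.subgroup) (h0 : ∀ i : Fin m, x i.castSucc = 0) :
    (E.exponent H : ℕ) • x ∈ (E.initKer H).subgroup :=
  (E.isComponent_initKer H).2.choose_spec.2 x ⟨hx, funext h0⟩

/-- The connected component of an intersection. -/
noncomputable def meet (H K : ConnSubgroup L G m) : ConnSubgroup L G m :=
  E.preimage H K .var

/-- Removing `K̂` from a fibre of `Ĥ` removes no torsion-determined part of the fibre. -/
def IsGeneric (H K : ConnSubgroup L G (m + 1)) : Prop :=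
  ∃ t ∈ (E.initKer H).subgroup, IsOfFinAddOrder t ∧ t ∉ (E.initKer (E.meet H K)).subgroup

lemma meet_le (H K : ConnSubgroup L G m) : (E.meet H K).subgroup ≤ H.subgroup :=
  fun _ hx => ((E.isComponent_preimage H K .var).1 hx).1

lemma initKer_meet_le (H K : ConnSubgroup L G (m + 1)) :
    (E.initKer (E.meet H K)).subgroup ≤ (E.initKer H).subgroup :=
  E.le_of_isComponent (E.isComponent_initKer H) fun _ hx =>
    ⟨E.meet_le H K ((E.isComponent_initKer _).1 hx).1, ((E.isComponent_initKer _).1 hx).2⟩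

end Setting

variable {A : Type a} {B : Type b} [L.Structure B]
  {S : CoverStructure L (ConnSubgroup L G) A B} [AddCommGroup A] [AddCommGroup B]
  (hS : CoreAxioms G add S)

namespace CoreAxioms

include hS

lemma mem_pred_initMap {H : ConnSubgroup L G (m + 1)} {x : Fin m → A} :
    x ∈ S.pred (E.initMap H) ↔ ∃ z, Fin.snoc x z ∈ S.pred H := by
  rw [Setting.initMap, hS.mem_pred_map E]
  constructor
  · rintro ⟨y, hy, rfl⟩
    refine ⟨y (Fin.last m), ?_⟩
    convert! hy
    exact Fin.snoc_init_self y
  · rintro ⟨z, hz⟩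
    exact ⟨_, hz, by ext; simp⟩

lemma mem_pred_meet {H K : ConnSubgroup L G m} {x : Fin m → A} :
    x ∈ S.pred (E.meet H K) ↔ x ∈ S.pred H ∧ x ∈ S.pred K :=
  hS.mem_pred_preimage E (E.isComponent_preimage H K .var)

lemma mem_pred_initKer {H : ConnSubgroup L G (m + 1)} {x : Fin (m + 1) → A} :
    x ∈ S.pred (E.initKer H) ↔ x ∈ S.pred H ∧ ∀ i : Fin m, x i.castSucc = 0 := by
  rw [hS.mem_pred_ker E (E.isComponent_initKer H), funext_iff]
  rfl

include E in
lemma rho_sub (i : ℕ+) (x y : A) : S.rho i (x - y) = S.rho i x - S.rho i y :=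
  map_sub (hS.rhoHom E i) x y

include E in
lemma rho_smul (i : ℕ+) (r : ℕ) (x : A) : S.rho i (r • x) = r • S.rho i x :=
  map_nsmul (hS.rhoHom E i) r x

/-- The image of a fibre of `Ĥ` under `ρ_n`. -/
lemma exists_fiber_rho {H : ConnSubgroup L G (m + 1)} {x : Fin m → A}
    (hx : x ∈ S.pred (E.initMap H)) (n : ℕ+) {z : B}
    (hz : H.formula.Realize (Fin.snoc (fun i => S.rho (n * E.exponent H) (x i)) z : Fin (m + 1) → B)) :
    ∃ c, Fin.snoc x c ∈ S.pred H ∧ S.rho n c = (E.exponent H : ℕ) • z := by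
  obtain ⟨c, hc⟩ := (hS.mem_pred_initMap E).1 hx
  -- With $N$ the exponent, $z$ and $\rho_{nN}(c)$ complete the same tuple, so $N$ times their
  -- difference lies in the component of the kernel and lifts through $\rho_n$ to some $d$. Adding
  -- $d$ to $c$ corrects $\rho_n(c)=N\rho_{nN}(c)$ to $Nz$.
  have h1 := hS.realize_rho H hc (n * E.exponent H)
  have h2 := sub_mem ((E.mem_realizeSubgroup hS.base hS.base_add).2 hz)
    ((E.mem_realizeSubgroup hS.base hS.base_add).2 h1)
  have h3 := E.realize_nsmul_of_forall hS.base hS.base_add (C := E.initKer H) (N := E.exponent H)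
    (φ := H.formula ⊓ (zeroFormula add (Fin m)).relabel Fin.castSucc) (fun u hu => by
      rw [Formula.realize_inf, Formula.realize_relabel, realize_zeroFormula E.definesAdd] at hu
      exact E.exponent_nsmul_mem ((H.mem_iff u).2 hu.1) (congrFun hu.2)) (y := _) (by
      rw [Formula.realize_inf, Formula.realize_relabel, realize_zeroFormula hS.base_add]
      exact ⟨h2, by ext; simp⟩)
  obtain ⟨d, hd, hdz⟩ := hS.exists_rho_eq _ h3 n
  have hd' := (hS.mem_pred_initKer E).1 hd
  refine ⟨c + d (Fin.last m), ?_, ?_⟩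
  · convert! hS.add_mem_pred H hc hd'.1
    ext i
    refine Fin.lastCases ?_ (fun i => ?_) i
    · simp
    · simp [hd'.2]
  · have h4 := congrFun hdz (Fin.last m)
    simp only [Pi.smul_apply, Pi.sub_apply, Fin.snoc_last] at h4
    rw [hS.rho_add E, h4, smul_sub, ← hS.rho_nsmul]
    abel

/-- For non-generic `K`, membership of points of `Ĥ` in `K̂` is determined by the base sort. -/
lemma mem_pred_of_not_isGeneric {H K : ConnSubgroup L G (m + 1)} (hK : ¬ E.IsGeneric H K)
    {x : Fin m → A} {c : A} (hc : Fin.snoc x c ∈ S.pred H) :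
    Fin.snoc x c ∈ S.pred K ↔ x ∈ S.pred (E.initMap (E.meet H K)) ∧
      ∃ z, (E.meet H K).formula.Realize
        (Fin.snoc (fun i => S.rho (E.exponent (E.meet H K)) (x i)) z : Fin (m + 1) → B) ∧
          (E.exponent (E.meet H K) : ℕ) • z = S.rho 1 c := by
  constructor
  · intro hcK
    have h := (hS.mem_pred_meet E).2 ⟨hc, hcK⟩
    refine ⟨(hS.mem_pred_initMap E).2 ⟨c, h⟩, S.rho (E.exponent (E.meet H K)) c, ?_, ?_⟩
    · convert! hS.realize_rho _ h (E.exponent (E.meet H K)) using 2 with i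
      refine Fin.lastCases ?_ (fun i => ?_) i <;> simp
    · simpa using hS.coherent 1 (E.exponent (E.meet H K)) c
  · rintro ⟨hx, z, hz, hzc⟩
    -- Some $d$ in the fibre of the cover of the component of $H\cap K$ has $\rho_1(d)=\rho_1(c)$.
    -- The difference of $c$ and $d$ is killed by $\rho_1$, and there non-genericity and `torsion`
    -- identify the two kernel groups.
    obtain ⟨d, hd, hdz⟩ := hS.exists_fiber_rho E hx 1 (z := z) (by simpa using hz)
    have hd' := (hS.mem_pred_meet E).1 hd
    have hker := hS.torsion _ _ (E.initKer_meet_le H K) (by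
      ext t
      refine ⟨fun h => ⟨E.initKer_meet_le H K h.1, h.2⟩, fun h => ⟨?_, h.2⟩⟩
      by_contra h0
      exact hK ⟨t, h.1, h.2, h0⟩)
    have h1 : (Fin.snoc x c - Fin.snoc x d : Fin (m + 1) → A) ∈
        S.pred (E.initKer H) ∩ S.ker (m + 1) := by
      refine ⟨(hS.mem_pred_initKer E).2 ⟨hS.sub_mem_pred _ hc hd'.1, fun i => by simp⟩, fun i => ?_⟩
      rw [Pi.sub_apply, hS.rho_sub E]
      refine Fin.lastCases ?_ (fun i => ?_) i
      · simp [hdz, hzc]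
      · simp
    rw [← hker] at h1
    have h2 := ((hS.mem_pred_meet E).1 ((hS.mem_pred_initKer E).1 h1.1).1).2
    simpa using hS.add_mem_pred _ h2 hd'.2

/-- A torsion point with $rt=0$ witnessing genericity can be found in `B`, this being first order.
Lift it to $\hat x$ through $\rho_n$; then $r\hat x$ is killed by $\rho_n$. If a positive multiple
of $r\hat x$ lay in the smaller cover, so would $\hat x$ by `mem_of_nsmul_mem`, and $t$ would lie in
the smaller group. -/
lemma exists_kernel_element {H K : ConnSubgroup L G (m + 1)} (hK : E.IsGeneric H K) (n : ℕ+) :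
    ∃ x ∈ S.pred (E.initKer H), (∀ j, S.rho n (x j) = 0) ∧
      ∀ r : ℕ, 0 < r → r • x ∉ S.pred (E.initKer (E.meet H K)) := by
  obtain ⟨t, ht, htor, htK⟩ := hK
  obtain ⟨r, hr, hrt⟩ := isOfFinAddOrder_iff_nsmul_eq_zero.1 htor
  have h : ∃ y : Fin (m + 1) → B, (E.initKer H).formula.Realize y ∧ r • y = 0 ∧
      ¬ (E.initKer (E.meet H K)).formula.Realize y := by
    by_contra! hcon
    have := (forall_realize_iff hS.base (((E.initKer H).formula ⊓
      pull add (fun j => .nsmul r (.var j)) (zeroFormula add (Fin (m + 1)))).imp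
        (E.initKer (E.meet H K)).formula)).1 (fun y => ?_) t
    · simp only [Formula.realize_imp, Formula.realize_inf, realize_pull E.definesAdd,
        realize_zeroFormula E.definesAdd, LinTerm.evalHom_nsmul, ← ConnSubgroup.mem_iff] at this
      exact htK (this ⟨ht, hrt⟩)
    · simp only [Formula.realize_imp, Formula.realize_inf, realize_pull hS.base_add,
        realize_zeroFormula hS.base_add, LinTerm.evalHom_nsmul]
      exact fun h => hcon y h.1 h.2
  obtain ⟨y, hy, hry, hyK⟩ := h
  obtain ⟨x, hx, rfl⟩ := hS.exists_rho_eq _ hy n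
  refine ⟨r • x, hS.nsmul_mem_pred _ hx r, fun j => ?_, fun s hs hsx => hyK ?_⟩
  · rw [Pi.smul_apply, hS.rho_smul E]
    exact congrFun hry j
  · rw [← mul_smul] at hsx
    exact hS.realize_rho _ (hS.mem_of_nsmul_mem E (Nat.mul_pos hs hr) hsx) n

open scoped Pointwise in
/-- Points of a fibre of `Ĥ` with given image under `ρ_n` exist outside any finite union of covers
of generic groups. -/
lemma exists_avoid {H : ConnSubgroup L G (m + 1)} {l : List (ConnSubgroup L G (m + 1))}
    (hl : ∀ K ∈ l, E.IsGeneric H K) {x : Fin m → A} {c : A} (hc : Fin.snoc x c ∈ S.pred H)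
    (n : ℕ+) : ∃ d, Fin.snoc x d ∈ S.pred H ∧ S.rho n d = S.rho n c ∧
      ∀ K ∈ l, Fin.snoc x d ∉ S.pred K := by
  let K := fun i : Fin l.length => l.get i
  obtain ⟨Λ₀, hΛ₀⟩ := hS.isSubgroup (E.initKer H)
  choose Λ hΛ using fun i => hS.isSubgroup (E.initKer (E.meet H (K i)))
  let R : (Fin (m + 1) → A) →+ (Fin (m + 1) → B) :=
    AddMonoidHom.mk' (fun x j => S.rho n (x j)) fun x y => funext fun j => hS.rho_add E n _ _
  -- Translating $(x,c)$ by elements of `Q` keeps it in the fibre and preserves $\rho_n$.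
  let Q : AddSubgroup (Fin (m + 1) → A) := Λ₀ ⊓ R.ker
  have hQ : ∀ {q}, q ∈ Q ↔ q ∈ S.pred (E.initKer H) ∧ ∀ j, S.rho n (q j) = 0 := by
    intro q
    rw [← hΛ₀, ← funext_iff]
    rfl
  have hΛ' : ∀ {i q}, q ∈ Λ i ↔ q ∈ S.pred (E.initKer (E.meet H (K i))) := by
    intro i q
    rw [← hΛ]
    rfl
  by_contra! hcon
  have hbad : ∀ q : Q, ∃ i, (Fin.snoc x c : Fin (m + 1) → A) + q ∈ S.pred (K i) := by
    rintro ⟨q, hq⟩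
    have hq' := hQ.1 hq
    have hq0 := (hS.mem_pred_initKer E).1 hq'.1
    have hsnoc : (Fin.snoc x (c + q (Fin.last m)) : Fin (m + 1) → A) = (Fin.snoc x c : Fin (m + 1) → A) + q := by
      ext i
      refine Fin.lastCases ?_ (fun i => ?_) i
      · simp
      · simp [hq0.2]
    obtain ⟨J, hJ, hJx⟩ := hcon (c + q (Fin.last m))
      (hsnoc ▸ hS.add_mem_pred _ hc hq0.1) (by rw [hS.rho_add E, hq'.2, add_zero])
    obtain ⟨i, rfl⟩ := List.get_of_mem hJ
    exact ⟨i, hsnoc ▸ hJx⟩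
  classical
  -- A translation taking $(x,c)$ into $\widehat K_i$. If there is none, index $i$ is not needed for
  -- the covering and the value $0$ is irrelevant.
  let g : Fin l.length → Q := fun i =>
    if h : ∃ q : Q, (Fin.snoc x c : Fin (m + 1) → A) + q ∈ S.pred (K i) then h.choose else 0
  have hcover : ⋃ i ∈ (Finset.univ : Finset (Fin l.length)),
      g i +ᵥ ((Λ i).addSubgroupOf Q : Set Q) = Set.univ := by
    refine Set.eq_univ_of_forall fun q => ?_
    obtain ⟨i, hi⟩ := hbad q
    have hg : (Fin.snoc x c : Fin (m + 1) → A) + g i ∈ S.pred (K i) := by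
      have h : ∃ q : Q, (Fin.snoc x c : Fin (m + 1) → A) + q ∈ S.pred (K i) := ⟨q, hi⟩
      simp only [g, dif_pos h]
      exact h.choose_spec
    refine Set.mem_iUnion₂.2 ⟨i, Finset.mem_univ i, ?_⟩
    refine Set.mem_vadd_set_iff_neg_vadd_mem.2 ?_
    have hmem : ((-(g i) + q : Q) : Fin (m + 1) → A) ∈ S.pred (E.initKer H) := (hQ.1 (-(g i) + q).2).1
    have hmem' := (hS.mem_pred_initKer E).1 hmem
    refine (AddSubgroup.mem_addSubgroupOf (h := -(g i) + q)).2 (hΛ'.2 ?_)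
    refine (hS.mem_pred_initKer E).2 ⟨(hS.mem_pred_meet E).2 ⟨hmem'.1, ?_⟩, hmem'.2⟩
    convert! hS.sub_mem_pred _ hi hg using 1
    push_cast
    abel
  -- Neumann's lemma: in a finite covering by cosets, one of the subgroups has finite index. A
  -- multiple of every element of `Q` would then lie in it, against `exists_kernel_element`.
  obtain ⟨i, -, hi⟩ := AddSubgroup.exists_finiteIndex_of_leftCoset_cover hcover
  obtain ⟨q, hq, hq0, hqr⟩ := hS.exists_kernel_element E (hl (K i) (l.get_mem i)) n
  refine hqr _ (Nat.pos_of_ne_zero hi.index_ne_zero) (hΛ'.1 ?_)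
  exact AddSubgroup.nsmul_index_mem ((Λ i).addSubgroupOf Q) ⟨q, hQ.2 ⟨hq, hq0⟩⟩

end CoreAxioms

end Fiber

/-! ### The projection of a cell and the translation of formulas into cells -/

section Elimination

variable {L : FirstOrder.Language.{u, v}} {m k : ℕ}

/-- A formula in two groups of variables as a bounded formula. -/
def boundVars {α : Type*} (φ : L.Formula (α ⊕ Fin k)) : L.BoundedFormula α k :=
  BoundedFormula.relabel (k := 0) id φ

lemma realize_boundVars {α : Type*} {M : Type*} [L.Structure M] {φ : L.Formula (α ⊕ Fin k)}
    {v : α → M} {y : Fin k → M} : (boundVars φ).Realize v y ↔ φ.Realize (Sum.elim v y) := by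
  rw [boundVars]
  refine (BoundedFormula.realize_relabel (n := 0)).trans (iff_of_eq ?_)
  rw [Formula.Realize]
  congr 1
  exact Subsingleton.elim _ _

/-- A common multiple of the indices of the maps `ρ_q` occurring in a formula. -/
noncomputable def level (φ : L.BoundedFormula (ℕ+ × Fin m) k) : ℕ+ :=
  ∏ v ∈ φ.toFormula.freeVarFinset, Sum.elim (fun q => q.1) (fun _ => 1) v

lemma dvd_level {φ : L.BoundedFormula (ℕ+ × Fin m) k} {q : ℕ+} {i : Fin m}
    (h : Sum.inl (q, i) ∈ φ.toFormula.freeVarFinset) : ∃ d : ℕ+, level φ = q * d :=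
  Finset.dvd_prod_of_mem (Sum.elim (fun q : ℕ+ × Fin m => q.1) fun _ => 1) h

/-- A formula restricted to the variables that occur in it. -/
noncomputable def restrictVars (φ : L.BoundedFormula (ℕ+ × Fin m) k) :
    L.Formula φ.toFormula.freeVarFinset :=
  BoundedFormula.restrictFreeVar φ.toFormula id

/-- The substitution replacing `ρ_q` of the last cover variable by `(n / q) N` times a new base
variable. -/
def fiberSubst (n N : ℕ) :
    (ℕ+ × Fin (m + 1)) ⊕ Fin k → LinTerm (((ℕ+ × Fin m) ⊕ Fin k) ⊕ Fin 1)
  -- The quotient is taken in the natural numbers; it is exact for indices $q$ dividing $n$, in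
  -- particular for those occurring in a formula of level $n$.
  | .inl (q, i) => Fin.lastCases (.nsmul (n / q) (.nsmul N (.var (.inr 0))))
      (fun i => .var (.inl (.inl (q, i)))) i
  | .inr j => .var (.inl (.inr j))

variable {G : Type w} [AddCommGroup G] [L.Structure G] {add : L.Formula (Fin 3)}
  (E : Setting L G add)

/-- A base formula for the projection of the set defined by a base formula on fibres of `Ĥ`. -/
noncomputable def fiberFormula (H : ConnSubgroup L G (m + 1))
    (φ : L.BoundedFormula (ℕ+ × Fin (m + 1)) k) : L.BoundedFormula (ℕ+ × Fin m) k :=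
  boundVars (Formula.iExs (Fin 1)
    (H.formula.relabel (Fin.snoc (α := fun _ => _)
      (fun i => .inl (.inl (level φ * E.exponent H, i))) (.inr 0)) ⊓
      pull add (fun v => fiberSubst (level φ) (E.exponent H) v.1)
        (restrictVars φ)))

/-- A base formula for membership in the cover of a group, relative to a group for which it is not
generic. -/
noncomputable def fiberMemFormula (k : ℕ) (H : ConnSubgroup L G (m + 1)) :
    L.BoundedFormula (ℕ+ × Fin (m + 1)) k :=
  boundVars (Formula.iExs (Fin 1)
    (H.formula.relabel (Fin.snoc (α := fun _ => _)
      (fun i => .inl (.inl (E.exponent H, i.castSucc))) (.inr 0)) ⊓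
      (graphFormula add (.nsmul (E.exponent H) (.var (.inr 0)))).relabel
        (Sum.elim id fun _ => .inl (.inl (1, Fin.last m)))))

open Classical in
/-- The projection of a cell along a cover variable. -/
noncomputable def exCover (H : ConnSubgroup L G (m + 1)) :
    List (ConnSubgroup L G (m + 1)) → L.BoundedFormula (ℕ+ × Fin (m + 1)) k → List (Cell L G m k)
  | [], φ => [⟨E.initMap H, [], fiberFormula E H φ⟩]
  -- A generic group is dropped. For a non-generic one, a point of $\widehat H$ avoids $\widehat K$
  -- in one of two ways: $x$ lies outside the projection of the cover of the meet, or the base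
  -- condition on $\rho_1(c)$ fails.
  | K :: l, φ => if E.IsGeneric H K then exCover H l φ else
      (exCover H l φ).map (fun c => ⟨c.pos, E.initMap (E.meet H K) :: c.neg, c.formula⟩) ++
        exCover H l (φ ⊓ ∼(fiberMemFormula E k (E.meet H K)))

/-- The finite union of cells equivalent to a formula. -/
noncomputable def toCells : ∀ {m k : ℕ}, CoverFormula L (ConnSubgroup L G) m k →
    List (Cell L G m k)
  | _, _, .falsum => []
  | m, _, .eqCover i j => [⟨E.preimage (E.top m) E.diag fun l => .var (![i, j] l), [], ⊤⟩]
  | m, _, .mem H e => [⟨E.preimage (E.top m) H fun l => .var (e l), [], ⊤⟩]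
  | m, _, .eqBase s t => [⟨E.top m, [], .equal s t⟩]
  | m, _, .rel R ts => [⟨E.top m, [], .rel R ts⟩]
  | _, _, .imp φ ψ => cellsCompl E (toCells φ) ++ toCells ψ
  | _, _, .allBase φ => cellsCompl E ((cellsCompl E (toCells φ)).map Cell.exBase)
  | _, _, .allCover φ => cellsCompl E ((cellsCompl E (toCells φ)).flatMap fun c =>
      exCover E c.pos c.neg c.formula)

variable {A : Type a} {B : Type b} [L.Structure B]
  {S : CoverStructure L (ConnSubgroup L G) A B} [AddCommGroup A] [AddCommGroup B]
  (hS : CoreAxioms G add S)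

namespace CoreAxioms

include hS

/-- For $q$ dividing the level $n$, $\rho_q(c)=(n/q)\rho_n(c)=(n/q)Nz$. Indices absent from the
formula need not divide $n$, so the variables are restricted to those that occur. -/
lemma realize_fiberSubst {φ : L.BoundedFormula (ℕ+ × Fin (m + 1)) k} {x : Fin m → A}
    {y : Fin k → B} {c : A} {N : ℕ} {z : B} (hz : S.rho (level φ) c = N • z) :
    (restrictVars φ).Realize (LinTerm.evalHom
        (fun v => fiberSubst (level φ) N v.1)
        (Sum.elim (Sum.elim (fun q => S.rho q.1 (x q.2)) y) fun _ => z)) ↔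
      S.BaseRealize φ (Fin.snoc x c : Fin (m + 1) → A) y := by
  have h := BoundedFormula.realize_restrictFreeVar (M := B) (φ := φ.toFormula) (f := id)
    (v := LinTerm.evalHom (fun v => fiberSubst (level φ) N v.1)
      (Sum.elim (Sum.elim (fun q => S.rho q.1 (x q.2)) y) fun _ => z)) (xs := default)
    (Sum.elim (fun q => S.rho q.1 ((Fin.snoc x c : Fin (m + 1) → A) q.2)) y) (by
      rintro ⟨⟨q, i⟩ | j, hv⟩
      · obtain ⟨d, hd⟩ := dvd_level hv
        induction i using Fin.lastCases with
        | last =>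
          have h1 : ((level φ : ℕ+) : ℕ) / q = d := by
            rw [hd, PNat.mul_coe, Nat.mul_div_cancel_left _ q.pos]
          simp only [LinTerm.evalHom_apply, id, fiberSubst, Fin.lastCases_last,
            LinTerm.eval_nsmul, LinTerm.eval_var, Sum.elim_inl, Sum.elim_inr, Fin.snoc_last]
          rw [← hz, h1, hS.rho_nsmul q d, hd]
        | cast i => simp [fiberSubst]
      · simp [fiberSubst])
  refine h.trans ?_
  exact BoundedFormula.realize_toFormula φ _

lemma realize_fiberFormula {H : ConnSubgroup L G (m + 1)}
    {φ : L.BoundedFormula (ℕ+ × Fin (m + 1)) k} {x : Fin m → A} {y : Fin k → B} :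
    S.BaseRealize (fiberFormula E H φ) x y ↔ ∃ z : B, H.formula.Realize
      (Fin.snoc (fun i => S.rho (level φ * E.exponent H) (x i)) z : Fin (m + 1) → B) ∧
      (restrictVars φ).Realize (LinTerm.evalHom
        (fun v => fiberSubst (level φ) (E.exponent H) v.1)
        (Sum.elim (Sum.elim (fun q => S.rho q.1 (x q.2)) y) fun _ => z)) := by
  rw [CoverStructure.BaseRealize, fiberFormula, realize_boundVars, Formula.realize_iExs]
  have key : ∀ z : Fin 1 → B, (Sum.elim (Sum.elim (fun q : ℕ+ × Fin m => S.rho q.1 (x q.2)) y) z ∘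
      (Fin.snoc (α := fun _ => _) (fun i => .inl (.inl (level φ * E.exponent H, i))) (.inr 0))) =
      (Fin.snoc (fun i => S.rho (level φ * E.exponent H) (x i)) (z 0) : Fin (m + 1) → B) := by
    intro z
    ext i
    refine Fin.lastCases ?_ (fun i => ?_) i <;> simp
  simp only [Formula.realize_inf, Formula.realize_relabel, realize_pull hS.base_add, key]
  constructor
  · rintro ⟨z, h⟩
    refine ⟨z 0, ?_⟩
    rw [show z = fun _ => z 0 by ext i; rw [Subsingleton.elim i 0] ] at h
    exact h
  · exact fun ⟨z, h⟩ => ⟨fun _ => z, h⟩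

lemma realize_fiberMemFormula {H : ConnSubgroup L G (m + 1)} {x : Fin m → A} {c : A}
    {y : Fin k → B} : S.BaseRealize (fiberMemFormula E k H) (Fin.snoc x c : Fin (m + 1) → A) y ↔
      ∃ z : B, H.formula.Realize
        (Fin.snoc (fun i => S.rho (E.exponent H) (x i)) z : Fin (m + 1) → B) ∧
        (E.exponent H : ℕ) • z = S.rho 1 c := by
  rw [CoverStructure.BaseRealize, fiberMemFormula, realize_boundVars, Formula.realize_iExs]
  set w := Sum.elim (fun q : ℕ+ × Fin (m + 1) => S.rho q.1 ((Fin.snoc x c : Fin (m + 1) → A) q.2)) y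
  have key : ∀ z : Fin 1 → B, (Sum.elim w z ∘
      (Fin.snoc (α := fun _ => _) (fun i => .inl (.inl (E.exponent H, i.castSucc))) (.inr 0))) =
      (Fin.snoc (fun i => S.rho (E.exponent H) (x i)) (z 0) : Fin (m + 1) → B) := by
    intro z
    ext i
    refine Fin.lastCases ?_ (fun i => ?_) i <;> simp [w]
  have key2 : ∀ z : Fin 1 → B, (Sum.elim w z ∘ Sum.elim id
      fun _ : Fin 1 => .inl (.inl (1, Fin.last m))) = Sum.elim (Sum.elim w z) fun _ => S.rho 1 c := by
    intro z
    ext (i | i)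
    · rfl
    · simp [w]
  simp only [Formula.realize_inf, Formula.realize_relabel, realize_graphFormula hS.base_add, key,
    key2, LinTerm.eval_nsmul, LinTerm.eval_var, Sum.elim_inr]
  exact ⟨fun ⟨z, h⟩ => ⟨z 0, h⟩, fun ⟨z, h⟩ => ⟨fun _ => z, h⟩⟩

/-- The list `l'` remembers the generic groups dropped so far. They must be avoided simultaneously,
which is done once `l` is exhausted. -/
lemma realizeAny_exCover {H : ConnSubgroup L G (m + 1)} {l : List (ConnSubgroup L G (m + 1))} :
    ∀ {φ : L.BoundedFormula (ℕ+ × Fin (m + 1)) k} {l' : List (ConnSubgroup L G (m + 1))}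
      {x : Fin m → A} {y : Fin k → B}, (∀ K ∈ l', E.IsGeneric H K) →
      (RealizeAny S (exCover E H l φ) x y ↔ ∃ c : A, Fin.snoc x c ∈ S.pred H ∧
        (∀ K ∈ l', Fin.snoc x c ∉ S.pred K) ∧ (∀ K ∈ l, Fin.snoc x c ∉ S.pred K) ∧
          S.BaseRealize φ (Fin.snoc x c : Fin (m + 1) → A) y) := by
  induction l with
  | nil =>
    intro φ l' x y hl'
    rw [exCover, realizeAny_singleton]
    simp only [Cell.Realize, hS.realize_fiberFormula E, List.not_mem_nil, false_imp_iff,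
      implies_true, true_and]
    constructor
    · rintro ⟨hx, z, hz, h⟩
      obtain ⟨c, hc, hcz⟩ := hS.exists_fiber_rho E hx _ hz
      -- The point $c$ satisfies the base formula but may lie in the cover of a dropped group; $d$
      -- has the same image under $\rho$ at the level of the formula and avoids them all.
      obtain ⟨d, hd, hdc, hdl⟩ := hS.exists_avoid E hl' hc (level φ)
      exact ⟨d, hd, hdl, (hS.realize_fiberSubst (hdc.trans hcz)).1 h⟩
    · rintro ⟨c, hc, -, h⟩
      refine ⟨(hS.mem_pred_initMap E).2 ⟨c, hc⟩, S.rho (level φ * E.exponent H) c, ?_, ?_⟩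
      · convert! hS.realize_rho _ hc (level φ * E.exponent H) using 2 with i
        refine Fin.lastCases ?_ (fun i => ?_) i <;> simp
      · exact (hS.realize_fiberSubst (hS.rho_nsmul (level φ) (E.exponent H) c)).2 h
  | cons K l ih =>
    intro φ l' x y hl'
    by_cases hK : E.IsGeneric H K
    · rw [exCover, if_pos hK, ih (l' := K :: l') (by simpa using ⟨hK, hl'⟩)]
      refine exists_congr fun c => and_congr_right fun _ => ?_
      rw [List.forall_mem_cons, List.forall_mem_cons, and_assoc, and_left_comm]
      simp only [and_assoc]
    · rw [exCover, if_neg hK, realizeAny_append, ih hl']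
      have h1 : RealizeAny S ((exCover E H l φ).map (fun c =>
          (⟨c.pos, E.initMap (E.meet H K) :: c.neg, c.formula⟩ : Cell L G m k))) x y ↔
          x ∉ S.pred (E.initMap (E.meet H K)) ∧ RealizeAny S (exCover E H l φ) x y := by
        simp only [RealizeAny, List.mem_map, exists_exists_and_eq_and, Cell.Realize,
          List.forall_mem_cons]
        exact ⟨fun ⟨c, hc, h⟩ => ⟨h.2.1.1, c, hc, h.1, h.2.1.2, h.2.2⟩,
          fun ⟨h0, c, hc, h⟩ => ⟨c, hc, h.1, ⟨h0, h.2.1⟩, h.2.2⟩⟩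
      rw [h1, ih hl', ← exists_and_left, ← exists_or]
      refine exists_congr fun c => ?_
      have h2 : S.BaseRealize (φ ⊓ ∼(fiberMemFormula E k (E.meet H K)))
          (Fin.snoc x c : Fin (m + 1) → A) y ↔ S.BaseRealize φ (Fin.snoc x c : Fin (m + 1) → A) y ∧
          ¬ S.BaseRealize (fiberMemFormula E k (E.meet H K)) (Fin.snoc x c : Fin (m + 1) → A) y := by
        simp [CoverStructure.BaseRealize]
      rw [h2, hS.realize_fiberMemFormula E, and_left_comm, ← and_or_left]
      refine and_congr_right fun hc => ?_
      rw [List.forall_mem_cons, hS.mem_pred_of_not_isGeneric E hK hc, not_and_or]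
      generalize (x ∈ S.pred (E.initMap (E.meet H K))) = p1
      generalize (∀ K ∈ l', (Fin.snoc x c : Fin (m + 1) → A) ∉ S.pred K) = p2
      generalize (∀ K ∈ l, (Fin.snoc x c : Fin (m + 1) → A) ∉ S.pred K) = p3
      generalize S.BaseRealize φ (Fin.snoc x c : Fin (m + 1) → A) y = p4
      generalize (∃ z : B, _) = p5
      tauto

lemma realize_toCells : ∀ {m k : ℕ} (φ : CoverFormula L (ConnSubgroup L G) m k) {x : Fin m → A}
    {y : Fin k → B}, RealizeAny S (toCells E φ) x y ↔ φ.Realize S x y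
  | _, _, .falsum, _, _ => by simp [toCells, RealizeAny, CoverFormula.Realize]
  | m, _, .eqCover i j, x, y => by
    rw [toCells, realizeAny_singleton, CoverFormula.Realize]
    simp only [Cell.Realize, hS.mem_pred_preimage E (E.isComponent_preimage _ _ _),
      hS.mem_pred_top E, true_and, hS.mem_diag E, LinTerm.evalHom_var]
    simp [CoverStructure.BaseRealize]
  | m, _, .mem H e, x, y => by
    rw [toCells, realizeAny_singleton, CoverFormula.Realize]
    simp only [Cell.Realize, hS.mem_pred_preimage E (E.isComponent_preimage _ _ _),
      hS.mem_pred_top E, true_and, LinTerm.evalHom_var]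
    simp [CoverStructure.BaseRealize, Function.comp_def]
  | m, _, .eqBase s t, x, y => by
    rw [toCells, realizeAny_singleton, CoverFormula.Realize]
    simp [Cell.Realize, hS.mem_pred_top E, CoverStructure.BaseRealize, CoverStructure.termVal,
      BoundedFormula.Realize]
  | m, _, .rel R ts, x, y => by
    rw [toCells, realizeAny_singleton, CoverFormula.Realize]
    simp [Cell.Realize, hS.mem_pred_top E, CoverStructure.BaseRealize, CoverStructure.termVal,
      BoundedFormula.Realize]
  | _, _, .imp φ ψ, x, y => by
    rw [toCells, realizeAny_append, hS.realizeAny_compl E, realize_toCells φ, realize_toCells ψ,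
      CoverFormula.Realize]
    tauto
  | _, _, .allBase φ, x, y => by
    simp only [toCells, hS.realizeAny_compl E, realizeAny_map_exBase, realize_toCells φ,
      CoverFormula.Realize, not_exists, not_not]
  | m, k, .allCover φ, x, y => by
    have h : ∀ l : List (Cell L G (m + 1) k),
        RealizeAny S (l.flatMap fun c => exCover E c.pos c.neg c.formula) x y ↔
          ∃ c : A, RealizeAny S l (Fin.snoc x c : Fin (m + 1) → A) y := by
      intro l
      have h1 : RealizeAny S (l.flatMap fun c => exCover E c.pos c.neg c.formula) x y ↔
          ∃ c ∈ l, RealizeAny S (exCover E c.pos c.neg c.formula) x y := by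
        simp only [RealizeAny, List.mem_flatMap]
        exact ⟨fun ⟨c, ⟨d, hd, h⟩, h'⟩ => ⟨d, hd, c, h, h'⟩,
          fun ⟨d, hd, c, h, h'⟩ => ⟨c, ⟨d, hd, h⟩, h'⟩⟩
      rw [h1]
      simp only [hS.realizeAny_exCover E (l' := []) (by simp), List.not_mem_nil, false_imp_iff,
        implies_true, true_and]
      exact ⟨fun ⟨c, hc, z, h⟩ => ⟨z, c, hc, h⟩, fun ⟨z, c, hc, h⟩ => ⟨c, hc, z, h⟩⟩
    simp only [toCells, hS.realizeAny_compl E, h, realize_toCells φ, CoverFormula.Realize,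
      not_exists, not_not]

end CoreAxioms

end Elimination

/-! ### Completeness -/

section Complete

variable {L : FirstOrder.Language.{u, v}} {G : Type w} [AddCommGroup G] [L.Structure G]
  {add : L.Formula (Fin 3)} (E : Setting L G add)
  {A : Type a} {B : Type b} [L.Structure B]
  {S : CoverStructure L (ConnSubgroup L G) A B} [AddCommGroup A] [AddCommGroup B]

/-- Without variables every cover predicate holds, being a subgroup of the trivial group, so nothing
may be removed. The base formula then has no free variables, and its truth is decided by the theory
of $\mathbb G$. -/
lemma CoreAxioms.realize_cell_zero (hS : CoreAxioms G add S) (c : Cell L G 0 0) :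
    c.Realize S Fin.elim0 Fin.elim0 ↔
      c.neg = [] ∧ ∀ v : ℕ+ × Fin 0 → G, Formula.Realize (c.formula : L.Formula _) v := by
  have h : ∀ K : ConnSubgroup L G 0, Fin.elim0 ∈ S.pred K := fun K => by
    convert! hS.zero_mem_pred K
  rw [← forall_realize_iff hS.base]
  have h1 : (∀ K ∈ c.neg, Fin.elim0 ∉ S.pred K) ↔ c.neg = [] := by
    refine ⟨fun h' => List.eq_nil_iff_forall_not_mem.2 fun K hK => h' K hK (h K), fun h' => ?_⟩
    simp [h']
  rw [Cell.Realize, h1]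
  simp only [h, true_and]
  refine and_congr_right fun _ => ?_
  constructor
  · intro h' v
    rw [Subsingleton.elim v fun q => S.rho q.1 (Fin.elim0 q.2)]
    convert! h'
  · intro h'
    convert! h' fun q => S.rho q.1 (Fin.elim0 q.2)

include E in
/-- Any two structures satisfying the axioms are elementarily equivalent. -/
lemma CoreAxioms.completeTheory_eq {A' : Type p} {B' : Type*} [L.Structure B']
    {S' : CoverStructure L (ConnSubgroup L G) A' B'} [AddCommGroup A'] [AddCommGroup B']
    (hS : CoreAxioms G add S) (hS' : CoreAxioms G add S') :
    S.completeTheory = S'.completeTheory := by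
  ext σ
  change σ.Realize S _ _ ↔ σ.Realize S' _ _
  -- The list of cells is computed from the sentence alone and is the same for both structures.
  rw [← hS.realize_toCells E, ← hS'.realize_toCells E]
  simp only [RealizeAny, hS.realize_cell_zero, hS'.realize_cell_zero]

end Complete

/-! ### Two-sorted formulas -/

namespace CoverFormula

section

variable {L : FirstOrder.Language.{u, v}} {P : ℕ → Type p} {A : Type a} {B : Type b}
  [L.Structure B] {S : CoverStructure L P A B} {m n k : ℕ}

/-- Negation. -/
def not (φ : CoverFormula L P m k) : CoverFormula L P m k := .imp φ .falsum

/-- Conjunction. -/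
def and (φ ψ : CoverFormula L P m k) : CoverFormula L P m k := not (.imp φ (not ψ))

/-- Existential quantification over the cover sort. -/
def exCover (φ : CoverFormula L P (m + 1) k) : CoverFormula L P m k := not (.allCover (not φ))

/-- Finite conjunction. -/
def conj : ∀ {n : ℕ}, (Fin n → CoverFormula L P m k) → CoverFormula L P m k
  | 0, _ => not .falsum
  | n + 1, f => and (conj fun i : Fin n => f i.castSucc) (f (Fin.last n))

/-- Finite existential quantification over the cover sort. -/
def exCovers : ∀ (n : ℕ), CoverFormula L P (m + n) k → CoverFormula L P m k
  | 0, φ => φ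
  | n + 1, φ => exCovers n (exCover φ)

/-- Universal quantification over all cover variables. -/
def closeCover : ∀ {m : ℕ}, CoverFormula L P m k → CoverFormula L P 0 k
  | 0, φ => φ
  | _ + 1, φ => closeCover (.allCover φ)

/-- Universal quantification over all base variables. -/
def closeBase : ∀ {k : ℕ}, CoverFormula L P m k → CoverFormula L P m 0
  | 0, φ => φ
  | _ + 1, φ => closeBase (.allBase φ)

/-- A formula of the base language as a formula of the two-sorted language. -/
def ofBase : ∀ {k : ℕ}, L.BoundedFormula (ℕ+ × Fin m) k → CoverFormula L P m k
  | _, .falsum => .falsum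
  | _, .equal s t => .eqBase s t
  | _, .rel R ts => .rel R ts
  | _, .imp φ ψ => .imp (ofBase φ) (ofBase ψ)
  | _, .all φ => .allBase (ofBase φ)

variable {x : Fin m → A} {y : Fin k → B}

@[simp] lemma realize_imp {φ ψ : CoverFormula L P m k} :
    (imp φ ψ).Realize S x y ↔ (φ.Realize S x y → ψ.Realize S x y) := Iff.rfl

@[simp] lemma realize_not {φ : CoverFormula L P m k} :
    φ.not.Realize S x y ↔ ¬ φ.Realize S x y := Iff.rfl

@[simp] lemma realize_and {φ ψ : CoverFormula L P m k} :
    (φ.and ψ).Realize S x y ↔ φ.Realize S x y ∧ ψ.Realize S x y := by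
  simp [and]

@[simp] lemma realize_exCover {φ : CoverFormula L P (m + 1) k} :
    φ.exCover.Realize S x y ↔ ∃ c : A, φ.Realize S (Fin.snoc x c) y := by
  simp [exCover, Realize]

@[simp] lemma realize_conj {f : Fin n → CoverFormula L P m k} :
    (conj f).Realize S x y ↔ ∀ i, (f i).Realize S x y := by
  induction n with
  | zero => simp [conj, Realize]
  | succ n ih => simp [conj, ih, Fin.forall_fin_succ', and_comm]

@[simp] lemma realize_eqCover {i j : Fin m} :
    (eqCover i j : CoverFormula L P m k).Realize S x y ↔ x i = x j := Iff.rfl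

@[simp] lemma realize_mem {H : P n} {e : Fin n → Fin m} :
    (mem H e : CoverFormula L P m k).Realize S x y ↔ (fun i => x (e i)) ∈ S.pred H := Iff.rfl

@[simp] lemma realize_exCovers {φ : CoverFormula L P (m + n) k} :
    (exCovers n φ).Realize S x y ↔ ∃ z : Fin n → A, φ.Realize S (Fin.append x z) y := by
  induction n with
  | zero =>
    have h : ∀ z : Fin 0 → A, Fin.append x z = x := fun z => by
      ext i
      exact Fin.append_left x z i
    simp [exCovers, h]
  | succ n ih =>
    simp only [exCovers, ih, realize_exCover]
    constructor
    · rintro ⟨z, c, h⟩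
      exact ⟨Fin.snoc z c, by rwa [Fin.append_snoc]⟩
    · rintro ⟨z, h⟩
      refine ⟨Fin.init z, z (Fin.last n), ?_⟩
      rwa [← Fin.append_snoc, Fin.snoc_init_self]

lemma realize_closeCover {m : ℕ} {φ : CoverFormula L P m k} :
    (closeCover φ).Realize S Fin.elim0 y ↔ ∀ x : Fin m → A, φ.Realize S x y := by
  induction m with
  | zero =>
    refine ⟨fun h x => ?_, fun h => h _⟩
    rwa [Subsingleton.elim x Fin.elim0]
  | succ m ih =>
    rw [closeCover, ih]
    refine ⟨fun h x => ?_, fun h x c => h _⟩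
    rw [← Fin.snoc_init_self x]
    exact h _ _

lemma realize_closeBase {k : ℕ} {φ : CoverFormula L P m k} :
    (closeBase φ).Realize S x Fin.elim0 ↔ ∀ y : Fin k → B, φ.Realize S x y := by
  induction k with
  | zero =>
    refine ⟨fun h y => ?_, fun h => h _⟩
    rwa [Subsingleton.elim y Fin.elim0]
  | succ k ih =>
    rw [closeBase, ih]
    refine ⟨fun h y => ?_, fun h y c => h _⟩
    rw [← Fin.snoc_init_self y]
    exact h _ _

end

section

variable {L : FirstOrder.Language.{u, v}} {P : ℕ → Type p} {m k : ℕ}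

@[simp] lemma realize_ofBase {A : Type a} {B : Type b} [L.Structure B]
    {S : CoverStructure L P A B} {x : Fin m → A} (φ : L.BoundedFormula (ℕ+ × Fin m) k)
    {y : Fin k → B} : (ofBase φ).Realize S x y ↔ S.BaseRealize φ x y := by
  induction φ with
  | falsum => rfl
  | equal s t => rfl
  | rel R ts => rfl
  | imp φ ψ h1 h2 => exact imp_congr h1 h2
  | all φ h => exact forall_congr' fun c => h

lemma isQF_ofBase {φ : L.BoundedFormula (ℕ+ × Fin m) k} (h : φ.IsQF) :
    (ofBase φ : CoverFormula L P m k).IsQF := by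
  induction h with
  | falsum => exact .falsum
  | of_isAtomic h =>
    cases h with
    | equal s t => exact .eqBase _ _
    | rel R ts => exact .rel _ _
  | imp _ _ h1 h2 => exact .imp h1 h2

lemma IsQF.not {φ : CoverFormula L P m k} (h : φ.IsQF) : φ.not.IsQF := .imp h .falsum

lemma IsQF.and {φ ψ : CoverFormula L P m k} (h : φ.IsQF) (h' : ψ.IsQF) : (φ.and ψ).IsQF :=
  (h.imp h'.not).not

end

end CoverFormula

/-! ### Quantifier elimination -/

section QE

variable {L : FirstOrder.Language.{u, v}} {G : Type w} [AddCommGroup G] [L.Structure G]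
  {m k : ℕ}

lemma exists_isQF_realize (hqe : HasQE (L.completeTheory G)) {n : ℕ} (φ : L.Formula (Fin n)) :
    ∃ ψ : L.Formula (Fin n), BoundedFormula.IsQF ψ ∧
      ∀ x : Fin n → G, φ.Realize x ↔ ψ.Realize x := by
  obtain ⟨ψ, hψ, h⟩ := hqe n φ
  refine ⟨ψ, hψ, fun x => ?_⟩
  -- The equivalence is given for models in one particular universe. Packed into a sentence, it can
  -- be evaluated in $\mathbb G$ itself.
  have h1 : L.completeTheory G ⊨ᵇ
      (Formula.iAlls (Fin n) ((φ.iff ψ).relabel Sum.inr : L.Formula (Empty ⊕ Fin n))) := by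
    intro M v xs
    rw [BoundedFormula.realize_iAlls]
    intro i
    have h2 := h M i default
    rw [Formula.realize_relabel]
    exact h2
  have h2 := h1.realize_sentence G
  simp only [Sentence.Realize, Formula.realize_iAlls, Formula.realize_relabel,
    Formula.realize_iff, Sum.elim_comp_inr] at h2
  exact h2 x

lemma exists_isQF_baseRealize (hqe : HasQE (L.completeTheory G))
    (φ : L.BoundedFormula (ℕ+ × Fin m) k) : ∃ ψ : L.BoundedFormula (ℕ+ × Fin m) k, ψ.IsQF ∧
      ∀ (B : Type b) [L.Structure B], B ⊨ L.completeTheory G → ∀ (x : ℕ+ × Fin m → B)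
        (y : Fin k → B), φ.Realize x y ↔ ψ.Realize x y := by
  let e := φ.toFormula.freeVarFinset.equivFin
  obtain ⟨ψ, hψ, h⟩ := exists_isQF_realize hqe (BoundedFormula.restrictFreeVar φ.toFormula e)
  refine ⟨BoundedFormula.relabel (k := 0) (fun i => (e.symm i).1) ψ, hψ.relabel _,
    fun B _ hB x y => ?_⟩
  have h1 : φ.Realize x y ↔ Formula.Realize
      (BoundedFormula.restrictFreeVar φ.toFormula e : L.Formula _)
        fun i => Sum.elim x y (e.symm i).1 := by
    refine Iff.trans ?_ (BoundedFormula.realize_restrictFreeVar (Sum.elim x y)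
      (fun a => by simp)).symm
    exact (BoundedFormula.realize_toFormula φ (Sum.elim x y)).symm
  have h2 := (forall_realize_iff hB ((BoundedFormula.restrictFreeVar φ.toFormula e :
    L.Formula _).iff ψ)).2 (fun x => Formula.realize_iff.2 (h x))
  rw [h1, Formula.realize_iff.1 (h2 _)]
  refine (Iff.trans (BoundedFormula.realize_relabel (n := 0)) (iff_of_eq ?_)).symm
  rw [Formula.Realize]
  congr 1
  exact Subsingleton.elim _ _

/-- The only quantifiers left in a cell sit in its base formula, where quantifier elimination for
$T$ applies. -/
lemma exists_isQF_cells (hqe : HasQE (L.completeTheory G)) (l : List (Cell L G m k)) :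
    ∃ ψ : CoverFormula L (ConnSubgroup L G) m k, ψ.IsQF ∧ ∀ (A : Type a) (B : Type b)
      [L.Structure B] (S : CoverStructure L (ConnSubgroup L G) A B), B ⊨ L.completeTheory G →
        ∀ (x : Fin m → A) (y : Fin k → B), ψ.Realize S x y ↔ RealizeAny S l x y := by
  have hneg : ∀ l : List (ConnSubgroup L G m), ∃ ψ : CoverFormula L (ConnSubgroup L G) m k,
      ψ.IsQF ∧ ∀ (A : Type a) (B : Type b) [L.Structure B]
        (S : CoverStructure L (ConnSubgroup L G) A B) (x : Fin m → A) (y : Fin k → B),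
          ψ.Realize S x y ↔ ∀ K ∈ l, x ∉ S.pred K := by
    intro l
    induction l with
    | nil => exact ⟨_, (CoverFormula.IsQF.falsum).not, by simp [CoverFormula.Realize]⟩
    | cons K l ih =>
      obtain ⟨ψ, hψ, h⟩ := ih
      exact ⟨_, (CoverFormula.IsQF.mem K id).not.and hψ, by simp [h]⟩
  induction l with
  | nil => exact ⟨_, .falsum, by simp [CoverFormula.Realize, RealizeAny]⟩
  | cons c l ih =>
    obtain ⟨ψ, hψ, h⟩ := ih
    obtain ⟨χ, hχ, h'⟩ := hneg c.neg
    obtain ⟨θ, hθ, h''⟩ := exists_isQF_baseRealize.{u, v, w, b} hqe c.formula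
    refine ⟨_, (((CoverFormula.IsQF.mem c.pos id).and
      (hχ.and (CoverFormula.isQF_ofBase hθ))).not).imp hψ, fun A B _ S hB x y => ?_⟩
    have h3 : S.BaseRealize θ x y ↔ S.BaseRealize c.formula x y := (h'' B hB _ _).symm
    simp only [CoverFormula.realize_imp, CoverFormula.realize_not, CoverFormula.realize_and,
      CoverFormula.realize_mem, CoverFormula.realize_ofBase, h', h A B S hB, h3, id]
    have h4 : RealizeAny S (c :: l) x y ↔ c.Realize S x y ∨ RealizeAny S l x y := by
      simp [RealizeAny]
    rw [h4, or_iff_not_imp_left]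
    rfl

end QE

/-! ### Models of the theory of the cover satisfy the axioms -/

/-- A group whose addition has a given graph, from axioms on the graph. -/
lemma exists_addCommGroup_of_graph {X : Type*} [Nonempty X] (R : X → X → X → Prop)
    (total : ∀ x y, ∃ z, R x y z) (unique : ∀ x y z z', R x y z → R x y z' → z = z')
    (assoc : ∀ x y z s t r, R x y s → R s z t → R y z r → R x r t)
    (comm : ∀ x y z, R x y z → R y x z) (div : ∀ x y, ∃ z, R z x y) :
    ∃ _ : AddCommGroup X, ∀ x y z, R x y z ↔ x + y = z := by
  choose f hf using total
  choose d hd using div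
  have hR : ∀ x y z, R x y z ↔ f x y = z := fun x y z =>
    ⟨fun h => unique _ _ _ _ (hf x y) h, fun h => h ▸ hf x y⟩
  simp only [hR] at assoc comm hd
  have hassoc : ∀ x y z, f (f x y) z = f x (f y z) := fun x y z =>
    (assoc x y z _ _ _ rfl rfl rfl).symm
  have hcomm : ∀ x y, f x y = f y x := fun x y => (comm x y _ rfl).symm
  obtain ⟨o⟩ := ‹Nonempty X›
  -- The element `d o o` fixes `o` under addition, and every $y$ is the sum of `o` and another
  -- element.
  have hzero : ∀ y, f (d o o) y = y := fun y => by
    rw [← hd o y, hcomm (d o y), ← hassoc, hd]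
  let _ : Add X := ⟨f⟩
  let _ : Zero X := ⟨d o o⟩
  let _ : Neg X := ⟨fun x => d x (d o o)⟩
  let _ : AddGroup X := AddGroup.ofLeftAxioms hassoc hzero fun x => hd _ _
  exact ⟨{ (inferInstance : AddGroup X) with add_comm := hcomm }, hR⟩

section Models

variable {L : FirstOrder.Language.{u, v}} {G : Type w} [AddCommGroup G] [L.Structure G]
  {add : L.Formula (Fin 3)}

lemma realize_relabel_three {α B : Type*} [L.Structure B] (i j k : α) (x : α → B) :
    (add.relabel ![i, j, k]).Realize x ↔ add.Realize ![x i, x j, x k] := by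
  rw [Formula.realize_relabel]
  exact iff_of_eq (congrArg _ (by ext i; fin_cases i <;> rfl))

lemma exists_addCommGroup_definesAdd {B : Type b} [L.Structure B] (hadd : DefinesAdd add G)
    (hB : B ⊨ L.completeTheory G) : ∃ _ : AddCommGroup B, DefinesAdd add B := by
  have hne : Nonempty B := by
    by_contra h
    have := (forall_realize_iff hB (⊥ : L.Formula (Fin 1))).1 fun x => (h ⟨x 0⟩).elim
    simpa using this 0
  have realize : ∀ x y z : G, add.Realize ![x, y, z] ↔ x + y = z := hadd
  obtain ⟨_, h⟩ := exists_addCommGroup_of_graph (fun x y z : B => add.Realize ![x, y, z])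
    (fun x y => by
      have := (forall_realize_iff hB (Formula.iExs (Fin 1)
        (add.relabel ![.inl 0, .inl 1, .inr 0] : L.Formula (Fin 2 ⊕ Fin 1)))).2 (fun x => by
          simp only [Formula.realize_iExs, realize_relabel_three, Sum.elim_inl, Sum.elim_inr,
            realize]
          exact ⟨fun _ => _, rfl⟩) ![x, y]
      simp only [Formula.realize_iExs, realize_relabel_three, Sum.elim_inl, Sum.elim_inr] at this
      obtain ⟨z, hz⟩ := this
      exact ⟨z 0, hz⟩)
    (fun x y z z' h h' => by
      have := (forall_realize_iff hB ((add.relabel ![0, 1, 2]).imp ((add.relabel ![0, 1, 3]).imp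
        (Term.equal (.var 2) (.var 3))) : L.Formula (Fin 4))).2 (fun x => by
          simp only [Formula.realize_imp, realize_relabel_three, realize, Formula.realize_equal,
            Term.realize_var]
          exact fun h h' => h.symm.trans h') ![x, y, z, z']
      simp only [Formula.realize_imp, realize_relabel_three, Formula.realize_equal,
        Term.realize_var] at this
      exact this h h')
    (fun x y z s t r h1 h2 h3 => by
      have := (forall_realize_iff hB ((add.relabel ![0, 1, 3]).imp ((add.relabel ![3, 2, 4]).imp
        ((add.relabel ![1, 2, 5]).imp (add.relabel ![0, 5, 4]))) : L.Formula (Fin 6))).2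
        (fun x => by
          simp only [Formula.realize_imp, realize_relabel_three, realize]
          intro h1 h2 h3
          rw [← h3, ← h2, ← h1, add_assoc]) ![x, y, z, s, t, r]
      simp only [Formula.realize_imp, realize_relabel_three] at this
      exact this h1 h2 h3)
    (fun x y z h => by
      have := (forall_realize_iff hB ((add.relabel ![0, 1, 2]).imp (add.relabel ![1, 0, 2]) :
        L.Formula (Fin 3))).2 (fun x => by
          simp only [Formula.realize_imp, realize_relabel_three, realize]
          intro h
          rw [add_comm, h]) ![x, y, z]
      simp only [Formula.realize_imp, realize_relabel_three] at this
      exact this h)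
    (fun x y => by
      have := (forall_realize_iff hB (Formula.iExs (Fin 1)
        (add.relabel ![.inr 0, .inl 0, .inl 1] : L.Formula (Fin 2 ⊕ Fin 1)))).2 (fun x => by
          simp only [Formula.realize_iExs, realize_relabel_three, Sum.elim_inl, Sum.elim_inr,
            realize]
          exact ⟨fun _ => x 1 - x 0, sub_add_cancel _ _⟩) ![x, y]
      simp only [Formula.realize_iExs, realize_relabel_three, Sum.elim_inl, Sum.elim_inr] at this
      obtain ⟨z, hz⟩ := this
      exact ⟨z 0, hz⟩)
  exact ⟨_, h⟩

variable {A : Type a} {B : Type b} [L.Structure B]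
  {S : CoverStructure L (ConnSubgroup L G) A B} {n m k : ℕ}

lemma realize_ofBase_zero {x : Fin m → A} {y : Fin 0 → B} (φ : L.Formula (ℕ+ × Fin m)) :
    (CoverFormula.ofBase φ).Realize S x y ↔ φ.Realize fun q => S.rho q.1 (x q.2) := by
  rw [CoverFormula.realize_ofBase, CoverStructure.BaseRealize, Formula.Realize,
    Subsingleton.elim y default]

lemma realize_mem_three {x : Fin m → A} {y : Fin k → B} (H : ConnSubgroup L G 3) (i j l : Fin m) :
    (CoverFormula.mem H ![i, j, l]).Realize S x y ↔ ![x i, x j, x l] ∈ S.pred H := by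
  rw [CoverFormula.realize_mem]
  exact iff_of_eq (congrArg (· ∈ S.pred H) (by ext i; fin_cases i <;> rfl))

section Transfer

variable (hM : S.Models (hatTheory L G))
include hM

/-- A universally quantified formula holds in a model of the theory of the cover if and only if it
holds in the cover. -/
lemma forall_coverRealize_iff (φ : CoverFormula L (ConnSubgroup L G) m k) :
    (∀ x y, φ.Realize S x y) ↔ ∀ x y, φ.Realize (hatStructure L G G) x y := by
  have key : ∀ σ : CoverFormula L (ConnSubgroup L G) 0 0,
      σ.Realize S Fin.elim0 Fin.elim0 ↔ σ.Realize (hatStructure L G G) Fin.elim0 Fin.elim0 := by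
    intro σ
    by_cases h : σ.Realize (hatStructure L G G) Fin.elim0 Fin.elim0
    · exact iff_of_true (hM _ h) h
    · exact iff_of_false (hM σ.not h) h
  have := key (CoverFormula.closeBase (CoverFormula.closeCover φ))
  simp only [CoverFormula.realize_closeBase, CoverFormula.realize_closeCover] at this
  rw [forall_comm, this, forall_comm]

lemma models_base : B ⊨ L.completeTheory G := by
  refine ⟨fun ψ hψ => ?_⟩
  have h := (forall_coverRealize_iff hM (CoverFormula.ofBase
    (Formula.relabel Empty.elim ψ : L.Formula (ℕ+ × Fin 0)))).2 (fun x y => by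
      rw [realize_ofBase_zero, Formula.realize_relabel]
      have hψ' : Formula.Realize ψ (default : Empty → G) := mem_completeTheory.1 hψ
      convert! hψ') Fin.elim0 Fin.elim0
  rw [realize_ofBase_zero, Formula.realize_relabel] at h
  rw [Sentence.Realize]
  convert! h

lemma pred_subset_iff (H K : ConnSubgroup L G n) : S.pred H ⊆ S.pred K ↔
    (hatStructure L G G).pred H ⊆ (hatStructure L G G).pred K := by
  have := forall_coverRealize_iff hM (k := 0) (.imp (.mem H id) (.mem K id))
  simp only [CoverFormula.realize_imp, CoverFormula.realize_mem, forall_const, id] at this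
  exact this

lemma pred_eq_iff (H K : ConnSubgroup L G n) : S.pred H = S.pred K ↔
    (hatStructure L G G).pred H = (hatStructure L G G).pred K := by
  simp only [subset_antisymm_iff, pred_subset_iff hM]

lemma exists_addCommGroup_cover (E : Setting L G add) :
    ∃ _ : AddCommGroup A, S.pred E.addGraph = {x | x 0 + x 1 = x 2} := by
  have hne : Nonempty A := by
    by_contra h
    exact (forall_coverRealize_iff hM (.falsum : CoverFormula L (ConnSubgroup L G) 1 0)).1
      (fun x => (h ⟨x 0⟩).elim) 0 0
  have hS0 := hatStructure_coreAxioms E (B := G) inferInstance E.definesAdd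
  have realize : ∀ x y z : Hat G, ![x, y, z] ∈ (hatStructure L G G).pred E.addGraph ↔ x + y = z :=
    fun x y z => hS0.mem_addGraph E
  obtain ⟨_, h⟩ := exists_addCommGroup_of_graph
    (fun x y z : A => ![x, y, z] ∈ S.pred E.addGraph)
    (fun x y => by
      have := (forall_coverRealize_iff hM (m := 2) (k := 0)
        (.exCover (.mem E.addGraph ![0, 1, 2]))).2 (fun x y => by
          simp only [CoverFormula.realize_exCover, realize_mem_three, realize]
          exact ⟨x 0 + x 1, rfl⟩) ![x, y] Fin.elim0
      simp only [CoverFormula.realize_exCover, realize_mem_three] at this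
      exact this)
    (fun x y z z' h h' => by
      have := (forall_coverRealize_iff hM (m := 4) (k := 0) (.imp (.mem E.addGraph ![0, 1, 2])
        (.imp (.mem E.addGraph ![0, 1, 3]) (.eqCover 2 3)))).2 (fun x y => by
          simp only [CoverFormula.realize_imp, realize_mem_three, realize,
            CoverFormula.realize_eqCover]
          exact fun h h' => h.symm.trans h') ![x, y, z, z'] Fin.elim0
      simp only [CoverFormula.realize_imp, realize_mem_three,
        CoverFormula.realize_eqCover] at this
      exact this h h')
    (fun x y z s t r h1 h2 h3 => by
      have := (forall_coverRealize_iff hM (m := 6) (k := 0) (.imp (.mem E.addGraph ![0, 1, 3])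
        (.imp (.mem E.addGraph ![3, 2, 4]) (.imp (.mem E.addGraph ![1, 2, 5])
          (.mem E.addGraph ![0, 5, 4]))))).2 (fun x y => by
          simp only [CoverFormula.realize_imp, realize_mem_three, realize]
          intro h1 h2 h3
          rw [← h3, ← h2, ← h1, add_assoc]) ![x, y, z, s, t, r] Fin.elim0
      simp only [CoverFormula.realize_imp, realize_mem_three] at this
      exact this h1 h2 h3)
    (fun x y z h => by
      have := (forall_coverRealize_iff hM (m := 3) (k := 0) (.imp (.mem E.addGraph ![0, 1, 2])
        (.mem E.addGraph ![1, 0, 2]))).2 (fun x y => by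
          simp only [CoverFormula.realize_imp, realize_mem_three, realize]
          intro h
          rw [add_comm, h]) ![x, y, z] Fin.elim0
      simp only [CoverFormula.realize_imp, realize_mem_three] at this
      exact this h)
    (fun x y => by
      have := (forall_coverRealize_iff hM (m := 2) (k := 0)
        (.exCover (.mem E.addGraph ![2, 0, 1]))).2 (fun x y => by
          simp only [CoverFormula.realize_exCover, realize_mem_three, realize]
          exact ⟨x 1 - x 0, sub_add_cancel _ _⟩) ![x, y] Fin.elim0
      simp only [CoverFormula.realize_exCover, realize_mem_three] at this
      exact this)
  refine ⟨‹_›, Set.ext fun x => ?_⟩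
  rw [Set.mem_ofPred_eq, ← h]
  exact iff_of_eq (congrArg (· ∈ S.pred E.addGraph) (by ext i; fin_cases i <;> rfl))

end Transfer

end Models

/-! ### The axioms as sentences true in the cover -/

section Models

variable {L : FirstOrder.Language.{u, v}} {G : Type w} [AddCommGroup G] [L.Structure G]
  {add : L.Formula (Fin 3)} {A : Type a} {B : Type b} [L.Structure B]
  {S : CoverStructure L (ConnSubgroup L G) A B}

/-- The equation `m ρ_{nm}(x) = ρ_n(x)`. -/
noncomputable def coherentFormula (add : L.Formula (Fin 3)) (n m : ℕ+) : L.Formula (ℕ+ × Fin 1) :=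
  (graphFormula add (.nsmul m (.var (n * m, 0)))).relabel (Sum.elim id fun _ => (n, 0))

lemma realize_coherentFormula {B : Type b} [AddCommGroup B] [L.Structure B] (hB : DefinesAdd add B)
    {n m : ℕ+} {f : ℕ+ × Fin 1 → B} :
    (coherentFormula add n m).Realize f ↔ (m : ℕ) • f (n * m, 0) = f (n, 0) := by
  rw [coherentFormula, Formula.realize_relabel, Sum.comp_elim]
  exact (realize_graphFormula hB _ _ _).trans (by simp)

section

variable (E : Setting L G add)
  (hM : S.Models (hatTheory L G))
include E hM

lemma exists_addSubgroup_pred [AddCommGroup A]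
    (hA : ∀ x y z : A, ![x, y, z] ∈ S.pred E.addGraph ↔ x + y = z) {n : ℕ} (H : ConnSubgroup L G n) :
    ∃ K : AddSubgroup (Fin n → A), (K : Set (Fin n → A)) = S.pred H := by
  have hS0 := hatStructure_coreAxioms E (B := G) inferInstance E.definesAdd
  have hA0 : ∀ x y z : Hat G, ![x, y, z] ∈ (hatStructure L G G).pred E.addGraph ↔ x + y = z :=
    fun x y z => hS0.mem_addGraph E
  have hne : (S.pred H).Nonempty := by
    by_contra! h
    refine (forall_coverRealize_iff hM (k := 0) (CoverFormula.not (.mem H id))).1 (fun x y => ?_)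
      0 0 (hS0.zero_mem_pred H)
    rw [CoverFormula.realize_not, CoverFormula.realize_mem, h]
    exact id
  have hsub : ∀ x ∈ S.pred H, ∀ y ∈ S.pred H, y - x ∈ S.pred H := by
    intro x hx y hy
    -- Only the graph of addition is available, so closure under subtraction is stated for three
    -- blocks of variables $u+v=w$: if $v$ and $w$ lie in the predicate, so does $u$. The blocks are
    -- then taken to be $y-x$, $x$, $y$.
    have h := (forall_coverRealize_iff hM (m := n + n + n) (k := 0)
      (.imp (CoverFormula.conj fun i : Fin n => .mem E.addGraph
        ![Fin.castAdd n (Fin.castAdd n i), Fin.castAdd n (Fin.natAdd n i), Fin.natAdd (n + n) i])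
      (.imp (.mem H fun i => Fin.castAdd n (Fin.natAdd n i))
        (.imp (.mem H (Fin.natAdd (n + n))) (.mem H fun i => Fin.castAdd n (Fin.castAdd n i)))))).2
      (fun z _ => by
        simp only [CoverFormula.realize_imp, CoverFormula.realize_conj, realize_mem_three, hA0]
        intro h1 h2 h3
        exact Set.mem_of_eq_of_mem (funext fun i => eq_sub_of_add_eq (h1 i))
          (hS0.sub_mem_pred H h3 h2)) (Fin.append (Fin.append (y - x) x) y) Fin.elim0
    simp only [CoverFormula.realize_imp, CoverFormula.realize_conj, realize_mem_three, hA,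
      Fin.append_left, Fin.append_right] at h
    simp only [CoverFormula.realize_mem, Fin.append_left, Fin.append_right] at h
    exact h (fun i => sub_add_cancel _ _) hx hy
  obtain ⟨x, hx⟩ := hne
  have h0 : 0 ∈ S.pred H := sub_self x ▸ hsub x hx x hx
  refine ⟨.ofSub (S.pred H) ⟨x, hx⟩ fun x hx y hy => ?_, rfl⟩
  rw [← sub_eq_add_neg]
  exact hsub y hy x hx

lemma rho_coherent [AddCommGroup B] (hB : DefinesAdd add B) (n m : ℕ+) (x : A) :
    (m : ℕ) • S.rho (n * m) x = S.rho n x := by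
  have hS0 := hatStructure_coreAxioms E (B := G) inferInstance E.definesAdd
  have := (forall_coverRealize_iff hM (m := 1) (k := 0)
    (CoverFormula.ofBase (coherentFormula add n m))).2 (fun x y => by
      rw [realize_ofBase_zero, realize_coherentFormula E.definesAdd]
      exact hS0.coherent n m (x 0)) (fun _ => x) Fin.elim0
  rwa [realize_ofBase_zero, realize_coherentFormula hB] at this

lemma rho_image_pred {n : ℕ} (H : ConnSubgroup L G n) (i : ℕ+) :
    (fun (x : Fin n → A) (j : Fin n) => S.rho i (x j)) '' S.pred H = {y | H.formula.Realize y} := by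
  have hS0 := hatStructure_coreAxioms E (B := G) inferInstance E.definesAdd
  ext y
  constructor
  · rintro ⟨x, hx, rfl⟩
    have := (forall_coverRealize_iff hM (m := n) (k := 0) (.imp (.mem H id)
      (CoverFormula.ofBase (H.formula.relabel fun j => (i, j))))).2 (fun x y => by
        rw [CoverFormula.realize_imp, realize_ofBase_zero, Formula.realize_relabel]
        exact fun h => hS0.realize_rho H h i) x Fin.elim0
    rw [CoverFormula.realize_imp, realize_ofBase_zero, Formula.realize_relabel] at this
    exact this hx
  · intro hy
    have := (forall_coverRealize_iff hM (m := 0) (k := n) (.imp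
      (CoverFormula.ofBase (boundVars (H.formula.relabel Sum.inr)))
      (CoverFormula.exCovers n (.and (.mem H (Fin.natAdd 0)) (CoverFormula.conj fun j : Fin n =>
        .eqBase (.var (.inl (i, Fin.natAdd 0 j))) (.var (.inr j))))))).2 (fun x y => by
        rw [CoverFormula.realize_imp, CoverFormula.realize_ofBase, CoverStructure.BaseRealize,
          realize_boundVars, Formula.realize_relabel, Sum.elim_comp_inr,
          CoverFormula.realize_exCovers]
        intro h
        obtain ⟨z, hz, hz'⟩ := hS0.exists_rho_eq H h i
        refine ⟨z, CoverFormula.realize_and.2 ⟨?_, CoverFormula.realize_conj.2 fun j => ?_⟩⟩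
        · simpa only [CoverFormula.realize_mem, Fin.append_right] using hz
        · simp only [CoverFormula.Realize, CoverStructure.termVal, Term.realize_var, Sum.elim_inl,
            Sum.elim_inr, Fin.append_right]
          exact congrFun hz' j) Fin.elim0 y
    rw [CoverFormula.realize_imp, CoverFormula.realize_ofBase, CoverStructure.BaseRealize,
      realize_boundVars, Formula.realize_relabel, Sum.elim_comp_inr,
      CoverFormula.realize_exCovers] at this
    obtain ⟨z, hz⟩ := this hy
    rw [CoverFormula.realize_and, CoverFormula.realize_conj] at hz
    refine ⟨z, by simpa only [CoverFormula.realize_mem, Fin.append_right] using hz.1,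
      funext fun j => ?_⟩
    have h := hz.2 j
    simpa only [CoverFormula.Realize, CoverStructure.termVal, Term.realize_var, Sum.elim_inl,
      Sum.elim_inr, Fin.append_right] using h

lemma pred_inter_ker_eq [AddCommGroup B] (hB : DefinesAdd add B) {n : ℕ}
    (H K : ConnSubgroup L G n) (hle : H.subgroup ≤ K.subgroup)
    (hT : {x | x ∈ H.subgroup ∧ IsOfFinAddOrder x} = {x | x ∈ K.subgroup ∧ IsOfFinAddOrder x}) :
    S.pred H ∩ S.ker n = S.pred K ∩ S.ker n := by
  have hS0 := hatStructure_coreAxioms E (B := G) inferInstance E.definesAdd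
  refine subset_antisymm (Set.inter_subset_inter_left _
    ((pred_subset_iff hM H K).2 (hS0.pred_mono hle))) fun x hx => ⟨?_, hx.2⟩
  have := (forall_coverRealize_iff hM (m := n) (k := 0) (.imp (.mem K id)
    (.imp (CoverFormula.ofBase ((zeroFormula add (Fin n)).relabel fun j => (1, j)))
      (.mem H id)))).2 (fun x y => by
        rw [CoverFormula.realize_imp, CoverFormula.realize_imp, realize_ofBase_zero,
          Formula.realize_relabel, realize_zeroFormula E.definesAdd]
        exact fun h h' => ((Set.ext_iff.1 (hS0.torsion H K hle hT) x).2
          ⟨h, fun i => congrFun h' i⟩).1) x Fin.elim0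
  rw [CoverFormula.realize_imp, CoverFormula.realize_imp, realize_ofBase_zero,
    Formula.realize_relabel, realize_zeroFormula hB] at this
  exact this hx.1 (funext hx.2)

lemma pred_proj [AddCommGroup A] (hA : ∀ x y z : A, ![x, y, z] ∈ S.pred E.addGraph ↔ x + y = z)
    {n m : ℕ} (e : Fin m ↪ Fin n) (F : ConnSubgroup L G n) (H : ConnSubgroup L G m)
    (K₀ : ConnSubgroup L G n) (hFH : F.subgroup.map (coordProj e) = H.subgroup)
    (hK : K₀.subgroup ≤ F.subgroup ⊓ (coordProj e).ker)
    (hi : K₀.subgroup.relIndex (F.subgroup ⊓ (coordProj e).ker) ≠ 0) :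
    coordProj e '' S.pred F = S.pred H ∧
      S.pred K₀ = {x | x ∈ S.pred F ∧ coordProj e x = 0} := by
  have hS0 := hatStructure_coreAxioms E (B := G) inferInstance E.definesAdd
  have hA0 : ∀ x y z : Hat G, ![x, y, z] ∈ (hatStructure L G G).pred E.addGraph ↔ x + y = z :=
    fun x y z => hS0.mem_addGraph E
  obtain ⟨h1, h2⟩ := hS0.proj e F H K₀ hFH hK hi
  refine ⟨Set.ext fun y => ⟨?_, fun hy => ?_⟩, Set.ext fun x => ?_⟩
  · rintro ⟨x, hx, rfl⟩
    exact (forall_coverRealize_iff hM (k := 0) (.imp (.mem F id) (.mem H e))).2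
      (fun x _ hx => (Set.ext_iff.1 h1 _).1 ⟨x, hx, rfl⟩) x Fin.elim0 hx
  · have := (forall_coverRealize_iff hM (m := m) (k := 0) (.imp (.mem H id)
      (CoverFormula.exCovers n (.and (.mem F (Fin.natAdd m)) (CoverFormula.conj fun j : Fin m =>
        .eqCover (Fin.natAdd m (e j)) (Fin.castAdd n j)))))).2 (fun y _ => by
        simp only [CoverFormula.realize_imp, CoverFormula.realize_exCovers,
          CoverFormula.realize_and, CoverFormula.realize_conj, CoverFormula.realize_mem,
          CoverFormula.realize_eqCover, Fin.append_left, Fin.append_right, id]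
        intro hy
        obtain ⟨x, hx, rfl⟩ := (Set.ext_iff.1 h1 y).2 hy
        exact ⟨x, hx, fun j => rfl⟩) y Fin.elim0
    simp only [CoverFormula.realize_imp, CoverFormula.realize_exCovers,
      CoverFormula.realize_and, CoverFormula.realize_conj, CoverFormula.realize_mem,
      CoverFormula.realize_eqCover, Fin.append_left, Fin.append_right, id] at this
    obtain ⟨x, hx, hxy⟩ := this hy
    exact ⟨x, hx, funext hxy⟩
  -- Zero of the first sort has no symbol; an extra variable $z$ with $z+z=z$ stands for it.
  · have := (forall_coverRealize_iff hM (m := n + 1) (k := 0) (.imp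
      (.mem E.addGraph ![Fin.last n, Fin.last n, Fin.last n])
      (.and (.imp (.mem K₀ Fin.castSucc) (.and (.mem F Fin.castSucc)
          (CoverFormula.conj fun j : Fin m => .eqCover (e j).castSucc (Fin.last n))))
        (.imp (.and (.mem F Fin.castSucc)
          (CoverFormula.conj fun j : Fin m => .eqCover (e j).castSucc (Fin.last n)))
          (.mem K₀ Fin.castSucc))))).2 (fun x _ => by
        simp only [CoverFormula.realize_imp, CoverFormula.realize_and, CoverFormula.realize_conj,
          CoverFormula.realize_eqCover, realize_mem_three, hA0, _root_.add_eq_left]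
        intro h0
        rw [h0, CoverFormula.realize_mem, h2, ← iff_def]
        exact and_congr_right fun _ => funext_iff) (Fin.snoc x 0) Fin.elim0
    simp only [CoverFormula.realize_imp, CoverFormula.realize_and, CoverFormula.realize_conj,
      CoverFormula.realize_eqCover, realize_mem_three, hA, _root_.add_eq_left, Fin.snoc_last,
      Fin.snoc_castSucc, forall_const, ← iff_def] at this
    simp only [CoverFormula.realize_mem, Fin.snoc_castSucc] at this
    exact this.trans (and_congr_right fun _ => funext_iff.symm)

end

/-- Every model of the theory of the cover satisfies the axioms. -/
lemma exists_coreAxioms_of_models (E : Setting L G add) (hM : S.Models (hatTheory L G)) :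
    ∃ (_ : AddCommGroup A) (_ : AddCommGroup B), CoreAxioms G add S := by
  have hS0 := hatStructure_coreAxioms E (B := G) inferInstance E.definesAdd
  have hbase := models_base hM
  obtain ⟨_, hA⟩ := exists_addCommGroup_cover hM E
  obtain ⟨_, hB⟩ := exists_addCommGroup_definesAdd E.definesAdd hbase
  have hA' : ∀ x y z : A, ![x, y, z] ∈ S.pred E.addGraph ↔ x + y = z :=
    fun x y z => Set.ext_iff.1 hA _
  refine ⟨‹_›, ‹_›, hbase, hB, fun H hH => ?_, fun H hH => Set.ext fun x => ?_,
    exists_addSubgroup_pred E hM hA', rho_coherent E hM hB, rho_image_pred E hM, fun H K => ?_,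
    pred_inter_ker_eq E hM hB, pred_proj E hM hA'⟩
  · rw [← hA, pred_eq_iff hM, hS0.cover_add H hH]
    exact (Set.ext fun x => hS0.mem_addGraph E).symm
  · have := hS0.diag H hH
    have h1 := (forall_coverRealize_iff hM (m := 2) (k := 0) (.and (.imp (.mem H id)
      (.eqCover 0 1)) (.imp (.eqCover 0 1) (.mem H id)))).2 (fun x _ => by
        rw [CoverFormula.realize_and, CoverFormula.realize_imp, CoverFormula.realize_imp,
          ← iff_def]
        exact Set.ext_iff.1 this x) x Fin.elim0
    rwa [CoverFormula.realize_and, CoverFormula.realize_imp, CoverFormula.realize_imp,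
      ← iff_def] at h1
  · rw [pred_subset_iff hM, ← hS0.lattice]
    have := forall_realize_iff hbase (H.formula.imp K.formula)
    simpa only [Formula.realize_imp] using this

end Models

end ProCover

/-! ### The main theorem -/

theorem mainTheorem5 {L : FirstOrder.Language.{u, v}} (hL : L.card ≤ ℵ₀)
    {G : Type w} [AddCommGroup G] [L.Structure G]
    (add : L.Formula (Fin 3)) (hadd : ProCover.DefinesAdd add G)
    (hdiv : ∀ n : ℕ, 0 < n → ∀ g : G, ∃ h : G, n • h = g)
    (hfmr : ProCover.HasFiniteMorleyRank.{u, v, w} (L.completeTheory G))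
    (hqe : ProCover.HasQE (L.completeTheory G))
    (hacl : ∀ (n : ℕ) (H : AddSubgroup (Fin n → G)), ProCover.IsDefConnected L H →
      ProCover.IsAclEqDefinable L (H : Set (Fin n → G)) →
      (∅ : Set G).Definable L (H : Set (Fin n → G))) :
    ProCover.HasCoverQE (ProCover.hatTheory L G) ∧
    (∀ (A : Type a) (B : Type b) [L.Structure B]
      (S : ProCover.CoverStructure L (ProCover.ConnSubgroup L G) A B),
      S.Models (ProCover.hatTheory L G) ↔ ProCover.SatisfiesAxioms G add S) ∧
    (∀ (G' : Type a) [AddCommGroup G'] [L.Structure G'], ProCover.DefinesAdd add G' →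
      G' ⊨ L.completeTheory G →
      (ProCover.hatStructure L G G').completeTheory = ProCover.hatTheory L G) := by
  have E := ProCover.Setting.of_hasFiniteMorleyRank hadd hdiv hfmr
  have hS0 := ProCover.hatStructure_coreAxioms E (B := G) inferInstance hadd
  refine ⟨fun m k φ => ?_, fun A B _ S => ⟨fun hM => ?_, ?_⟩, fun G' _ _ hadd' hG' =>
    (ProCover.hatStructure_coreAxioms E hG' hadd').completeTheory_eq E hS0⟩
  · obtain ⟨ψ, hψ, h⟩ := ProCover.exists_isQF_cells hqe (ProCover.toCells E φ)
    refine ⟨ψ, hψ, fun A B _ S hM x y => ?_⟩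
    obtain ⟨_, _, hS⟩ := ProCover.exists_coreAxioms_of_models E hM
    rw [h A B S hS.base, hS.realize_toCells E]
  · obtain ⟨_, _, hS⟩ := ProCover.exists_coreAxioms_of_models E hM
    exact ⟨_, _, hS.coverAxioms E⟩
  -- A structure satisfying the axioms has the same complete theory as the standard cover, which
  -- satisfies them too.
  · rintro ⟨_, _, hS⟩ σ hσ
    exact (Set.ext_iff.1 (hS.core.completeTheory_eq E hS0) σ).2 hσ
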